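/- Let $\mathbb F_q$ be a finite field. For a linear code $C\le\mathbb F_q^n$ let $C^\perp$ be its dual for the dot product. An $[[n,k]]$ conjugate code pair over $\mathbb F_q$ is a pair $(C_1,C_2)$ of linear codes in $\mathbb F_q^n$ with $C_2^\perp\le C_1$ and $k=\dim C_1+\dim C_2-n$; its rate is $k/n$. A syndrome decoder of a quotient code $C/B$ (where $B\le C$) is a function $g$ that estimates the additive error from the received word $y$ and depends only on the syndrome of $y$, i.e. on $y+C$; if the coordinates of the error $e$ are independent with distribution $W$ on $\mathbb F_q$ (additive memoryless channel $W$), its error probability is $\Pr[e-g(e)\notin B]$. For a conjugate pair $(C_1,C_2)$ and syndrome decoders of $C_1/C_2^\perp$ on a channel $W_1$ and of $C_2/C_1^\perp$ on a channel $W_2$ (possibly $W_1=W_2$), the error probability of the pair is the maximum $P=\max\{P_1,P_2\}$ of the two error probabilities. The concatenation of an $[[n,k]]$ pair $(C_1,C_2)$ over $\mathbb F_q$ (inner codes) and an $[[N,K]]$ pair $(D_1,D_2)$ over $\mathbb F_{q^k}$ (outer codes) is the pair $L_1=\pi_1(D_1)+\bigoplus_{i=1}^N C_2^\perp$, $L_2=[\pi_1(D_2^\perp)+\bigoplus_{i=1}^N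 C_2^\perp]^\perp$ of codes of length $N_{\rm o}=nN$, where $\pi_1$ replaces each symbol $\sum_j x_j\beta_j\in\mathbb F_{q^k}$ by the block $\sum_j x_jg_j\in\mathbb F_q^n$; here $(\beta_j)$, $(\beta'_j)$ are bases of $\mathbb F_{q^k}$ over $\mathbb F_q$ that are dual for the trace form, and $g_1,\dots,g_k$, $g_1',\dots,g_k'$ are vectors with $C_1=C_2^\perp+\mathrm{span}\{g_j\}$, $C_2=C_1^\perp+\mathrm{span}\{g'_j\}$ and $g_l\cdot g'_m=\delta_{lm}$. Decoders for a sequence of codes are said to have polynomial complexity if the decoder of each code of the sequence is computed by a straight-line algorithm (circuit) whose number of elementary steps, each of which applies a binary operation $\mathbb F_q\times\mathbb F_q\to\mathbb F_q$, is bounded by a fixed polynomial in the length of the code. **Theorem.** Let $W_1,W_2$ be additive memoryless channels over $\mathbb F_q$, let $E$ be a continuous real function on $[\frac12,1]$, and let $a_n$ be bounded above by a polynomial in $n$. Assume that for every $0<r<1$ there is a sequence of $[[n,k]]$ conjugate code pairs over $\mathbb F_q$ with $n\to\infty$ and $k/n\to r$, with syndrome decoders for which $$P\le a_n\,q^{-nE((1+r_{\rm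 q})/2)},\qquad r_{\rm q}=k/n .$$ Then for every $R_{\rm o}\in[0,1]$ there is a sequence of $[[N_{\rm o},K_{\rm o}]]$ conjugate code pairs $(L_1,L_2)$ over $\mathbb F_q$ with $N_{\rm o}\to\infty$, each being the concatenation of an inner $[[n,k]]$ pair that satisfies the above bound and an outer conjugate pair of two generalized Reed–Solomon codes over $\mathbb F_{q^k}$ of the same dimension, together with syndrome decoders of $L_1/L_2^\perp$ and $L_2/L_1^\perp$, such that (i) $K_{\rm o}/N_{\rm o}\to R_{\rm o}$; (ii) the error probability $P_{\rm e}$ of $(L_1,L_2)$ with these decoders satisfies $$\limsup_{N_{\rm o}\to\infty}-\frac1{N_{\rm o}}\log_q P_{\rm e}\ \ge\ \frac14\max_{rR=R_{\rm o}}(1-R)\,E\big((1+r)/2\big),$$ where the maximum is over $\{(r,R)\mid 0\le r\le1,\ 0\le R\le1,\ rR=R_{\rm o}\}$ (and it exists); (iii) the decoders of $L_1/L_2^\perp$ and of $L_2/L_1^\perp$ both have polynomial complexity. Moreover, the rate $1-2h(p)$ is achievable on the binary symmetric channel with polynomial decoding: if $q=2$, $0\le p\le1$ and $1-2h(p)\ge0$,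 where $h$ is the binary entropy function (in bits), then there is a sequence of such concatenated conjugate code pairs with generalized Reed–Solomon outer codes (here the inner pairs are arbitrary conjugate code pairs), with $N_{\rm o}\to\infty$, rates tending to $1-2h(p)$, and syndrome decoders of polynomial complexity for both quotient codes, whose error probability $P_{\rm e}$ for $W_1=W_2=$ the binary symmetric channel with flip probability $p$ tends to $0$. -/

import Mathlib

open Filter Topology

universe u

noncomputable section

/-! ### Linear codes, duals, conjugate code pairs -/

/-- The dual code `C^⊥` for the dot product. -/
def dualCode {K ι : Type*} [Field K] [Fintype ι] (C : Submodule K (ι → K)) :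
    Submodule K (ι → K) where
  carrier := {y | ∀ x ∈ C, x ⬝ᵥ y = 0}
  add_mem' := by
    intro y z hy hz x hx
    rw [dotProduct_add, hy x hx, hz x hx, add_zero]
  zero_mem' := by
    intro x _
    exact dotProduct_zero x
  smul_mem' := by
    intro c y hy x hx
    rw [dotProduct_smul, hy x hx, smul_zero]

/-- `(C₁, C₂)` is an `[[n, k]]` conjugate code pair (`n` is the number of coordinates):
`C₂^⊥ ≤ C₁` and `k = k₁ + k₂ - n`, where `kᵢ = dim Cᵢ`. -/
structure IsConjugatePair {K ι : Type*} [Field K] [Fintype ι]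
    (C₁ C₂ : Submodule K (ι → K)) (k : ℕ) : Prop where
  dual_le : dualCode C₂ ≤ C₁
  dim_eq : Module.finrank K C₁ + Module.finrank K C₂ = Fintype.card ι + k

/-! ### Syndrome decoding of quotient codes on additive memoryless channels -/

/-- A syndrome decoder for the code `C`: the estimate `g y` of the error pattern depends on the
received word `y` only through its syndrome, that is, only through the coset `y + C`.
The word `y` is then corrected to `y - g y`. -/
def IsSyndromeDecoder {F ι : Type*} [Field F] (C : Submodule F (ι → F))
    (g : (ι → F) → (ι → F)) : Prop :=
  ∀ y, ∀ c ∈ C, g (y + c) = g y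

open Classical in
/-- The error probability of the syndrome decoder `g` for a quotient code `C / B`, when the
coordinates of the additive error `e` are independent with common distribution `W`.
If `x ∈ C` is sent, then `x + e` is corrected to `x + (e - g e)`, which lies in the coset of `x`
modulo `B` exactly if `e - g e ∈ B`. -/
def decodingErrorProb {F ι : Type*} [Field F] [Fintype F] [Fintype ι]
    (W : F → ℝ) (B : Submodule F (ι → F)) (g : (ι → F) → (ι → F)) : ℝ :=
  ∑ e : ι → F, if e - g e ∈ B then 0 else ∏ i, W (e i)

open Classical in
/-- Binary symmetric channel with flip probability `p` (for a field with two elements):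
distribution of the additive error. -/
def bsc (F : Type*) [Field F] (p : ℝ) : F → ℝ :=
  fun x => if x = 0 then 1 - p else p

/-- The exponent `-(1/n) log_q P`, equal to `⊤` if `P = 0`. -/
def errorExponent (q n : ℕ) (P : ℝ) : EReal :=
  -(ENNReal.log (ENNReal.ofReal P)) / (((n : ℝ) * Real.log (q : ℝ) : ℝ) : EReal)

/-- `(C₁, C₂)` is an `[[n, k]]` conjugate code pair and the quotient codes `C₁ / C₂^⊥` (on the
channel `W₁`) and `C₂ / C₁^⊥` (on the channel `W₂`) have syndrome decoders whose error
probabilities `P₁, P₂` satisfy `max P₁ P₂ ≤ a_n q^(-n E((1 + k/n)/2))`. -/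
def AttainsBound {F : Type*} [Field F] [Fintype F] (W₁ W₂ : F → ℝ) (E : ℝ → ℝ) (a : ℕ → ℝ)
    {n : ℕ} (k : ℕ) (C₁ C₂ : Submodule F (Fin n → F)) : Prop :=
  IsConjugatePair C₁ C₂ k ∧
  ∃ g₁ g₂ : (Fin n → F) → (Fin n → F),
    IsSyndromeDecoder C₁ g₁ ∧ IsSyndromeDecoder C₂ g₂ ∧
    max (decodingErrorProb W₁ (dualCode C₂) g₁) (decodingErrorProb W₂ (dualCode C₁) g₂) ≤
      a n * (Fintype.card F : ℝ) ^ (-((n : ℝ) * E ((1 + (k : ℝ) / (n : ℝ)) / 2)))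

/-! ### Generalized Reed-Solomon codes and concatenation -/

/-- `D` is a generalized Reed-Solomon code of length `N` and dimension `κ`: for distinct `αᵢ` and
nonzero `vᵢ`, it consists of the words `(vᵢ f(αᵢ))ᵢ` with `f` a polynomial of degree `< κ`. -/
def IsGRS {K : Type*} [Field K] {N : ℕ} (D : Submodule K (Fin N → K)) (κ : ℕ) : Prop :=
  κ ≤ N ∧ ∃ α v : Fin N → K, Function.Injective α ∧ (∀ i, v i ≠ 0) ∧
    ∀ c : Fin N → K, c ∈ D ↔
      ∃ f : Polynomial K, f.degree < (κ : WithBot ℕ) ∧ ∀ i, c i = v i * f.eval (α i)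

/-- The map `π`: the symbol `∑ⱼ xⱼ βⱼ` in each position is replaced by the block `∑ⱼ xⱼ gⱼ`. -/
def concatMap {F K : Type*} [Field F] [Field K] [Algebra F K] {n k : ℕ} (N : ℕ)
    (β : Module.Basis (Fin k) F K) (g : Fin k → Fin n → F) :
    (Fin N → K) →ₗ[F] (Fin N × Fin n → F) where
  toFun x := fun p => ∑ j, β.repr (x p.1) j * g j p.2
  map_add' := by
    intro x y
    funext p
    simp [add_mul, Finset.sum_add_distrib]
  map_smul' := by
    intro c x
    funext p
    simp [mul_assoc, Finset.mul_sum]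

/-- The code whose words are the concatenations of `N` words of `B`. -/
def blockSum {F : Type*} [Field F] {n : ℕ} (N : ℕ) (B : Submodule F (Fin n → F)) :
    Submodule F (Fin N × Fin n → F) where
  carrier := {y | ∀ i, (fun t => y (i, t)) ∈ B}
  add_mem' := fun hy hz i => B.add_mem (hy i) (hz i)
  zero_mem' := fun _ => B.zero_mem
  smul_mem' := fun c _ hy i => B.smul_mem c (hy i)

/-- `(L₁, L₂)` is a concatenation of the inner pair `(C₁, C₂)` over `F` and the outer pair
`(D₁, D₂)` over the extension `K` of degree `k`:
`L₁ = π₁(D₁) + ⨁ C₂^⊥` and `L₂ = [π₁(D₂^⊥) + ⨁ C₂^⊥]^⊥`, where `π₁` is built from vectors `g, g'`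
with `C₁ = C₂^⊥ + span g`, `C₂ = C₁^⊥ + span g'`, `g_l · g'_m = δ_lm`, and from bases `β, β'` of `K`
over `F` that are dual to each other for the trace form. -/
def IsConcatenation {F K : Type*} [Field F] [Field K] [Algebra F K] {n N : ℕ} (k : ℕ)
    (C₁ C₂ : Submodule F (Fin n → F)) (D₁ D₂ : Submodule K (Fin N → K))
    (L₁ L₂ : Submodule F (Fin N × Fin n → F)) : Prop :=
  ∃ (g g' : Fin k → Fin n → F) (β β' : Module.Basis (Fin k) F K),
    C₁ = dualCode C₂ ⊔ Submodule.span F (Set.range g) ∧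
    C₂ = dualCode C₁ ⊔ Submodule.span F (Set.range g') ∧
    (∀ l m, g l ⬝ᵥ g' m = if l = m then 1 else 0) ∧
    (∀ l m, Algebra.trace F K (β l * β' m) = if l = m then 1 else 0) ∧
    L₁ = (D₁.restrictScalars F).map (concatMap N β g) ⊔ blockSum N (dualCode C₂) ∧
    L₂ = dualCode
      (((dualCode D₂).restrictScalars F).map (concatMap N β g) ⊔ blockSum N (dualCode C₂))

/-- A concatenation `(L₁, L₂)` of an inner `[[n, k]]` conjugate code pair over `F` and an outer
`[[N, κ]]` conjugate code pair over the extension of `F` of degree `k`, the two outer codes being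
generalized Reed-Solomon codes of the same dimension `κ₁`. -/
structure GRSConcatenation (F : Type u) [Field F] where
  (n k N κ κ₁ : ℕ)
  n_pos : 0 < n
  k_pos : 0 < k
  N_pos : 0 < N
  (C₁ C₂ : Submodule F (Fin n → F))
  inner_pair : IsConjugatePair C₁ C₂ k
  Ext : Type u
  extField : Field Ext
  extAlgebra : Algebra F Ext
  (D₁ D₂ : Submodule Ext (Fin N → Ext))
  grs₁ : IsGRS D₁ κ₁
  grs₂ : IsGRS D₂ κ₁
  outer_pair : IsConjugatePair D₁ D₂ κ
  (L₁ L₂ : Submodule F (Fin N × Fin n → F))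
  isConcatenation : IsConcatenation k C₁ C₂ D₁ D₂ L₁ L₂

/-- The overall length `N_o = nN`. -/
def GRSConcatenation.length {F : Type u} [Field F] (S : GRSConcatenation F) : ℕ := S.n * S.N

/-- The overall dimension `K_o = kκ`. -/
def GRSConcatenation.dim {F : Type u} [Field F] (S : GRSConcatenation F) : ℕ := S.k * S.κ

/-- The words of length `N_o` over `F`, as `N` blocks of `n` symbols. -/
abbrev GRSConcatenation.Word {F : Type u} [Field F] (S : GRSConcatenation F) : Type u :=
  Fin S.N × Fin S.n → F

/-! ### Complexity: number of steps of straight-line algorithms -/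

/-- The operands available at step `m` of a computation whose step `j` yields `w j`: the input
symbols, the constants, and the results of the steps `j < m`. -/
def IsOperand {A ι : Type*} {s : ℕ} (w : Fin s → (ι → A) → A) (m : ℕ) (u : (ι → A) → A) : Prop :=
  (∃ t : ι, u = fun x => x t) ∨ (∃ c : A, u = fun _ => c) ∨ ∃ j : Fin s, j.val < m ∧ u = w j

/-- `f` is computed in `s` elementary steps (by a circuit with `s` gates over the alphabet `A`):
each step applies some binary operation `A → A → A` to two operands available at that step,
and each output symbol is one of the operands available in the end. -/
def ComputableInSteps {A ι κ : Type*} (s : ℕ) (f : (ι → A) → (κ → A)) : Prop :=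
  ∃ w : Fin s → (ι → A) → A,
    (∀ i : Fin s, ∃ (op : A → A → A) (u v : (ι → A) → A),
      IsOperand w i.val u ∧ IsOperand w i.val v ∧ w i = fun x => op (u x) (v x)) ∧
    ∀ o : κ, IsOperand w s (fun x => f x o)

/-- `g₁ j`, `g₂ j` are syndrome decoders for the quotient codes `L₁ / L₂^⊥`, `L₂ / L₁^⊥` of the
`j`-th pair, and both are of polynomial complexity in the overall length. -/
def ArePolynomialDecoders {F : Type u} [Field F] (S : ℕ → GRSConcatenation F)
    (g₁ g₂ : (j : ℕ) → (S j).Word → (S j).Word) : Prop :=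
  (∀ j, IsSyndromeDecoder (S j).L₁ (g₁ j) ∧ IsSyndromeDecoder (S j).L₂ (g₂ j)) ∧
  ∃ p : Polynomial ℕ, ∀ j,
    (∃ s, s ≤ p.eval (S j).length ∧ ComputableInSteps s (g₁ j)) ∧
    (∃ s, s ≤ p.eval (S j).length ∧ ComputableInSteps s (g₂ j))

/-- `P_e`, the larger one of the error probabilities of the decoders `g₁` of `L₁ / L₂^⊥` on `W₁` and
`g₂` of `L₂ / L₁^⊥` on `W₂`. -/
def GRSConcatenation.errorProb {F : Type u} [Field F] [Fintype F] (S : GRSConcatenation F)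
    (W₁ W₂ : F → ℝ) (g₁ g₂ : S.Word → S.Word) : ℝ :=
  max (decodingErrorProb W₁ (dualCode S.L₂) g₁) (decodingErrorProb W₂ (dualCode S.L₁) g₂)

end

/-! Let `(C₁, C₂)` be an inner `[[n, k]]` pair and put `h = ⌊q ^ k / 2⌋`, `N = 2h`. For distinct
points `αᵢ` of the field `K` with `q ^ k` elements, the dual of the code of evaluations of the
polynomials of degree `< m` is a generalized Reed-Solomon code, whose multipliers are the Lagrange
weights of the `αᵢ`. So the outer pairs can be given any common dimension `κ₁ = h + j`, `j ≤ h`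
(`exists_grs_conjugatePair`). The concatenation is symmetric: expanding `D₂` in the trace-dual
basis and the vectors `g'` gives `L₂ = π₂(D₂) + ⨁ C₁^⊥` (`IsConcatenation.symm`), so it suffices to
decode `L₁ / L₂^⊥`.

Decoding. Each block is corrected by the inner decoder, and read as a symbol of `K`. The inner
decoder is a table of `q ^ n` entries; as `N` is about `q ^ k` and `k / n` stays away from `0`, this
is polynomial in the length. The outer decoder of Berlekamp and Welch finds `(Λ, G)` with
`Λ(αᵢ) yᵢ = vᵢ G(αᵢ)` by eliminating one linear condition after the other, and then solves another
such system, which yields the word itself without a polynomial division (`rsDecode`). Its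
operations on `K` are again tables over `F` of polynomial size. The result is a
circuit which corrects every error pattern that defeats the inner decoder in at most `t` of the
`N` blocks, where `t` is about `(N - κ₁) / 2`. A decoder has to be a function of the syndrome, so it
is applied to a linear representative of the coset `y + L₁`.
The blocks are independent and there are at most `2 ^ N` sets of blocks, whence
`P_e ≤ 2 ^ N P ^ (t + 1)` (`IsConcatenation.exists_decoder`). The factor `2 ^ N` is negligible in the
exponent as the block length `n` grows, and `t / N` tends to `(1 - R) / 4`, if the outer rate
`κ / N` tends to `R`.

The maximum over `r R = R₀` is attained at some `(r, R)` by compactness. If `r > 0`, the inner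
rates are chosen in `[r / 2, r)` and tend to `r`, so that a single polynomial bounds the
complexity. If `r = 0`, then `R₀ = 0`, and the pairs of dimension `0` will do: for them
`L₁ = L₂^⊥`, so that every error is harmless once the syndrome is matched.

For the binary symmetric channel, inner pairs with vanishing error probability at every rate below
`1 - 2h(p)` come from the images of a coordinate pair under all invertible matrices: on average over
them, maximum likelihood decoding satisfies Gallager's bound
`P ≤ (∑ W(x) ^ (1 - s)) ^ n q ^ (-s m)`, `m` being the codimension of `C₁` and of `C₂`
(`exists_good_conjugatePair`), and `s → 0` gives exponential decay as soon as `m / n > h(p)`. -/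

/-! ### Straight-line programs -/

/-- `StraightLine s S T`: starting from the available functions `S`, a straight-line program of `s`
gates makes exactly the functions in `T` available (the new functions are added to `S`). -/
inductive StraightLine {X A : Type*} : ℕ → Set (X → A) → Set (X → A) → Prop
  | refl (S : Set (X → A)) : StraightLine 0 S S
  | step {s : ℕ} {S T : Set (X → A)} (op : A → A → A) {u v : X → A} :
      StraightLine s S T → u ∈ T → v ∈ T →
      StraightLine (s + 1) S (insert (fun x => op (u x) (v x)) T)

/-- All functions in `T` can be computed from those in `S` by a straight-line program with at most
`s` gates. Sharing of intermediate results is accounted for: `T` is a set of functions, and one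
program computes all of them. -/
def Derivable {X A : Type*} (S : Set (X → A)) (s : ℕ) (T : Set (X → A)) : Prop :=
  ∃ r ≤ s, ∃ T', StraightLine r S T' ∧ T ⊆ T'

section Circuits

variable {X A : Type*} {S S' T T' U : Set (X → A)} {s t : ℕ}

theorem StraightLine.subset (h : StraightLine s S T) : S ⊆ T := by
  induction h with
  | refl S => exact subset_rfl
  | step op _ _ _ ih => exact ih.trans (Set.subset_insert _ _)

theorem StraightLine.trans (h : StraightLine s S T) (h' : StraightLine t T U) :
    StraightLine (s + t) S U := by
  induction h' with
  | refl S => exact h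
  | step op _ hu hv ih => exact StraightLine.step op (ih h) hu hv

theorem StraightLine.union_right (h : StraightLine s S T) (U : Set (X → A)) :
    StraightLine s (S ∪ U) (T ∪ U) := by
  induction h with
  | refl S => exact .refl _
  | step op _ hu hv ih =>
    rw [Set.insert_union]
    exact .step op ih (Or.inl hu) (Or.inl hv)

theorem Derivable.of_subset (h : T ⊆ S) : Derivable S 0 T :=
  ⟨0, le_rfl, S, .refl S, h⟩

theorem Derivable.mono (h : Derivable S s T) (hS : S ⊆ S') (hs : s ≤ t) (hT : U ⊆ T) :
    Derivable S' t U := by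
  obtain ⟨r, hr, T', hg, hT'⟩ := h
  refine ⟨r, hr.trans hs, T' ∪ S', ?_, hT.trans (hT'.trans Set.subset_union_left)⟩
  have := hg.union_right S'
  rwa [Set.union_eq_right.2 hS] at this

theorem Derivable.trans (h : Derivable S s T) (h' : Derivable (S ∪ T) t U) :
    Derivable S (s + t) (T ∪ U) := by
  obtain ⟨r, hr, V, hg, hV⟩ := h
  obtain ⟨r', hr', V', hg', hV'⟩ :=
    h'.mono (Set.union_subset hg.subset hV) le_rfl subset_rfl
  exact ⟨r + r', by omega, V', hg.trans hg', Set.union_subset (hV.trans hg'.subset) hV'⟩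

theorem Derivable.gate (op : A → A → A) {u v : X → A} (hu : u ∈ S) (hv : v ∈ S) :
    Derivable S 1 {fun x => op (u x) (v x)} :=
  ⟨1, le_rfl, _, .step op (.refl S) hu hv, by simp⟩

theorem Derivable.iUnion {κ : Type*} [Fintype κ] {T : κ → Set (X → A)}
    (h : ∀ j, Derivable S s (T j)) : Derivable S (Fintype.card κ * s) (⋃ j, T j) := by
  classical
  have key : ∀ J : Finset κ, Derivable S (J.card * s) (⋃ j ∈ J, T j) := by
    intro J
    induction J using Finset.induction_on with
    | empty => exact (Derivable.of_subset (by simp)).mono subset_rfl (Nat.zero_le _) subset_rfl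
    | insert a J ha ih =>
      refine (ih.trans ((h a).mono Set.subset_union_left le_rfl subset_rfl)).mono subset_rfl
        ?_ ?_
      · rw [Finset.card_insert_of_notMem ha]; ring_nf; rfl
      · simp [Set.union_comm]
  exact (key Finset.univ).mono subset_rfl le_rfl (by simp)

theorem Derivable.range {κ : Type*} [Fintype κ] {φ : κ → X → A}
    (h : ∀ j, Derivable S s {φ j}) : Derivable S (Fintype.card κ * s) (Set.range φ) :=
  (Derivable.iUnion h).mono subset_rfl le_rfl (by simp)

/-- The operands available before the first step: input symbols and constants. -/
def inputsAndConstants (ι A : Type*) : Set ((ι → A) → A) :=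
  {u | (∃ t : ι, u = fun x => x t) ∨ ∃ c : A, u = fun _ => c}

theorem IsOperand.snoc {ι : Type*} {w : Fin s → (ι → A) → A} {m : ℕ} {u : (ι → A) → A}
    (h : IsOperand w m u) (a : (ι → A) → A) :
    IsOperand (Fin.snoc (α := fun _ => (ι → A) → A) w a) m u := by
  rcases h with h | h | ⟨j, hj, rfl⟩
  · exact Or.inl h
  · exact Or.inr (Or.inl h)
  · exact Or.inr (Or.inr ⟨j.castSucc, by simpa using hj, by simp⟩)

theorem IsOperand.mono {ι : Type*} {w : Fin s → (ι → A) → A} {m m' : ℕ} {u : (ι → A) → A}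
    (h : IsOperand w m u) (hm : m ≤ m') : IsOperand w m' u := by
  rcases h with h | h | ⟨j, hj, rfl⟩
  · exact Or.inl h
  · exact Or.inr (Or.inl h)
  · exact Or.inr (Or.inr ⟨j, hj.trans_le hm, rfl⟩)

theorem Derivable.computableInSteps {ι κ : Type*} {f : (ι → A) → (κ → A)}
    (h : Derivable (inputsAndConstants ι A) s (Set.range fun o x => f x o)) :
    ∃ r ≤ s, ComputableInSteps r f := by
  obtain ⟨r, hr, T, hg, hT⟩ := h
  have key : ∀ {r : ℕ} {S T : Set ((ι → A) → A)}, StraightLine r S T →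
      S = inputsAndConstants ι A → ∃ w : Fin r → (ι → A) → A,
      (∀ i : Fin r, ∃ (op : A → A → A) (u v : (ι → A) → A),
        IsOperand w i.val u ∧ IsOperand w i.val v ∧ w i = fun x => op (u x) (v x)) ∧
      ∀ u ∈ T, IsOperand w r u := by
    intro r S T h
    induction h with
    | refl S =>
      rintro rfl
      refine ⟨Fin.elim0, fun i => i.elim0, fun u hu => ?_⟩
      rcases hu with hu | hu
      · exact Or.inl hu
      · exact Or.inr (Or.inl hu)
    | @step r S T op u v _ hu hv ih =>
      intro hS
      obtain ⟨w, hw, hop⟩ := ih hS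
      refine ⟨Fin.snoc (α := fun _ => (ι → A) → A) w (fun x => op (u x) (v x)), ?_, ?_⟩
      · intro i
        refine Fin.lastCases ?_ (fun i => ?_) i
        · exact ⟨op, u, v, (hop u hu).snoc _, (hop v hv).snoc _, by simp⟩
        · obtain ⟨op', u', v', h1, h2, h3⟩ := hw i
          exact ⟨op', u', v', h1.snoc _, h2.snoc _, by simpa using h3⟩
      · intro u' hu'
        rcases hu' with rfl | hu'
        · exact Or.inr (Or.inr ⟨Fin.last r, by simp, by simp⟩)
        · exact ((hop u' hu').snoc _).mono (Nat.le_succ r)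
  obtain ⟨w, hw, hop⟩ := key hg rfl
  exact ⟨r, hr, w, hw, fun o => hop _ (hT ⟨o, rfl⟩)⟩

/-- A sum of gates. With `op` a multiplication this covers inner products, and with constant second
operands linear forms. -/
theorem Derivable.sum [AddCommMonoid A] {κ : Type*} [Fintype κ] (op : κ → A → A → A)
    {u v : κ → X → A} (h0 : (fun _ => 0) ∈ S) (hu : ∀ j, u j ∈ S) (hv : ∀ j, v j ∈ S) :
    Derivable S (2 * Fintype.card κ) {fun x => ∑ j, op j (u j x) (v j x)} := by
  classical
  have key : ∀ J : Finset κ,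
      Derivable S (2 * J.card) {fun x => ∑ j ∈ J, op j (u j x) (v j x)} := by
    intro J
    induction J using Finset.induction_on with
    | empty => exact (Derivable.of_subset (by simpa using h0)).mono subset_rfl (by simp) subset_rfl
    | insert a J ha ih =>
      have h1 : Derivable S (2 * J.card + 1) _ :=
        ih.trans (Derivable.gate (op a) (Or.inl (hu a)) (Or.inl (hv a)))
      refine (h1.trans (Derivable.gate (fun a b => a + b) (u := fun x => op a (u a x) (v a x))
        (v := fun x => ∑ j ∈ J, op j (u j x) (v j x)) ?_ ?_)).mono subset_rfl ?_ ?_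
      · simp
      · simp
      · rw [Finset.card_insert_of_notMem ha]; omega
      · simp [Finset.sum_insert ha]
  exact key Finset.univ

theorem Derivable.linearForm [Semiring A] {κ : Type*} [Fintype κ] (c : κ → A)
    {u : κ → X → A} (h0 : (fun _ => 0) ∈ S) (hu : ∀ j, u j ∈ S) :
    Derivable S (2 * Fintype.card κ) {fun x => ∑ j, c j * u j x} :=
  Derivable.sum (fun j a _ => c j * a) h0 hu hu

/-- Table lookup: an arbitrary function of `m` available symbols. The table is read one variable at
a time, `φ(a₀, a') = ∑ₐ [a₀ = a] φ(a, a')`. -/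
theorem Derivable.lookup [AddCommMonoid A] [Fintype A] [Nontrivial A]
    (hc : ∀ c : A, (fun _ => c) ∈ S) {m : ℕ} (φ : (Fin m → A) → A) {u : Fin m → X → A}
    (hu : ∀ i, u i ∈ S) :
    Derivable S (2 * Fintype.card A ^ (m + 1)) {fun x => φ fun i => u i x} := by
  classical
  have hq : 2 ≤ Fintype.card A := Fintype.one_lt_card
  have key : ∀ (m : ℕ) (φ : (Fin m → A) → A) (u : Fin m → X → A), (∀ i, u i ∈ S) →
      ∃ s, s + 2 * Fintype.card A ≤ 2 * Fintype.card A ^ (m + 1) ∧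
        Derivable S s {fun x => φ fun i => u i x} := by
    intro m
    induction m with
    | zero =>
      intro φ u _
      refine ⟨0, by simp, Derivable.of_subset ?_⟩
      have : (fun x => φ fun i => u i x) = fun _ => φ Fin.elim0 := by
        funext x; congr 1; funext i; exact i.elim0
      rw [this]
      simpa using hc _
    | succ m ih =>
      intro φ u hu
      let ψ : A → X → A := fun a x => φ (Fin.cons a fun i => u i.succ x)
      choose! s hs hd using fun a : A => ih (fun y => φ (Fin.cons a y)) (fun i => u i.succ)
        (fun i => hu i.succ)
      have h1 : Derivable S _ (Set.range ψ) := Derivable.range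
        (s := 2 * Fintype.card A ^ (m + 1) - 2 * Fintype.card A)
        (fun a => (hd a).mono subset_rfl (by have := hs a; omega) subset_rfl)
      have h2 := h1.trans (Derivable.sum (fun a b c => if b = a then c else 0)
        (u := fun _ => u 0) (v := ψ) (Or.inl (hc 0)) (fun _ => Or.inl (hu 0))
        (fun a => Or.inr ⟨a, rfl⟩))
      refine ⟨_, ?_, h2.mono subset_rfl le_rfl ?_⟩
      · have h3 : 2 * Fintype.card A ≤ 2 * Fintype.card A ^ (m + 1) := by
          rw [pow_succ]
          have : 0 < Fintype.card A ^ m := by positivity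
          nlinarith
        obtain ⟨d, hd⟩ := Nat.exists_eq_add_of_le h3
        rw [pow_succ _ (m + 1), ← mul_assoc, hd]
        simp only [Nat.add_sub_cancel_left]
        nlinarith
      · refine Set.singleton_subset_iff.2 (Or.inr ?_)
        rw [Set.mem_singleton_iff]
        funext x
        rw [Finset.sum_eq_single (u 0 x) (by
          intro b _ hb; rw [if_neg (Ne.symm hb)]) (by simp)]
        simp only [if_true, ψ]
        congr 1
        funext i
        refine Fin.cases ?_ (fun i => ?_) i <;> simp
  obtain ⟨s, hs, hd⟩ := key m φ u hu
  exact hd.mono subset_rfl (by omega) subset_rfl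

/-- The `F`-valued coordinates, with respect to `e : K ≃ F^k`, of a set of `K`-valued functions. -/
def coordSet {F K : Type*} {k : ℕ} (e : K ≃ (Fin k → F)) (S : Set (X → K)) : Set (X → F) :=
  {u | ∃ φ ∈ S, ∃ j, u = fun x => e (φ x) j}

/-- Passing to a smaller alphabet: each gate over `K` is simulated by `k` table lookups over `F`,
with `2k` variables each. -/
theorem Derivable.changeAlphabet {F K : Type*} [AddCommMonoid F] [Fintype F] [Nontrivial F] {k : ℕ}
    (e : K ≃ (Fin k → F)) {S T : Set (X → K)} {S' : Set (X → F)} (h : Derivable S s T)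
    (hS : coordSet e S ⊆ S') (hc : ∀ c : F, (fun _ => c) ∈ S') :
    Derivable S' (s * (k * (2 * Fintype.card F ^ (k + k + 1)))) (coordSet e T) := by
  obtain ⟨r, hr, T', hg, hT⟩ := h
  suffices key : Derivable S' (r * (k * (2 * Fintype.card F ^ (k + k + 1)))) (coordSet e T') by
    refine key.mono subset_rfl (Nat.mul_le_mul_right _ hr) ?_
    rintro _ ⟨φ, hφ, j, rfl⟩
    exact ⟨φ, hT hφ, j, rfl⟩
  clear hT hr
  induction hg with
  | refl S => exact (Derivable.of_subset hS).mono subset_rfl (by simp) subset_rfl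
  | @step r S T op u v _ hu hv ih =>
    let w : Fin (k + k) → X → F := Fin.addCases (fun i x => e (u x) i) (fun i x => e (v x) i)
    have hw₁ : ∀ i x, w (Fin.castAdd k i) x = e (u x) i := fun i x => by
      simp only [w, Fin.addCases_left]
    have hw₂ : ∀ i x, w (Fin.natAdd k i) x = e (v x) i := fun i x => by
      simp only [w, Fin.addCases_right]
    have hw : ∀ i, w i ∈ S' ∪ coordSet e T := by
      intro i
      refine Fin.addCases (fun i => ?_) (fun i => ?_) i
      · exact Or.inr ⟨u, hu, i, funext (hw₁ i)⟩
      · exact Or.inr ⟨v, hv, i, funext (hw₂ i)⟩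
    have h1 : Derivable (S' ∪ coordSet e T) _
        (Set.range fun (j : Fin k) x => e (op (u x) (v x)) j) :=
      Derivable.range fun j => by
        have := Derivable.lookup (S := S' ∪ coordSet e T) (fun c => Or.inl (hc c))
          (fun y : Fin (k + k) → F => e (op (e.symm fun i => y (Fin.castAdd k i))
            (e.symm fun i => y (Fin.natAdd k i))) j) hw
        simpa only [hw₁, hw₂, Equiv.symm_apply_apply] using this
    refine ((ih hS).trans h1).mono subset_rfl ?_ ?_
    · rw [Fintype.card_fin]; exact (Nat.succ_mul _ _).ge
    · rintro _ ⟨φ, hφ | hφ, j, rfl⟩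
      · exact Or.inr ⟨j, by rw [hφ]⟩
      · exact Or.inl ⟨φ, hφ, j, rfl⟩

end Circuits

/-! ### Gaussian elimination and decoding of generalized Reed-Solomon codes -/

section Elimination

variable {K ι σ : Type*} [Field K]

open Classical in
/-- The entry `f j` at the first position `j` of the list with `d j ≠ 0`, and `0` if there is no
such position. -/
noncomputable def pick (d f : ι → K) : List ι → K
  | [] => 0
  | j :: l => if d j = 0 then pick d f l else f j

theorem pick_spec (d : ι → K) (l : List ι) :
    ((∀ j ∈ l, d j = 0) ∧ ∀ f, pick d f l = 0) ∨ ∃ j ∈ l, d j ≠ 0 ∧ ∀ f, pick d f l = f j := by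
  induction l with
  | nil => exact Or.inl ⟨by simp, fun f => rfl⟩
  | cons a l ih =>
    by_cases ha : d a = 0
    · have h : ∀ f, pick d f (a :: l) = pick d f l := fun f => by simp [pick, ha]
      rcases ih with ⟨h1, h2⟩ | ⟨j, hj, h1, h2⟩
      · exact Or.inl ⟨by simpa [ha] using h1, fun f => (h f).trans (h2 f)⟩
      · exact Or.inr ⟨j, List.mem_cons_of_mem _ hj, h1, fun f => (h f).trans (h2 f)⟩
    · exact Or.inr ⟨a, List.mem_cons_self, ha, fun f => by simp [pick, ha]⟩

variable [Fintype ι]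

/-- One elimination step: from vectors `b j` to vectors that span the intersection of `span b` with
the kernel of the linear form `ℓ`. If `p` is the first vector with `ℓ p ≠ 0`, then `b j` becomes
`b j - (ℓ (b j) / ℓ p) p`; in particular `p` itself becomes `0`. If there is no such `p`, all
quotients are `0 / 0 = 0` and nothing changes. -/
noncomputable def eliminate (ℓ : ι → K) (b : ι → ι → K) : ι → ι → K :=
  let d : ι → K := fun j => ∑ i, ℓ i * b j i
  fun j i => b j i - d j / pick d d Finset.univ.toList *
    pick d (fun j => b j i) Finset.univ.toList

open Classical in
/-- A spanning family of the space of solutions of the homogeneous linear equations `ℓ a`, where `a`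
runs through a list. -/
noncomputable def kernelBasis (ℓ : σ → ι → K) : List σ → ι → ι → K
  | [] => fun j => Pi.single j 1
  | a :: l => eliminate (ℓ a) (kernelBasis ℓ l)

theorem mem_span_eliminate (ℓ : ι → K) (b : ι → ι → K) (v : ι → K) :
    v ∈ Submodule.span K (Set.range (eliminate ℓ b)) ↔
      v ∈ Submodule.span K (Set.range b) ∧ ∑ i, ℓ i * v i = 0 := by
  let φ : (ι → K) →ₗ[K] K := ∑ i, ℓ i • LinearMap.proj i
  have hφ : ∀ u, φ u = ∑ i, ℓ i * u i := fun u => by simp [φ]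
  obtain ⟨p, hp, hpD, he⟩ : ∃ p ∈ Submodule.span K (Set.range b),
      (φ p = 0 → ∀ j, φ (b j) = 0) ∧ ∀ j, eliminate ℓ b j = b j - (φ (b j) / φ p) • p := by
    rcases pick_spec (fun j => φ (b j)) Finset.univ.toList with ⟨h1, h2⟩ | ⟨j₀, _, h1, h2⟩
    · refine ⟨0, zero_mem _, fun _ j => h1 j (by simp), fun j => ?_⟩
      funext i
      simp [eliminate, ← hφ, h2]
    · refine ⟨b j₀, Submodule.subset_span ⟨j₀, rfl⟩, fun h => absurd h h1, fun j => ?_⟩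
      funext i
      simp [eliminate, ← hφ, h2]
  rw [← hφ]
  constructor
  · intro hv
    induction hv using Submodule.span_induction with
    | mem x hx =>
      obtain ⟨j, rfl⟩ := hx
      rw [he]
      refine ⟨sub_mem (Submodule.subset_span ⟨j, rfl⟩) (Submodule.smul_mem _ _ hp), ?_⟩
      rw [map_sub, map_smul, smul_eq_mul]
      by_cases h : φ p = 0
      · simp [h, hpD h j]
      · rw [div_mul_cancel₀ _ h, sub_self]
    | zero => exact ⟨zero_mem _, map_zero _⟩
    | add x y _ _ hx hy => exact ⟨add_mem hx.1 hy.1, by rw [map_add, hx.2, hy.2, add_zero]⟩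
    | smul c x _ hx => exact ⟨Submodule.smul_mem _ _ hx.1, by rw [map_smul, hx.2, smul_zero]⟩
  · rintro ⟨hv, hv0⟩
    obtain ⟨c, rfl⟩ := (Submodule.mem_span_range_iff_exists_fun K).1 hv
    refine (Submodule.mem_span_range_iff_exists_fun K).2 ⟨c, ?_⟩
    have : ∑ j, c j • (φ (b j) / φ p) • p = (φ (∑ j, c j • b j) / φ p) • p := by
      rw [map_sum, Finset.sum_div, Finset.sum_smul]
      refine Finset.sum_congr rfl fun j _ => ?_
      rw [map_smul, smul_smul, smul_eq_mul, mul_div_assoc]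
    simp_rw [he, smul_sub]
    rw [Finset.sum_sub_distrib, this, hv0, zero_div, zero_smul, sub_zero]

theorem mem_span_kernelBasis (ℓ : σ → ι → K) (l : List σ) (v : ι → K) :
    v ∈ Submodule.span K (Set.range (kernelBasis ℓ l)) ↔ ∀ a ∈ l, ∑ i, ℓ a i * v i = 0 := by
  induction l with
  | nil =>
    have : v ∈ Submodule.span K (Set.range (kernelBasis ℓ [])) := by
      refine (Submodule.mem_span_range_iff_exists_fun K).2 ⟨v, ?_⟩
      classical
      funext i
      simp [kernelBasis, Finset.sum_apply, Pi.single_apply]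
    simpa using this
  | cons a l ih =>
    rw [kernelBasis, mem_span_eliminate, ih, List.forall_mem_cons, and_comm]

/-- The first nonzero row of the matrix `b` (and `0` if `b = 0`). -/
noncomputable def firstRow (b : ι → ι → K) : ι → K := fun i =>
  pick (fun j => pick (b j) (b j) Finset.univ.toList) (fun j => b j i) Finset.univ.toList

theorem firstRow_mem (b : ι → ι → K) :
    firstRow b ∈ Submodule.span K (Set.range b) ∧ (firstRow b = 0 → b = 0) := by
  have hz : ∀ j, pick (b j) (b j) Finset.univ.toList = 0 → b j = 0 := by
    intro j hj
    rcases pick_spec (b j) Finset.univ.toList with ⟨h1, _⟩ | ⟨i, _, h1, h2⟩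
    · funext i
      exact h1 i (by simp)
    · exact absurd ((h2 _).symm.trans hj) h1
  rcases pick_spec (fun j => pick (b j) (b j) Finset.univ.toList) Finset.univ.toList with
    ⟨h1, h2⟩ | ⟨j, _, h1, h2⟩
  · have h0 : firstRow b = 0 := by funext i; exact h2 _
    refine ⟨h0 ▸ zero_mem _, fun _ => ?_⟩
    funext j
    exact hz j (h1 j (by simp))
  · have h0 : firstRow b = b j := by funext i; exact h2 _
    refine ⟨h0 ▸ Submodule.subset_span ⟨j, rfl⟩, fun h => absurd ?_ h1⟩
    rw [h0] at h
    rcases pick_spec (b j) Finset.univ.toList with ⟨_, h3⟩ | ⟨i, _, _, h3⟩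
    · exact h3 _
    · rw [h3, h]; rfl

end Elimination

section EliminationCircuits

variable {X K ι σ : Type*} [Field K] {S : Set (X → K)}

theorem Derivable.pick (h0 : (fun _ => 0) ∈ S) {d f : ι → X → K} (hd : ∀ j, d j ∈ S)
    (hf : ∀ j, f j ∈ S) (l : List ι) :
    Derivable S (3 * l.length) {fun x => pick (fun j => d j x) (fun j => f j x) l} := by
  classical
  induction l with
  | nil => exact .of_subset (by simpa [_root_.pick] using h0)
  | cons a l ih =>
    have h1 := ih.trans (Derivable.gate (fun a b => if a = 0 then b else 0)
      (u := d a) (v := fun x => _root_.pick (fun j => d j x) (fun j => f j x) l)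
      (Or.inl (hd a)) (Or.inr rfl))
    have h2 := h1.trans (Derivable.gate (fun a b => if a = 0 then 0 else b)
      (u := d a) (v := f a) (Or.inl (hd a)) (Or.inl (hf a)))
    have h3 := h2.trans (Derivable.gate (fun a b => a + b)
      (u := fun x => if d a x = 0 then _root_.pick (fun j => d j x) (fun j => f j x) l else 0)
      (v := fun x => if d a x = 0 then 0 else f a x) (by simp) (by simp))
    refine h3.mono subset_rfl (by simp; omega) (Set.singleton_subset_iff.2 (Or.inr ?_))
    rw [Set.mem_singleton_iff]
    funext x
    by_cases h : d a x = 0 <;> simp [_root_.pick, h]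

variable [Fintype ι]

theorem Derivable.eliminate (h0 : (fun _ => 0) ∈ S) {ℓ : ι → X → K} {b : ι → ι → X → K}
    (hℓ : ∀ i, ℓ i ∈ S) (hb : ∀ j i, b j i ∈ S) :
    Derivable S (11 * Fintype.card ι ^ 2)
      (Set.range fun (p : ι × ι) x => eliminate (fun i => ℓ i x) (fun j i => b j i x) p.1 p.2) := by
  let d : ι → X → K := fun j x => ∑ i, ℓ i x * b j i x
  have h1 : Derivable S _ (Set.range d) := Derivable.range fun j =>
    Derivable.sum (fun _ a b => a * b) h0 hℓ (hb j)
  let D : X → K := fun x => _root_.pick (fun j => d j x) (fun j => d j x) Finset.univ.toList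
  have h2 : Derivable (S ∪ Set.range d) _ {D} :=
    Derivable.pick (Or.inl h0) (fun j => Or.inr ⟨j, rfl⟩) (fun j => Or.inr ⟨j, rfl⟩) _
  let p : ι → X → K := fun i x =>
    _root_.pick (fun j => d j x) (fun j => b j i x) Finset.univ.toList
  have h3 : Derivable (S ∪ (Set.range d ∪ {D})) _ (Set.range p) := Derivable.range fun i =>
    Derivable.pick (Or.inl h0) (fun j => Or.inr (Or.inl ⟨j, rfl⟩)) (fun j => Or.inl (hb j i)) _
  let c : ι → X → K := fun j x => d j x / D x
  have h4 : Derivable (S ∪ (Set.range d ∪ {D} ∪ Set.range p)) _ (Set.range c) :=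
    Derivable.range fun j =>
      Derivable.gate (fun a b => a / b) (u := d j) (v := D)
        (Or.inr (Or.inl (Or.inl ⟨j, rfl⟩))) (Or.inr (Or.inl (Or.inr rfl)))
  let m : ι × ι → X → K := fun r x => c r.1 x * p r.2 x
  have h5 : Derivable (S ∪ (Set.range d ∪ {D} ∪ Set.range p ∪ Set.range c)) _ (Set.range m) :=
    Derivable.range fun r =>
      Derivable.gate (fun a b => a * b) (u := c r.1) (v := p r.2)
        (Or.inr (Or.inr ⟨_, rfl⟩)) (Or.inr (Or.inl (Or.inr ⟨_, rfl⟩)))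
  have h6 : Derivable (S ∪ (Set.range d ∪ {D} ∪ Set.range p ∪ Set.range c ∪ Set.range m)) _
      (Set.range fun (r : ι × ι) x => b r.1 r.2 x - m r x) :=
    Derivable.range fun r =>
      Derivable.gate (fun a b => a - b) (u := b r.1 r.2) (v := m r)
        (Or.inl (hb _ _)) (Or.inr (Or.inr ⟨_, rfl⟩))
  refine (((((h1.trans h2).trans h3).trans h4).trans h5).trans h6).mono subset_rfl ?_ ?_
  · simp only [Finset.length_toList, Finset.card_univ, Fintype.card_prod]
    have : Fintype.card ι ≤ Fintype.card ι ^ 2 := Nat.le_self_pow two_ne_zero _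
    nlinarith
  · exact Set.subset_union_right

theorem Derivable.kernelBasis (hc : ∀ c : K, (fun _ => c) ∈ S) {ℓ : σ → ι → X → K}
    (hℓ : ∀ a i, ℓ a i ∈ S) (l : List σ) :
    Derivable S (l.length * (11 * Fintype.card ι ^ 2))
      (Set.range fun (p : ι × ι) x => kernelBasis (fun a i => ℓ a i x) l p.1 p.2) := by
  induction l with
  | nil =>
    refine (Derivable.of_subset ?_).mono subset_rfl (by simp) subset_rfl
    rintro _ ⟨p, rfl⟩
    exact hc _
  | cons a l ih =>
    have h := ih.trans (Derivable.eliminate (Or.inl (hc 0)) (fun i => Or.inl (hℓ a i))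
      (b := fun j i x => _root_.kernelBasis (fun a i => ℓ a i x) l j i)
      (fun j i => Or.inr ⟨(j, i), rfl⟩))
    refine h.mono subset_rfl ?_ Set.subset_union_right
    simp only [List.length_cons]
    exact (Nat.succ_mul _ _).ge

theorem Derivable.firstRow (h0 : (fun _ => 0) ∈ S) {b : ι → ι → X → K}
    (hb : ∀ j i, b j i ∈ S) :
    Derivable S (6 * Fintype.card ι ^ 2)
      (Set.range fun i x => firstRow (fun j i => b j i x) i) := by
  have h1 := Derivable.range (S := S) fun j : ι =>
    Derivable.pick h0 (hb j) (hb j) Finset.univ.toList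
  have h2 := h1.trans (Derivable.range fun i : ι =>
    Derivable.pick (Or.inl h0) (fun j => Or.inr ⟨j, rfl⟩) (fun j => Or.inl (hb j i))
      Finset.univ.toList)
  refine h2.mono subset_rfl ?_ Set.subset_union_right
  simp only [Finset.length_toList, Finset.card_univ]
  nlinarith

end EliminationCircuits

section ReedSolomon

open Polynomial

variable {K : Type*} [Field K]

/-- The polynomial with the given coefficients. -/
noncomputable def polyOfCoeffs {m : ℕ} (c : Fin m → K) : K[X] := ∑ j, C (c j) * X ^ (j : ℕ)

theorem eval_polyOfCoeffs {m : ℕ} (c : Fin m → K) (a : K) :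
    (polyOfCoeffs c).eval a = ∑ j, c j * a ^ (j : ℕ) := by
  simp [polyOfCoeffs, eval_finsetSum]

theorem degree_polyOfCoeffs_lt {m : ℕ} (c : Fin m → K) : (polyOfCoeffs c).degree < m := by
  refine (degree_sum_le _ _).trans_lt ((Finset.sup_lt_iff (WithBot.bot_lt_coe m)).2 fun j _ => ?_)
  exact (degree_C_mul_X_pow_le _ _).trans_lt (Nat.cast_lt.2 j.2)

theorem coeff_polyOfCoeffs {m : ℕ} (c : Fin m → K) (j : Fin m) :
    (polyOfCoeffs c).coeff j = c j := by
  simp [polyOfCoeffs, finsetSum_coeff, coeff_C_mul, coeff_X_pow, Fin.val_inj]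

theorem polyOfCoeffs_coeff {m : ℕ} {f : K[X]} (hf : f.degree < m) :
    polyOfCoeffs (fun j : Fin m => f.coeff j) = f := by
  ext i
  by_cases hi : i < m
  · exact coeff_polyOfCoeffs _ ⟨i, hi⟩
  · rw [coeff_eq_zero_of_degree_lt, coeff_eq_zero_of_degree_lt]
    · exact hf.trans_le (by exact_mod_cast not_lt.1 hi)
    · exact (degree_polyOfCoeffs_lt _).trans_le (by exact_mod_cast not_lt.1 hi)

theorem eq_zero_of_eval_eq_zero {N m : ℕ} {α : Fin N → K} (hα : Function.Injective α)
    {f : K[X]} (hf : f.degree < m) (s : Finset (Fin N)) (hs : m ≤ s.card)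
    (h : ∀ i ∈ s, f.eval (α i) = 0) : f = 0 := by
  classical
  refine eq_zero_of_degree_lt_of_eval_finset_eq_zero (s.image α) ?_ ?_
  · rw [Finset.card_image_of_injective _ hα]
    exact hf.trans_le (by exact_mod_cast hs)
  · simpa using h

variable {N : ℕ}

/-- The equations `y i Λ(α i) = v i G(α i)` for the coefficients of `Λ` (degree `≤ t`) and of `G`
(degree `< κ + t`). -/
noncomputable def keyEquation (κ t : ℕ) (α v y : Fin N → K) (i : Fin N) :
    Fin (t + 1) ⊕ Fin (κ + t) → K :=
  Sum.elim (fun a => y i * α i ^ (a : ℕ)) (fun b => -(v i * α i ^ (b : ℕ)))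

/-- Values at the points `α i` of the locator polynomial `Λ`, taken from a nonzero solution of the
key equation. -/
noncomputable def locator (κ t : ℕ) (α v y : Fin N → K) (i : Fin N) : K :=
  ∑ a : Fin (t + 1),
    firstRow (kernelBasis (keyEquation κ t α v y) Finset.univ.toList) (Sum.inl a) * α i ^ (a : ℕ)

/-- The equations `lam i (v i f(α i) - s y i) = 0` for the coefficients of `f` (degree `< κ`) and the
scalar `s`. They compare `f` with the received word at the positions not excluded by `lam`. -/
noncomputable def erasureEquation (κ : ℕ) (α v y lam : Fin N → K) (i : Fin N) : Fin κ ⊕ Unit → K :=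
  Sum.elim (fun c => lam i * (v i * α i ^ (c : ℕ))) (fun _ => -(lam i * y i))

/-- Interpolation through the positions `i` of the received word `y` with `lam i ≠ 0`: if the
solutions of the erasure equations are the multiples of some `(f, 1)`, the result is the codeword of
`f`. -/
noncomputable def interpolateCodeword (κ : ℕ) (α v y lam : Fin N → K) (i : Fin N) : K :=
  let b := kernelBasis (erasureEquation κ α v y lam) Finset.univ.toList
  let d := fun j => b j (Sum.inr ())
  v i * ((∑ c : Fin κ, pick d (fun j => b j (Sum.inl c)) Finset.univ.toList * α i ^ (c : ℕ)) /
    pick d d Finset.univ.toList)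

/-- Berlekamp-Welch decoder of the generalized Reed-Solomon code `(v i f(α i))ᵢ`, `deg f < κ`, for up
to `t` errors. -/
noncomputable def rsDecode (κ t : ℕ) (α v y : Fin N → K) : Fin N → K :=
  interpolateCodeword κ α v y (locator κ t α v y)

/-- Any nonzero solution `(Λ, G)` of the key equation has `G = Λ f`, since `G - Λ f` has more zeros
at the error-free positions than its degree allows; hence `Λ` vanishes at all errors. -/
theorem exists_locatorPolynomial {κ t : ℕ} {α v y : Fin N → K} (hα : Function.Injective α)
    (hv : ∀ i, v i ≠ 0) (hN : κ + 2 * t ≤ N) {f : K[X]} (hf : f.degree < κ)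
    (E : Finset (Fin N)) (hE : E.card ≤ t) (hy : ∀ i ∉ E, y i = v i * f.eval (α i)) :
    ∃ Λ : K[X], Λ ≠ 0 ∧ Λ.degree < (t + 1 : ℕ) ∧ (∀ i, locator κ t α v y i = Λ.eval (α i)) ∧
      ∀ i, Λ.eval (α i) * (v i * f.eval (α i) - y i) = 0 := by
  classical
  set b := kernelBasis (keyEquation κ t α v y) Finset.univ.toList with hb
  have hker : ∀ w, w ∈ Submodule.span K (Set.range b) ↔ ∀ i,
      y i * (polyOfCoeffs fun a => w (Sum.inl a)).eval (α i) =
        v i * (polyOfCoeffs fun a => w (Sum.inr a)).eval (α i) := by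
    intro w
    rw [mem_span_kernelBasis]
    simp only [Finset.mem_toList, Finset.mem_univ, true_imp_iff]
    refine forall_congr' fun i => ?_
    rw [Fintype.sum_sum_type, eval_polyOfCoeffs, eval_polyOfCoeffs, Finset.mul_sum, Finset.mul_sum,
      ← sub_eq_zero (b := ∑ j, v i * _), sub_eq_add_neg, ← Finset.sum_neg_distrib]
    simp only [keyEquation, Sum.elim_inl, Sum.elim_inr]
    refine Eq.congr_left (congrArg₂ _ ?_ ?_) <;> exact Finset.sum_congr rfl fun j _ => by ring
  -- The polynomial that vanishes at the errors, together with its product with `f`, is a solution.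
  have hdeg : ∀ Λ : K[X], Λ.degree < (t + 1 : ℕ) → (Λ * f).degree < (κ + t : ℕ) := by
    intro Λ hΛ
    by_cases h0 : Λ * f = 0
    · rw [h0, degree_zero]; exact WithBot.bot_lt_coe _
    · have hΛ0 := left_ne_zero_of_mul h0
      have hf0 := right_ne_zero_of_mul h0
      rw [← natDegree_lt_iff_degree_lt hΛ0] at hΛ
      rw [← natDegree_lt_iff_degree_lt hf0] at hf
      rw [← natDegree_lt_iff_degree_lt h0, natDegree_mul hΛ0 hf0]
      omega
  have hb0 : b ≠ 0 := by
    intro h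
    let Λ₀ : K[X] := ∏ i ∈ E, (X - C (α i))
    have hΛm : Λ₀.Monic := monic_prod_of_monic _ _ fun i _ => monic_X_sub_C _
    have hΛd : Λ₀.degree < (t + 1 : ℕ) := by
      rw [← natDegree_lt_iff_degree_lt hΛm.ne_zero, natDegree_prod_of_monic _ _
        fun i _ => monic_X_sub_C _]
      simp only [natDegree_X_sub_C, Finset.sum_const, smul_eq_mul, mul_one]
      omega
    let w : Fin (t + 1) ⊕ Fin (κ + t) → K :=
      Sum.elim (fun a => Λ₀.coeff a) (fun a => (Λ₀ * f).coeff a)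
    have hw : w ∈ Submodule.span K (Set.range b) := by
      rw [hker]
      intro i
      simp only [w, Sum.elim_inl, Sum.elim_inr]
      rw [polyOfCoeffs_coeff hΛd, polyOfCoeffs_coeff (hdeg _ hΛd), eval_mul]
      by_cases hi : i ∈ E
      · have : Λ₀.eval (α i) = 0 := by
          rw [eval_prod]; exact Finset.prod_eq_zero hi (by simp)
        simp [this]
      · rw [hy i hi]; ring
    rw [h] at hw
    have hw0 : w = 0 := by
      have : Set.range (0 : Fin (t + 1) ⊕ Fin (κ + t) → Fin (t + 1) ⊕ Fin (κ + t) → K) ⊆ {0} := by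
        rintro _ ⟨j, rfl⟩; rfl
      have h2 := Submodule.span_mono (R := K) this hw
      simpa using h2
    refine hΛm.ne_zero ?_
    rw [← polyOfCoeffs_coeff hΛd]
    have : (fun a : Fin (t + 1) => Λ₀.coeff a) = 0 := by
      funext a; exact congrFun hw0 (Sum.inl a)
    rw [this]; simp [polyOfCoeffs]
  obtain ⟨hw, hw0⟩ := firstRow_mem b
  set w := firstRow b with hwdef
  set Λ : K[X] := polyOfCoeffs fun a => w (Sum.inl a) with hΛ
  set G : K[X] := polyOfCoeffs fun a => w (Sum.inr a) with hG
  have hΛd : Λ.degree < (t + 1 : ℕ) := degree_polyOfCoeffs_lt _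
  have hkey : ∀ i, y i * Λ.eval (α i) = v i * G.eval (α i) := (hker w).1 hw
  have hGΛ : G = Λ * f := by
    refine sub_eq_zero.1 (eq_zero_of_eval_eq_zero hα (m := κ + t) ?_ Eᶜ ?_ ?_)
    · exact (degree_sub_le _ _).trans_lt (max_lt (degree_polyOfCoeffs_lt _) (hdeg _ hΛd))
    · rw [Finset.card_compl, Fintype.card_fin]; omega
    · intro i hi
      have h1 := hkey i
      rw [hy i (Finset.mem_compl.1 hi)] at h1
      have h2 : v i * (f.eval (α i) * Λ.eval (α i) - G.eval (α i)) = 0 := by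
        linear_combination h1
      have h3 := (mul_eq_zero.1 h2).resolve_left (hv i)
      rw [eval_sub, eval_mul]
      linear_combination -h3
  refine ⟨Λ, ?_, hΛd, fun i => (eval_polyOfCoeffs _ _).symm, fun i => ?_⟩
  · intro h0
    refine hb0 (hw0 ?_)
    rw [h0, zero_mul] at hGΛ
    funext j
    rcases j with j | j
    · rw [← coeff_polyOfCoeffs (fun a => w (Sum.inl a)) j, ← hΛ, h0]; simp
    · rw [← coeff_polyOfCoeffs (fun a => w (Sum.inr a)) j, ← hG, hGΛ]; simp
  · have h1 := hkey i
    rw [hGΛ, eval_mul] at h1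
    linear_combination -h1

/-- The degree of `Λ` bounds the number of positions where it vanishes, so enough positions remain to
determine `f`. -/
theorem interpolateCodeword_eq {κ t : ℕ} {α v y lam : Fin N → K} (hα : Function.Injective α)
    (hv : ∀ i, v i ≠ 0) (hN : κ + t ≤ N) {f Λ : K[X]} (hf : f.degree < κ) (hΛ0 : Λ ≠ 0)
    (hΛ : Λ.degree < (t + 1 : ℕ)) (hlam : ∀ i, lam i = Λ.eval (α i))
    (h : ∀ i, lam i * (v i * f.eval (α i) - y i) = 0) (i : Fin N) :
    interpolateCodeword κ α v y lam i = v i * f.eval (α i) := by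
  classical
  set b := kernelBasis (erasureEquation κ α v y lam) Finset.univ.toList with hb
  have hker : ∀ w, w ∈ Submodule.span K (Set.range b) ↔ ∀ i,
      lam i * (v i * (polyOfCoeffs fun a => w (Sum.inl a)).eval (α i) -
        w (Sum.inr ()) * y i) = 0 := by
    intro w
    rw [mem_span_kernelBasis]
    simp only [Finset.mem_toList, Finset.mem_univ, true_imp_iff]
    refine forall_congr' fun i => ?_
    rw [Fintype.sum_sum_type, eval_polyOfCoeffs, mul_sub, Finset.mul_sum, Finset.mul_sum,
      sub_eq_add_neg]
    simp only [erasureEquation, Sum.elim_inl, Sum.elim_inr, Fintype.sum_unique]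
    refine Eq.congr_left (congrArg₂ _ ?_ (by ring))
    exact Finset.sum_congr rfl fun j _ => by ring
  have hsol : ∀ w ∈ Submodule.span K (Set.range b),
      (polyOfCoeffs fun a => w (Sum.inl a)) = C (w (Sum.inr ())) * f := by
    intro w hw
    have hw := (hker w).1 hw
    refine sub_eq_zero.1 (eq_zero_of_eval_eq_zero hα (m := κ) ?_
      (Finset.univ.filter fun i => Λ.eval (α i) ≠ 0) ?_ ?_)
    · refine (degree_sub_le _ _).trans_lt (max_lt (degree_polyOfCoeffs_lt _) ?_)
      rw [← smul_eq_C_mul]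
      exact (degree_smul_le _ _).trans_lt hf
    · have hcard : (Finset.univ.filter fun i => Λ.eval (α i) = 0).card ≤ t := by
        by_contra! hlt
        refine hΛ0 (eq_zero_of_eval_eq_zero hα hΛ _ hlt ?_)
        simp
      have hadd := Finset.card_filter_add_card_filter_not (s := (Finset.univ : Finset (Fin N)))
        (fun i => Λ.eval (α i) = 0)
      rw [Finset.card_univ, Fintype.card_fin] at hadd
      simp only [ne_eq]
      omega
    · intro i hi
      have hi' : lam i ≠ 0 := by rw [hlam]; exact (Finset.mem_filter.1 hi).2
      have h1 := (mul_eq_zero.1 (hw i)).resolve_left hi'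
      have h2 := (mul_eq_zero.1 (h i)).resolve_left hi'
      refine (mul_eq_zero.1 (?_ : v i * _ = 0)).resolve_left (hv i)
      rw [eval_sub, eval_mul, eval_C]
      linear_combination h1 - w (Sum.inr ()) * h2
  have h1 : (Sum.elim (fun a => f.coeff a) (fun _ => 1) : Fin κ ⊕ Unit → K) ∈
      Submodule.span K (Set.range b) := by
    rw [hker]
    intro i
    simp only [Sum.elim_inl, Sum.elim_inr, one_mul]
    rw [polyOfCoeffs_coeff hf]
    exact h i
  rcases pick_spec (fun j => b j (Sum.inr ())) Finset.univ.toList with ⟨h2, _⟩ | ⟨j, _, h2, h3⟩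
  · exfalso
    have : Submodule.span K (Set.range b) ≤
        LinearMap.ker (LinearMap.proj (R := K) (φ := fun _ => K) (Sum.inr () : Fin κ ⊕ Unit)) := by
      refine Submodule.span_le.2 ?_
      rintro _ ⟨j, rfl⟩
      exact h2 j (by simp)
    have := this h1
    simp at this
  · have h4 := congrArg (eval (α i)) (hsol (b j) (Submodule.subset_span ⟨j, rfl⟩))
    rw [eval_polyOfCoeffs, eval_mul, eval_C] at h4
    rw [interpolateCodeword]
    simp only [← hb, h3]
    rw [h4, mul_div_cancel_left₀ _ h2]

theorem rsDecode_eq {κ t : ℕ} {α v y : Fin N → K} (hα : Function.Injective α)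
    (hv : ∀ i, v i ≠ 0) (hN : κ + 2 * t ≤ N) {f : K[X]} (hf : f.degree < κ)
    (E : Finset (Fin N)) (hE : E.card ≤ t) (hy : ∀ i ∉ E, y i = v i * f.eval (α i)) :
    rsDecode κ t α v y = fun i => v i * f.eval (α i) := by
  obtain ⟨Λ, h0, hd, hlam, h⟩ := exists_locatorPolynomial hα hv hN hf E hE hy
  funext i
  exact interpolateCodeword_eq hα hv (by omega) hf h0 hd hlam (fun i => by rw [hlam]; exact h i) i

end ReedSolomon

section ReedSolomonCircuits

variable {X K : Type*} [Field K] {S : Set (X → K)} {N : ℕ}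

theorem Derivable.locator (hc : ∀ c : K, (fun _ => c) ∈ S) {κ t : ℕ} (hN : κ + 2 * t ≤ N)
    (α v : Fin N → K) {y : Fin N → X → K} (hy : ∀ i, y i ∈ S) :
    Derivable S (20 * (N + 1) ^ 3)
      (Set.range fun i x => locator κ t α v (fun i => y i x) i) := by
  let ι := Fin (t + 1) ⊕ Fin (κ + t)
  have hcard : Fintype.card ι ≤ N + 1 := by
    simp only [ι, Fintype.card_sum, Fintype.card_fin]; omega
  let e : Fin N → ι → X → K := fun i a x => keyEquation κ t α v (fun i => y i x) i a
  have h1 : Derivable S _ (Set.range fun (p : Fin N × ι) => e p.1 p.2) :=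
    Derivable.range (s := 1) fun p => by
      rcases p with ⟨i, a | a⟩
      · exact Derivable.gate (fun b _ => b * α i ^ (a : ℕ)) (hy i) (hy i)
      · exact (Derivable.of_subset (Set.singleton_subset_iff.2 (hc _))).mono
          subset_rfl zero_le_one subset_rfl
  have h2 := h1.trans (Derivable.kernelBasis (fun c => Or.inl (hc c)) (ℓ := e)
    (fun i a => Or.inr ⟨(i, a), rfl⟩) Finset.univ.toList)
  have h3 := h2.trans (Derivable.firstRow (Or.inl (hc 0))
    (b := fun j i x =>
    _root_.kernelBasis (fun i a => e i a x) Finset.univ.toList j i)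
    (fun j i => Or.inr (Or.inr ⟨(j, i), rfl⟩)))
  have h4 := h3.trans (Derivable.range fun i : Fin N =>
    Derivable.sum (fun (a : Fin (t + 1)) b _ => b * α i ^ (a : ℕ)) (Or.inl (hc 0))
      (u := fun (a : Fin (t + 1)) x => _root_.firstRow
        (_root_.kernelBasis (fun i a => e i a x) Finset.univ.toList) (Sum.inl a))
      (v := fun _ _ => 0)
      (fun a => Or.inr (Or.inr ⟨Sum.inl a, rfl⟩)) (fun _ => Or.inl (hc 0)))
  refine h4.mono subset_rfl ?_ (fun u hu => Or.inr hu)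
  simp only [Finset.length_toList, Finset.card_univ, Fintype.card_prod, Fintype.card_fin]
  generalize Fintype.card ι = m at hcard
  have e1 : m ^ 2 ≤ (N + 1) ^ 2 := Nat.pow_le_pow_left hcard 2
  have e2 : N * (11 * m ^ 2) ≤ N * (11 * (N + 1) ^ 2) :=
    Nat.mul_le_mul_left _ (Nat.mul_le_mul_left _ e1)
  have e3 : N * (2 * (t + 1)) ≤ N * (2 * (N + 1)) := Nat.mul_le_mul_left _ (by omega)
  have e4 : N * m * 1 ≤ N * (N + 1) * 1 :=
    Nat.mul_le_mul_right _ (Nat.mul_le_mul_left _ hcard)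
  nlinarith [Nat.zero_le N]

theorem Derivable.interpolateCodeword (hc : ∀ c : K, (fun _ => c) ∈ S) {κ : ℕ} (hN : κ ≤ N)
    (α v : Fin N → K) {y lam : Fin N → X → K} (hy : ∀ i, y i ∈ S) (hlam : ∀ i, lam i ∈ S) :
    Derivable S (20 * (N + 1) ^ 3)
      (Set.range fun i x => interpolateCodeword κ α v (fun i => y i x) (fun i => lam i x) i) := by
  let ι := Fin κ ⊕ Unit
  have hcard : Fintype.card ι ≤ N + 1 := by
    simp only [ι, Fintype.card_sum, Fintype.card_fin, Fintype.card_unit]; omega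
  let e : Fin N → ι → X → K :=
    fun i a x => erasureEquation κ α v (fun i => y i x) (fun i => lam i x) i a
  have h1 : Derivable S _ (Set.range fun (p : Fin N × ι) => e p.1 p.2) :=
    Derivable.range (s := 1) fun p => by
      rcases p with ⟨i, a | a⟩
      · exact Derivable.gate (fun b _ => b * (v i * α i ^ (a : ℕ))) (hlam i) (hlam i)
      · exact Derivable.gate (fun a b => -(a * b)) (hlam i) (hy i)
  let b : ι → ι → X → K := fun j i x =>
    _root_.kernelBasis (fun i a => e i a x) Finset.univ.toList j i
  have h2 := h1.trans (Derivable.kernelBasis (fun c => Or.inl (hc c)) (ℓ := e)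
    (fun i a => Or.inr ⟨(i, a), rfl⟩) Finset.univ.toList)
  let p : ι → X → K := fun i x =>
    _root_.pick (fun j => b j (Sum.inr ()) x) (fun j => b j i x) Finset.univ.toList
  have h3 := h2.trans (Derivable.range fun i : ι =>
    Derivable.pick (Or.inl (hc 0)) (d := fun j => b j (Sum.inr ())) (f := fun j => b j i)
      (fun j => Or.inr (Or.inr ⟨(j, Sum.inr ()), rfl⟩)) (fun j => Or.inr (Or.inr ⟨(j, i), rfl⟩))
      Finset.univ.toList)
  have h4 := h3.trans (Derivable.range fun i : Fin N =>
    (Derivable.sum (fun (a : Fin κ) b _ => b * α i ^ (a : ℕ)) (Or.inl (hc 0))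
      (u := fun (a : Fin κ) => p (Sum.inl a)) (v := fun _ _ => 0)
      (fun a => Or.inr (Or.inr ⟨Sum.inl a, rfl⟩)) (fun _ => Or.inl (hc 0))))
  have h5 := h4.trans (Derivable.range fun i : Fin N =>
    Derivable.gate (fun a b => v i * (a / b))
      (u := fun x => ∑ a : Fin κ, p (Sum.inl a) x * α i ^ (a : ℕ)) (v := p (Sum.inr ()))
      (Or.inr (Or.inr ⟨i, rfl⟩)) (Or.inr (Or.inl (Or.inr ⟨Sum.inr (), rfl⟩))))
  refine h5.mono subset_rfl ?_ (fun u hu => Or.inr hu)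
  simp only [Finset.length_toList, Finset.card_univ, Fintype.card_prod, Fintype.card_fin]
  generalize Fintype.card ι = m at hcard
  have e1 : m ^ 2 ≤ (N + 1) ^ 2 := Nat.pow_le_pow_left hcard 2
  have e2 : N * (11 * m ^ 2) ≤ N * (11 * (N + 1) ^ 2) :=
    Nat.mul_le_mul_left _ (Nat.mul_le_mul_left _ e1)
  have e3 : N * (2 * κ) ≤ N * (2 * N) := Nat.mul_le_mul_left _ (by omega)
  have e4 : N * m * 1 ≤ N * (N + 1) * 1 :=
    Nat.mul_le_mul_right _ (Nat.mul_le_mul_left _ hcard)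
  nlinarith [Nat.zero_le N]

theorem Derivable.rsDecode (hc : ∀ c : K, (fun _ => c) ∈ S) {κ t : ℕ} (hN : κ + 2 * t ≤ N)
    (α v : Fin N → K) {y : Fin N → X → K} (hy : ∀ i, y i ∈ S) :
    Derivable S (40 * (N + 1) ^ 3)
      (Set.range fun i x => rsDecode κ t α v (fun i => y i x) i) := by
  have h := (Derivable.locator hc hN α v hy).trans
    (Derivable.interpolateCodeword (fun c => Or.inl (hc c)) (by omega : κ ≤ N) α v
      (fun i => Or.inl (hy i))
      (lam := fun i x => _root_.locator κ t α v (fun i => y i x) i) (fun i => Or.inr ⟨i, rfl⟩))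
  exact h.mono subset_rfl (by omega) Set.subset_union_right

end ReedSolomonCircuits

/-! ### Duality of codes -/

section Duality

variable {K ι : Type*} [Field K] [Fintype ι]

theorem mem_dualCode {C : Submodule K (ι → K)} {y : ι → K} :
    y ∈ dualCode C ↔ ∀ x ∈ C, x ⬝ᵥ y = 0 := Iff.rfl

/-- The dot product as a bilinear form. -/
def dotForm (K ι : Type*) [Field K] [Fintype ι] : LinearMap.BilinForm K (ι → K) :=
  dotProductBilin K K

theorem dotForm_apply (x y : ι → K) : dotForm K ι x y = x ⬝ᵥ y := rfl

theorem dotForm_isRefl : (dotForm K ι).IsRefl := fun x y h => by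
  rw [dotForm_apply, dotProduct_comm]; exact h

theorem dotForm_nondegenerate : (dotForm K ι).Nondegenerate := by
  refine (LinearMap.IsRefl.nondegenerate_iff_separatingLeft (B := dotForm K ι)
    dotForm_isRefl).2 fun x hx => ?_
  exact dotProduct_eq_zero_iff.1 fun y => hx y

theorem dualCode_eq_orthogonal (C : Submodule K (ι → K)) :
    dualCode C = (dotForm K ι).orthogonal C := by
  ext y; rfl

theorem dualCode_dualCode (C : Submodule K (ι → K)) : dualCode (dualCode C) = C := by
  rw [dualCode_eq_orthogonal, dualCode_eq_orthogonal,
    LinearMap.BilinForm.orthogonal_orthogonal dotForm_nondegenerate dotForm_isRefl]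

theorem finrank_add_finrank_dualCode (C : Submodule K (ι → K)) :
    Module.finrank K C + Module.finrank K (dualCode C) = Fintype.card ι := by
  have h := LinearMap.BilinForm.finrank_orthogonal (dotForm_nondegenerate (K := K) (ι := ι)) C
  have h' := Submodule.finrank_le C
  rw [Module.finrank_fintype_fun_eq_card] at h h'
  rw [dualCode_eq_orthogonal, h]
  omega

theorem dualCode_anti {C D : Submodule K (ι → K)} (h : C ≤ D) : dualCode D ≤ dualCode C :=
  fun _ hy x hx => hy x (h hx)

theorem IsConjugatePair.symm {C₁ C₂ : Submodule K (ι → K)} {k : ℕ} (h : IsConjugatePair C₁ C₂ k) :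
    IsConjugatePair C₂ C₁ k :=
  ⟨by simpa [dualCode_dualCode] using dualCode_anti h.dual_le, by rw [add_comm]; exact h.dim_eq⟩

theorem IsConjugatePair.eq_dualCode {C₁ C₂ : Submodule K (ι → K)} (h : IsConjugatePair C₁ C₂ 0) :
    dualCode C₂ = C₁ := by
  refine Submodule.eq_of_le_of_finrank_eq h.dual_le ?_
  have h1 := finrank_add_finrank_dualCode C₂
  have h2 := h.dim_eq
  omega

/-- The dot product identifies `C₂ / C₁^⊥` with the dual space of `C₁ / C₂^⊥`; hence the two
quotients have representatives of dual bases. -/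
theorem IsConjugatePair.exists_dual_vectors {C₁ C₂ : Submodule K (ι → K)} {k : ℕ}
    (h : IsConjugatePair C₁ C₂ k) :
    ∃ g g' : Fin k → ι → K, C₁ = dualCode C₂ ⊔ Submodule.span K (Set.range g) ∧
      C₂ = dualCode C₁ ⊔ Submodule.span K (Set.range g') ∧
      ∀ l m, g l ⬝ᵥ g' m = if l = m then 1 else 0 := by
  obtain ⟨V, hV⟩ := Submodule.exists_isCompl (dualCode C₂)
  have hsup : dualCode C₂ ⊔ V ⊓ C₁ = C₁ := by
    rw [← sup_inf_assoc_of_le V h.dual_le, hV.sup_eq_top, top_inf_eq]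
  have hinf : dualCode C₂ ⊓ (V ⊓ C₁) = ⊥ := by
    rw [← inf_assoc, hV.inf_eq_bot, bot_inf_eq]
  have hdim : Module.finrank K ↥(V ⊓ C₁) = k := by
    have h1 := Submodule.finrank_sup_add_finrank_inf_eq (dualCode C₂) (V ⊓ C₁)
    rw [hsup, hinf, finrank_bot] at h1
    have h2 := finrank_add_finrank_dualCode C₂
    have h3 := h.dim_eq
    omega
  let b := Module.finBasisOfFinrankEq K ↥(V ⊓ C₁) hdim
  let g : Fin k → ι → K := fun j => (b j : ι → K)
  have hspan : Submodule.span K (Set.range g) = V ⊓ C₁ := by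
    have h1 : Set.range g = (V ⊓ C₁).subtype '' Set.range b := by
      rw [← Set.range_comp]; rfl
    rw [h1, Submodule.span_image, b.span_eq, Submodule.map_top, Submodule.range_subtype]
  have hC₁ : C₁ = dualCode C₂ ⊔ Submodule.span K (Set.range g) := by rw [hspan, hsup]
  have hdual : ∀ x ∈ C₂, (∀ l, g l ⬝ᵥ x = 0) → x ∈ dualCode C₁ := by
    intro x hx hg y hy
    have hle : C₁ ≤ dualCode (Submodule.span K {x}) := by
      rw [hC₁]
      refine sup_le (dualCode_anti ?_) (Submodule.span_le.2 ?_)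
      · rw [Submodule.span_singleton_le_iff_mem]; exact hx
      · rintro _ ⟨l, rfl⟩ z hz
        obtain ⟨a, rfl⟩ := Submodule.mem_span_singleton.1 hz
        rw [smul_dotProduct, dotProduct_comm, hg, smul_zero]
    rw [dotProduct_comm]
    exact hle hy x (Submodule.mem_span_singleton_self x)
  let T : C₂ →ₗ[K] (Fin k → K) :=
    LinearMap.pi fun l => (dotForm K ι (g l)).comp C₂.subtype
  have hT : ∀ x l, T x l = g l ⬝ᵥ (x : ι → K) := fun _ _ => rfl
  have hker : Module.finrank K (LinearMap.ker T) ≤ Module.finrank K (dualCode C₁) := by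
    rw [← ((LinearMap.ker T).equivMapOfInjective C₂.subtype C₂.injective_subtype).finrank_eq.symm]
    refine Submodule.finrank_mono ?_
    rintro _ ⟨x, hx, rfl⟩
    exact hdual x x.2 fun l => by rw [← hT]; exact congrFun hx l
  have hsurj : Function.Surjective T := by
    rw [← LinearMap.range_eq_top]
    refine Submodule.eq_top_of_finrank_eq (le_antisymm (Submodule.finrank_le _) ?_)
    have h1 := LinearMap.finrank_range_add_finrank_ker T
    have h2 := finrank_add_finrank_dualCode C₁
    have h3 := h.dim_eq
    rw [Module.finrank_fintype_fun_eq_card, Fintype.card_fin]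
    omega
  choose g' hg' using fun m => hsurj (Pi.single m 1)
  have hgg' : ∀ l m, g l ⬝ᵥ (g' m : ι → K) = if l = m then 1 else 0 := by
    intro l m
    rw [← hT, hg', Pi.single_apply]
  refine ⟨g, fun m => g' m, hC₁, le_antisymm (fun x hx => ?_) (sup_le h.symm.dual_le ?_), hgg'⟩
  · let y : ι → K := ∑ m, (g m ⬝ᵥ x) • (g' m : ι → K)
    have hy : y ∈ Submodule.span K (Set.range fun m => (g' m : ι → K)) :=
      Submodule.sum_mem _ fun m _ => Submodule.smul_mem _ _ (Submodule.subset_span ⟨m, rfl⟩)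
    have hy₂ : y ∈ C₂ := Submodule.sum_mem _ fun m _ => Submodule.smul_mem _ _ (g' m).2
    have : x - y ∈ dualCode C₁ := by
      refine hdual _ (sub_mem hx hy₂) fun l => ?_
      simp only [y, dotProduct_sub, dotProduct_sum, dotProduct_smul, hgg']
      simp
    rw [← sub_add_cancel x y]
    exact Submodule.add_mem_sup this hy
  · refine Submodule.span_le.2 ?_
    rintro _ ⟨m, rfl⟩
    exact (g' m).2

end Duality

/-! ### Generalized Reed-Solomon codes -/

section GRS

open Polynomial

variable {K : Type*} [Field K] {N : ℕ}

/-- The generalized Reed-Solomon code of the words `(v i f(α i))ᵢ`, `deg f < κ`. -/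
noncomputable def grsCode (κ : ℕ) (α v : Fin N → K) : Submodule K (Fin N → K) :=
  (degreeLT K κ).map (LinearMap.pi fun i => v i • leval (α i))

theorem mem_grsCode {κ : ℕ} {α v c : Fin N → K} :
    c ∈ grsCode κ α v ↔ ∃ f : K[X], f.degree < (κ : WithBot ℕ) ∧
      ∀ i, c i = v i * f.eval (α i) := by
  simp only [grsCode, Submodule.mem_map, mem_degreeLT]
  refine exists_congr fun f => and_congr_right fun _ => ?_
  constructor
  · rintro rfl i
    simp [leval]
  · intro h
    funext i
    simp [h i, leval]

theorem grsCode_mono {κ κ' : ℕ} (h : κ ≤ κ') (α v : Fin N → K) :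
    grsCode κ α v ≤ grsCode κ' α v :=
  Submodule.map_mono (degreeLT_mono h)

theorem finrank_grsCode {κ : ℕ} (hκ : κ ≤ N) {α v : Fin N → K} (hα : Function.Injective α)
    (hv : ∀ i, v i ≠ 0) : Module.finrank K (grsCode κ α v) = κ := by
  have hrange : grsCode κ α v = LinearMap.range ((LinearMap.pi fun i => v i • leval (α i)).comp
      (degreeLT K κ).subtype) := by
    rw [LinearMap.range_comp, Submodule.range_subtype, grsCode]
  rw [hrange, LinearMap.finrank_range_of_inj, (degreeLTEquiv K κ).finrank_eq,
    Module.finrank_fin_fun]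
  rw [← LinearMap.ker_eq_bot, LinearMap.ker_eq_bot']
  intro f hf
  refine Subtype.ext (eq_zero_of_eval_eq_zero hα (mem_degreeLT.1 f.2) Finset.univ (by simpa) ?_)
  intro i _
  have h := congrFun hf i
  simpa [leval, hv i] using h

/-- Two generalized Reed-Solomon codes of the same dimension `h + j` and length `2h` that form a
conjugate pair. The multipliers of the second are the weights of Lagrange interpolation: they
annihilate all values of polynomials of degree `< 2h - 1`. -/
theorem exists_grs_conjugatePair {h j : ℕ} (hj : j ≤ h) {α : Fin (2 * h) → K}
    (hα : Function.Injective α) :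
    ∃ D₁ D₂ : Submodule K (Fin (2 * h) → K), IsGRS D₁ (h + j) ∧ IsGRS D₂ (h + j) ∧
      IsConjugatePair D₁ D₂ (2 * j) := by
  classical
  let u : Fin (2 * h) → K := fun i => (∏ j ∈ Finset.univ.erase i, (α i - α j))⁻¹
  have hu : ∀ i, u i ≠ 0 := fun i => by
    refine inv_ne_zero (Finset.prod_ne_zero_iff.2 fun l hl => sub_ne_zero.2 fun h => ?_)
    exact (Finset.ne_of_mem_erase hl) (hα h).symm
  have hsum : ∀ f : K[X], f.degree < (2 * h - 1 : ℕ) → ∑ i, u i * f.eval (α i) = 0 := by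
    intro f hf
    have h1 := Lagrange.coeff_eq_sum (s := Finset.univ) (v := α) hα.injOn (P := f) (by
      rw [Finset.card_univ, Fintype.card_fin]
      exact hf.trans_le (by exact_mod_cast Nat.sub_le _ _))
    rw [Finset.card_univ, Fintype.card_fin, coeff_eq_zero_of_degree_lt hf] at h1
    rw [h1]
    exact Finset.sum_congr rfl fun i _ => by rw [div_eq_inv_mul]
  have hd₁ := finrank_grsCode (by omega : h + j ≤ 2 * h) hα (v := fun _ => 1) fun _ => one_ne_zero
  have hd₂ := finrank_grsCode (by omega : h + j ≤ 2 * h) hα hu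
  have hle : grsCode (h - j) α (fun _ => 1) ≤ dualCode (grsCode (h + j) α u) := by
    intro y hy x hx
    obtain ⟨f, hf, hy⟩ := mem_grsCode.1 hy
    obtain ⟨f', hf', hx⟩ := mem_grsCode.1 hx
    rw [dotProduct]
    simp_rw [hx, hy, one_mul, mul_assoc, ← eval_mul]
    refine hsum _ ?_
    by_cases h0 : f' * f = 0
    · rw [h0, degree_zero]; exact WithBot.bot_lt_coe _
    · have hf0 := right_ne_zero_of_mul h0
      have hf0' := left_ne_zero_of_mul h0
      rw [← natDegree_lt_iff_degree_lt hf0] at hf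
      rw [← natDegree_lt_iff_degree_lt hf0'] at hf'
      rw [← natDegree_lt_iff_degree_lt h0, natDegree_mul hf0' hf0]
      omega
  have heq := Submodule.eq_of_le_of_finrank_eq hle (by
    have h1 := finrank_add_finrank_dualCode (grsCode (h + j) α u)
    rw [Fintype.card_fin] at h1
    rw [finrank_grsCode (by omega) hα fun _ => one_ne_zero]
    omega)
  refine ⟨grsCode (h + j) α fun _ => 1, grsCode (h + j) α u,
    ⟨by omega, α, _, hα, fun _ => one_ne_zero, fun c => mem_grsCode⟩,
    ⟨by omega, α, u, hα, hu, fun c => mem_grsCode⟩, ?_, ?_⟩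
  · rw [← heq]
    exact grsCode_mono (by omega) _ _
  · rw [hd₁, hd₂, Fintype.card_fin]; omega

end GRS

/-! ### Concatenation -/

section Concatenation

variable {F K : Type*} [Field F] [Field K] [Algebra F K] {n N k : ℕ}

theorem concatMap_block (β : Module.Basis (Fin k) F K) (g : Fin k → Fin n → F) (x : Fin N → K)
    (i : Fin N) : (fun t => concatMap N β g x (i, t)) = ∑ j, β.repr (x i) j • g j := by
  funext t
  simp [concatMap, Finset.sum_apply]

theorem dotProduct_eq_sum_blocks (x y : Fin N × Fin n → F) :
    x ⬝ᵥ y = ∑ i, (fun t => x (i, t)) ⬝ᵥ (fun t => y (i, t)) := by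
  simp only [dotProduct, Fintype.sum_prod_type]

/-- The symbols carried by the blocks of a word, measured with the vectors `g'`. -/
noncomputable def symbolMap (N : ℕ) (β : Module.Basis (Fin k) F K) (g' : Fin k → Fin n → F) :
    (Fin N × Fin n → F) →ₗ[F] (Fin N → K) :=
  LinearMap.pi fun i => ∑ j, ((dotForm F (Fin n) (g' j)).comp
    (LinearMap.funLeft F F fun t => (i, t))).smulRight (β j)

theorem symbolMap_apply (β : Module.Basis (Fin k) F K) (g' : Fin k → Fin n → F)
    (y : Fin N × Fin n → F) (i : Fin N) :
    symbolMap N β g' y i = ∑ j, (g' j ⬝ᵥ fun t => y (i, t)) • β j := by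
  simp [symbolMap, LinearMap.sum_apply, dotForm_apply]
  rfl

theorem symbolMap_concatMap {g g' : Fin k → Fin n → F}
    (hgg' : ∀ l m, g l ⬝ᵥ g' m = if l = m then 1 else 0) (β : Module.Basis (Fin k) F K)
    (x : Fin N → K) : symbolMap N β g' (concatMap N β g x) = x := by
  funext i
  rw [symbolMap_apply, concatMap_block]
  have : ∀ j, (g' j ⬝ᵥ ∑ l, β.repr (x i) l • g l) = β.repr (x i) j := by
    intro j
    rw [dotProduct_comm]
    simp [sum_dotProduct, smul_dotProduct, hgg']
  simp_rw [this]
  exact β.sum_repr _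

theorem symbolMap_blockSum {B : Submodule F (Fin n → F)} {g' : Fin k → Fin n → F}
    (hg' : ∀ j, g' j ∈ dualCode B) (β : Module.Basis (Fin k) F K) {y : Fin N × Fin n → F}
    (hy : y ∈ blockSum N B) : symbolMap N β g' y = 0 := by
  funext i
  rw [symbolMap_apply]
  refine Finset.sum_eq_zero fun j _ => ?_
  rw [dotProduct_comm, hg' j _ (hy i), zero_smul]

theorem finrank_blockSum (B : Submodule F (Fin n → F)) :
    Module.finrank F (blockSum N B) = N * Module.finrank F B := by
  let e : blockSum N B ≃ₗ[F] (Fin N → B) :=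
    { toFun := fun y i => ⟨fun t => y.1 (i, t), y.2 i⟩
      invFun := fun z => ⟨fun p => (z p.1).1 p.2, fun i => (z i).2⟩
      map_add' := fun _ _ => rfl
      map_smul' := fun _ _ => rfl
      left_inv := fun _ => rfl
      right_inv := fun _ => rfl }
  rw [e.finrank_eq, Module.finrank_pi_fintype]
  simp

theorem finrank_concat {B : Submodule F (Fin n → F)} {g g' : Fin k → Fin n → F}
    (hgg' : ∀ l m, g l ⬝ᵥ g' m = if l = m then 1 else 0) (hg' : ∀ j, g' j ∈ dualCode B)
    (β : Module.Basis (Fin k) F K) (D : Submodule K (Fin N → K)) :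
    Module.finrank F
        ↥((D.restrictScalars F).map (concatMap N β g) ⊔ blockSum N B : Submodule F _) =
      k * Module.finrank K D + N * Module.finrank F B := by
  have hinf : (D.restrictScalars F).map (concatMap N β g) ⊓ blockSum N B = ⊥ := by
    rw [Submodule.eq_bot_iff]
    rintro _ ⟨⟨x, _, rfl⟩, hx⟩
    have h1 := symbolMap_blockSum hg' β hx
    rw [symbolMap_concatMap hgg'] at h1
    rw [h1, map_zero]
  have hinj : Function.Injective (concatMap N β g) :=
    Function.LeftInverse.injective (symbolMap_concatMap hgg' β)
  have h := Submodule.finrank_sup_add_finrank_inf_eq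
    ((D.restrictScalars F).map (concatMap N β g)) (blockSum N B)
  rw [hinf, finrank_bot, add_zero, finrank_blockSum,
    ← (Submodule.equivMapOfInjective _ hinj (D.restrictScalars F)).finrank_eq] at h
  have hF : Module.finrank F (D.restrictScalars F) = k * Module.finrank K D := by
    have h1 : Module.finrank F K = k := by
      rw [Module.finrank_eq_card_basis β, Fintype.card_fin]
    have : Module.Finite F K := Module.Finite.of_basis β
    rw [← h1]
    exact (Module.finrank_mul_finrank F K D).symm
  rw [h, hF]

/-- The dual of a concatenation is the concatenation of the duals. -/
theorem dualCode_concat {C₁ C₂ : Submodule F (Fin n → F)} {g g' : Fin k → Fin n → F}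
    {β β' : Module.Basis (Fin k) F K}
    (h₁ : C₁ = dualCode C₂ ⊔ Submodule.span F (Set.range g))
    (h₂ : C₂ = dualCode C₁ ⊔ Submodule.span F (Set.range g'))
    (hgg' : ∀ l m, g l ⬝ᵥ g' m = if l = m then 1 else 0)
    (hββ' : ∀ l m, Algebra.trace F K (β l * β' m) = if l = m then 1 else 0)
    (D : Submodule K (Fin N → K)) :
    dualCode (((dualCode D).restrictScalars F).map (concatMap N β g) ⊔ blockSum N (dualCode C₂)) =
      (D.restrictScalars F).map (concatMap N β' g') ⊔ blockSum N (dualCode C₁) := by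
  have hg : ∀ j, g j ∈ C₁ := fun j => by
    rw [h₁]; exact Submodule.mem_sup_right (Submodule.subset_span ⟨j, rfl⟩)
  have hg' : ∀ j, g' j ∈ C₂ := fun j => by
    rw [h₂]; exact Submodule.mem_sup_right (Submodule.subset_span ⟨j, rfl⟩)
  have hle : dualCode C₂ ≤ C₁ := by conv_rhs => rw [h₁]
                                    exact le_sup_left
  have hπ : ∀ x y : Fin N → K, concatMap N β g x ⬝ᵥ concatMap N β' g' y =
      Algebra.trace F K (x ⬝ᵥ y) := by
    intro x y
    rw [dotProduct_eq_sum_blocks, dotProduct, map_sum]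
    refine Finset.sum_congr rfl fun i _ => ?_
    rw [concatMap_block, concatMap_block]
    conv_rhs => rw [← β.sum_repr (x i), ← β'.sum_repr (y i)]
    simp only [sum_dotProduct, dotProduct_sum, smul_dotProduct, dotProduct_smul, hgg',
      Finset.sum_mul, Finset.mul_sum, map_sum, smul_mul_assoc, mul_smul_comm, map_smul, hββ']
  have hblock : ∀ (β : Module.Basis (Fin k) F K) {C : Submodule F (Fin n → F)}
      {g : Fin k → Fin n → F}, (∀ j, g j ∈ C) → ∀ (x : Fin N → K) i,
      (fun t => concatMap N β g x (i, t)) ∈ C := by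
    intro β C g hg x i
    rw [concatMap_block]
    exact Submodule.sum_mem _ fun j _ => Submodule.smul_mem _ _ (hg j)
  refine le_antisymm (fun w hw => ?_) (sup_le ?_ ?_)
  · have hwC : ∀ i, (fun t => w (i, t)) ∈ C₂ := by
      intro i
      rw [← dualCode_dualCode C₂]
      intro b hb
      have hb' : (fun p : Fin N × Fin n => if p.1 = i then b p.2 else 0) ∈
          blockSum N (dualCode C₂) := by
        intro i'
        by_cases h : i' = i
        · simpa [h] using hb
        · simp only [h, if_false]
          exact (dualCode C₂).zero_mem
      have h := hw _ (Submodule.mem_sup_right hb')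
      rw [dotProduct_eq_sum_blocks, Finset.sum_eq_single i] at h
      · simpa using h
      · intro i' _ hi'
        simp [hi', dotProduct]
      · simp
    let y : Fin N → K := fun i => ∑ j, (g j ⬝ᵥ fun t => w (i, t)) • β' j
    have hrepr : ∀ i j, β'.repr (y i) j = g j ⬝ᵥ fun t => w (i, t) := by
      intro i j
      have := β'.repr_sum_self fun j => g j ⬝ᵥ fun t => w (i, t)
      exact congrFun this j
    have hu : w - concatMap N β' g' y ∈ blockSum N (dualCode C₁) := by
      intro i c hc
      have hblk : (fun t => (w - concatMap N β' g' y) (i, t)) =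
          (fun t => w (i, t)) - ∑ j, (g j ⬝ᵥ fun t => w (i, t)) • g' j := by
        simp_rw [← hrepr]
        rw [← concatMap_block]
        rfl
      rw [hblk]
      have hmem : (fun t => w (i, t)) - ∑ j, (g j ⬝ᵥ fun t => w (i, t)) • g' j ∈ C₂ :=
        sub_mem (hwC i) (Submodule.sum_mem _ fun j _ => Submodule.smul_mem _ _ (hg' j))
      set z := (fun t => w (i, t)) - ∑ j, (g j ⬝ᵥ fun t => w (i, t)) • g' j with hz
      have hgz : ∀ l, g l ⬝ᵥ z = 0 := by
        intro l
        simp [hz, dotProduct_sub, dotProduct_sum, dotProduct_smul, hgg']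
      rw [h₁] at hc
      obtain ⟨b, hb, s, hs, rfl⟩ := Submodule.mem_sup.1 hc
      obtain ⟨a, rfl⟩ := (Submodule.mem_span_range_iff_exists_fun F).1 hs
      rw [add_dotProduct, dotProduct_comm b, hb z hmem, zero_add, sum_dotProduct]
      exact Finset.sum_eq_zero fun l _ => by rw [smul_dotProduct, hgz, smul_zero]
    have hyD : y ∈ D := by
      rw [← dualCode_dualCode D]
      intro x hx
      -- All scalar multiples of `x` are orthogonal to `y` for the trace form.
      have htr : ∀ l, Algebra.trace F K (β l * (x ⬝ᵥ y)) = 0 := by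
        intro l
        have hxl : β l • x ∈ dualCode D := (dualCode D).smul_mem _ hx
        have h1 := hw _ (Submodule.mem_sup_left (Submodule.mem_map_of_mem
          (f := concatMap N β g) (show β l • x ∈ (dualCode D).restrictScalars F from hxl)))
        have h2 : concatMap N β g (β l • x) ⬝ᵥ (w - concatMap N β' g' y) = 0 := by
          rw [dotProduct_eq_sum_blocks]
          exact Finset.sum_eq_zero fun i _ => hu i _ (hblock β hg _ i)
        rw [dotProduct_sub, h1, zero_sub, neg_eq_zero, hπ, smul_dotProduct, smul_eq_mul] at h2
        exact h2
      refine (β'.ext_elem_iff).2 fun l => ?_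
      have h1 := htr l
      rw [← β'.sum_repr (x ⬝ᵥ y)] at h1
      simp only [Finset.mul_sum, mul_smul_comm, map_sum, map_smul, hββ', smul_eq_mul, mul_ite,
        mul_one, mul_zero, Finset.sum_ite_eq, Finset.mem_univ, if_true] at h1
      rw [h1, map_zero, Finsupp.zero_apply]
    rw [← sub_add_cancel w (concatMap N β' g' y), add_comm]
    exact Submodule.add_mem_sup (Submodule.mem_map_of_mem (f := concatMap N β' g')
      (show y ∈ D.restrictScalars F from hyD)) hu
  · rintro _ ⟨y, hy, rfl⟩ z hz
    obtain ⟨_, ⟨x, hx, rfl⟩, b, hb, rfl⟩ := Submodule.mem_sup.1 hz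
    rw [add_dotProduct, hπ, dotProduct_comm x y, hx y hy, map_zero, zero_add,
      dotProduct_eq_sum_blocks]
    refine Finset.sum_eq_zero fun i _ => ?_
    rw [dotProduct_comm]
    exact hb i _ (hblock β' hg' y i)
  · intro c hc z hz
    obtain ⟨_, ⟨x, hx, rfl⟩, b, hb, rfl⟩ := Submodule.mem_sup.1 hz
    rw [dotProduct_eq_sum_blocks]
    refine Finset.sum_eq_zero fun i _ => hc i _ ?_
    exact add_mem (hblock β hg x i) (hle (hb i))

theorem IsConcatenation.symm {C₁ C₂ : Submodule F (Fin n → F)} {D₁ D₂ : Submodule K (Fin N → K)}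
    {L₁ L₂ : Submodule F (Fin N × Fin n → F)} (h : IsConcatenation k C₁ C₂ D₁ D₂ L₁ L₂) :
    IsConcatenation k C₂ C₁ D₂ D₁ L₂ L₁ := by
  obtain ⟨g, g', β, β', h₁, h₂, hgg', hββ', rfl, rfl⟩ := h
  have hgg : ∀ l m, g' l ⬝ᵥ g m = if l = m then 1 else 0 := fun l m => by
    rw [dotProduct_comm, hgg']; simp only [eq_comm]
  have hββ : ∀ l m, Algebra.trace F K (β' l * β m) = if l = m then 1 else 0 := fun l m => by
    rw [mul_comm, hββ']; simp only [eq_comm]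
  exact ⟨g', g, β', β, h₂, h₁, hgg, hββ, dualCode_concat h₁ h₂ hgg' hββ' D₂,
    (dualCode_concat h₂ h₁ hgg hββ D₁).symm⟩

theorem IsConcatenation.isConjugatePair {C₁ C₂ : Submodule F (Fin n → F)}
    {D₁ D₂ : Submodule K (Fin N → K)} {L₁ L₂ : Submodule F (Fin N × Fin n → F)}
    (h : IsConcatenation k C₁ C₂ D₁ D₂ L₁ L₂) {κ : ℕ} (hD : IsConjugatePair D₁ D₂ κ) :
    IsConjugatePair L₁ L₂ (k * κ) := by
  obtain ⟨g, g', β, β', h₁, h₂, hgg', hββ', rfl, rfl⟩ := h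
  have hg' : ∀ j, g' j ∈ dualCode (dualCode C₂) := fun j => by
    rw [dualCode_dualCode, h₂]; exact Submodule.mem_sup_right (Submodule.subset_span ⟨j, rfl⟩)
  refine ⟨?_, ?_⟩
  · rw [dualCode_dualCode]
    exact sup_le_sup_right (Submodule.map_mono
      (show (dualCode D₂).restrictScalars F ≤ D₁.restrictScalars F from hD.dual_le)) _
  · have h3 := finrank_add_finrank_dualCode
      (((dualCode D₂).restrictScalars F).map (concatMap N β g) ⊔ blockSum N (dualCode C₂))
    have h4 := finrank_add_finrank_dualCode D₂
    have h5 := hD.dim_eq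
    rw [finrank_concat hgg' hg'] at h3 ⊢
    rw [Fintype.card_fin] at h4 h5
    have h6 : k * Module.finrank K D₁ = k * Module.finrank K (dualCode D₂) + k * κ := by
      rw [← mul_add]; congr 1; omega
    omega

end Concatenation

/-- A degree `k` extension of a finite field, in the same universe. -/
theorem exists_field_extension (F : Type*) [Field F] [Finite F] {k : ℕ} (hk : 0 < k) :
    ∃ (K : Type _) (_ : Field K) (_ : Algebra F K), Module.finrank F K = k ∧ Finite K := by
  have := NeZero.of_pos hk
  obtain ⟨p, hp⟩ := CharP.exists F
  have : Fact p.Prime := ⟨CharP.char_is_prime F p⟩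
  refine ⟨ULift (FiniteField.Extension F p k), inferInstance, inferInstance, ?_, inferInstance⟩
  rw [(ULift.moduleEquiv (R := F) (M := FiniteField.Extension F p k)).finrank_eq,
    FiniteField.finrank_extension]

/-! ### The error probability of independent blocks -/

open Classical in
/-- The probability that more than `t` of `N` independent blocks are bad is at most
`2 ^ N P ^ (t + 1)`, by the union bound over the sets of `t + 1` blocks. -/
theorem sum_prod_bad_le {V : Type*} [Fintype V] {N : ℕ} (t : ℕ) {w : V → ℝ} (hw : ∀ v, 0 ≤ w v)
    (hw1 : ∑ v, w v = 1) (bad : V → Prop) :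
    (∑ y : Fin N → V, if t < (Finset.univ.filter fun i => bad (y i)).card then ∏ i, w (y i) else 0) ≤
      2 ^ N * (∑ v, if bad v then w v else 0) ^ (t + 1) := by
  set P := ∑ v, if bad v then w v else 0 with hP
  have hP0 : 0 ≤ P := Finset.sum_nonneg fun v _ => by split_ifs; exacts [hw v, le_rfl]
  let φ : Finset (Fin N) → (Fin N → V) → ℝ := fun A y =>
    ∏ i, if i ∈ A then (if bad (y i) then w (y i) else 0) else w (y i)
  have hφ0 : ∀ A y, 0 ≤ φ A y := fun A y => Finset.prod_nonneg fun i _ => by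
    split_ifs
    exacts [hw _, le_rfl, hw _]
  have hφ : ∀ A ∈ Finset.powersetCard (t + 1) Finset.univ, ∑ y, φ A y = P ^ (t + 1) := by
    intro A hA
    have h := Finset.prod_univ_sum (fun _ : Fin N => (Finset.univ : Finset V))
      (fun i v => if i ∈ A then (if bad v then w v else 0) else w v)
    rw [Fintype.piFinset_univ] at h
    rw [← h]
    have h2 : ∀ i, (∑ v, if i ∈ A then (if bad v then w v else 0) else w v) =
        if i ∈ A then P else 1 := by
      intro i
      by_cases hi : i ∈ A
      · simp [hi, hP]
      · simp [hi, hw1]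
    simp_rw [h2]
    rw [Finset.prod_ite_mem, Finset.univ_inter, Finset.prod_const,
      (Finset.mem_powersetCard.1 hA).2]
  calc (∑ y : Fin N → V,
        if t < (Finset.univ.filter fun i => bad (y i)).card then ∏ i, w (y i) else 0)
      ≤ ∑ y : Fin N → V, ∑ A ∈ Finset.powersetCard (t + 1) Finset.univ, φ A y := by
        refine Finset.sum_le_sum fun y _ => ?_
        split_ifs with h
        · obtain ⟨A, hA, hAc⟩ := Finset.exists_subset_card_eq (Nat.succ_le_of_lt h)
          have h1 : ∏ i, w (y i) = φ A y := by
            refine Finset.prod_congr rfl fun i _ => ?_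
            by_cases hi : i ∈ A
            · simp [hi, (Finset.mem_filter.1 (hA hi)).2]
            · simp [hi]
          rw [h1]
          exact Finset.single_le_sum (f := fun A => φ A y) (fun A _ => hφ0 A y)
            (Finset.mem_powersetCard.2 ⟨Finset.subset_univ _, hAc⟩)
        · exact Finset.sum_nonneg fun A _ => hφ0 A y
    _ = (N.choose (t + 1) : ℝ) * P ^ (t + 1) := by
        rw [Finset.sum_comm, Finset.sum_congr rfl hφ, Finset.sum_const, Finset.card_powersetCard,
          Finset.card_univ, Fintype.card_fin, nsmul_eq_mul]
    _ ≤ 2 ^ N * P ^ (t + 1) := by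
        refine mul_le_mul_of_nonneg_right ?_ (pow_nonneg hP0 _)
        exact_mod_cast Nat.choose_le_two_pow N (t + 1)

section ErrorProbability

variable {F : Type*} [Field F] [Fintype F] {W : F → ℝ}

open Classical in
theorem decodingErrorProb_eq {ι : Type*} [Fintype ι] [Fintype (ι → F)] (W : F → ℝ)
    (B : Submodule F (ι → F)) (g : (ι → F) → (ι → F)) :
    decodingErrorProb W B g = ∑ e : ι → F, if e - g e ∈ B then 0 else ∏ i, W (e i) := by
  rw [decodingErrorProb]
  congr!

theorem sum_prod_eq_pow {A ι : Type*} [Fintype A] [Fintype ι] [Fintype (ι → A)] (W : A → ℝ) :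
    ∑ e : ι → A, ∏ i, W (e i) = (∑ x, W x) ^ Fintype.card ι := by
  classical
  have h := Finset.prod_univ_sum (fun _ : ι => (Finset.univ : Finset A)) (fun _ v => W v)
  rw [Fintype.piFinset_univ, Finset.prod_const, Finset.card_univ] at h
  rw [h]
  congr!

theorem sum_prod_eq_one {A ι : Type*} [Fintype A] [Fintype ι] [Fintype (ι → A)] {W : A → ℝ}
    (hW : W ∈ stdSimplex ℝ A) : ∑ e : ι → A, ∏ i, W (e i) = 1 := by
  rw [sum_prod_eq_pow, hW.2, one_pow]

theorem decodingErrorProb_nonneg {ι : Type*} [Fintype ι] (hW : W ∈ stdSimplex ℝ F)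
    (B : Submodule F (ι → F)) (g : (ι → F) → (ι → F)) : 0 ≤ decodingErrorProb W B g := by
  classical
  refine Finset.sum_nonneg fun e _ => ?_
  split_ifs
  · exact le_rfl
  · exact Finset.prod_nonneg fun i _ => hW.1 _

open Classical in
/-- A decoder of a concatenated code that succeeds whenever at most `t` inner decoders fail. -/
theorem decodingErrorProb_le_of_blocks {n N t : ℕ} (hW : W ∈ stdSimplex ℝ F)
    {B : Submodule F (Fin n → F)} {gi : (Fin n → F) → (Fin n → F)}
    {B' : Submodule F (Fin N × Fin n → F)} {g : (Fin N × Fin n → F) → (Fin N × Fin n → F)}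
    (h : ∀ e : Fin N × Fin n → F,
      (Finset.univ.filter fun i => (fun t => e (i, t)) - gi (fun t => e (i, t)) ∉ B).card ≤ t →
        e - g e ∈ B') :
    decodingErrorProb W B' g ≤ 2 ^ N * decodingErrorProb W B gi ^ (t + 1) := by
  have hprod0 : ∀ v : Fin n → F, 0 ≤ ∏ i, W (v i) :=
    fun v => Finset.prod_nonneg fun i _ => hW.1 _
  obtain ⟨bad, hbad⟩ : ∃ bad : (Fin n → F) → Prop, ∀ v, bad v ↔ v - gi v ∉ B :=
    ⟨_, fun _ => Iff.rfl⟩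
  have key := sum_prod_bad_le (N := N) t hprod0 (sum_prod_eq_one hW) bad
  refine le_trans ?_ (key.trans_eq ?_)
  swap
  · rw [decodingErrorProb_eq]
    congr 2
    refine Finset.sum_congr rfl fun v _ => ?_
    by_cases hv : v - gi v ∈ B <;> simp [hv, hbad]
  rw [decodingErrorProb_eq, ← (Equiv.curry (Fin N) (Fin n) F).symm.sum_comp]
  refine Finset.sum_le_sum fun y _ => ?_
  have hy : ∏ p, W ((Equiv.curry (Fin N) (Fin n) F).symm y p) = ∏ i, ∏ t, W (y i t) := by
    rw [Fintype.prod_prod_type]; rfl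
  have hn : 0 ≤ ∏ i, ∏ t, W (y i t) := Finset.prod_nonneg fun i _ => hprod0 _
  rw [hy]
  by_cases ht : t < (Finset.univ.filter fun i => bad (y i)).card
  · rw [if_pos ht]
    split_ifs
    exacts [hn, le_rfl]
  · rw [if_neg ht, if_pos]
    refine h _ (le_trans (Finset.card_le_card fun i hi => ?_) (not_lt.1 ht))
    exact Finset.mem_filter.2 ⟨Finset.mem_univ _, (hbad _).2 (Finset.mem_filter.1 hi).2⟩

end ErrorProbability

/-! ### The decoder of a concatenated code -/

section Decoder

variable {F K : Type*} [Field F] [Field K] [Algebra F K] {n N k : ℕ}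

/-- A linear choice of representatives of the cosets of a code. -/
theorem exists_linear_coset_representative {ι : Type*} (L : Submodule F (ι → F)) :
    ∃ ρ : (ι → F) →ₗ[F] (ι → F), (∀ c ∈ L, ρ c = 0) ∧ ∀ y, y - ρ y ∈ L := by
  obtain ⟨V, hV⟩ := Submodule.exists_isCompl L
  refine ⟨V.projection L hV.symm, fun c hc => ?_, fun y => ?_⟩
  · exact (Submodule.projection_apply_eq_zero_iff hV.symm).2 hc
  · rw [← Submodule.projection_apply_eq_zero_iff hV.symm, map_sub, sub_eq_zero]
    exact (Submodule.projection_apply_left hV.symm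
      ⟨_, Submodule.projection_apply_mem hV.symm y⟩).symm

theorem Derivable.linearMap {ι κ : Type*} [Fintype ι] [Fintype κ]
    (f : (ι → F) →ₗ[F] (κ → F)) :
    Derivable (inputsAndConstants ι F) (Fintype.card κ * (2 * Fintype.card ι))
      (Set.range fun o x => f x o) := by
  classical
  refine Derivable.range fun o => ?_
  have h := Derivable.linearForm (S := inputsAndConstants ι F)
    (fun i => f (Pi.single i 1) o) (u := fun i x => x i) (Or.inr ⟨0, rfl⟩)
    (fun i => Or.inl ⟨i, rfl⟩)
  convert h using 3 with x
  conv_lhs => rw [LinearMap.pi_apply_eq_sum_univ f x]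
  simp only [Finset.sum_apply, Pi.smul_apply, smul_eq_mul, mul_comm]
  refine Finset.sum_congr rfl fun i _ => ?_
  have h1 : (fun j => if i = j then (1 : F) else 0) = Pi.single i 1 := by
    funext j
    simp [Pi.single_apply, eq_comm]
  rw [h1]

/-- The inner decoding of all blocks, followed by the extraction of the symbols. -/
noncomputable def innerDecode (N : ℕ) (β : Module.Basis (Fin k) F K) (g' : Fin k → Fin n → F)
    (gi : (Fin n → F) → (Fin n → F)) (y : Fin N × Fin n → F) : Fin N → K :=
  symbolMap N β g' (y - fun p => gi (fun t => y (p.1, t)) p.2)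

/-- The error estimate for a word of the concatenated code: inner decoding, decoding of the outer
generalized Reed-Solomon code, and encoding again. -/
noncomputable def errorEstimate (κ t : ℕ) (α v : Fin N → K) (β : Module.Basis (Fin k) F K)
    (g g' : Fin k → Fin n → F) (gi : (Fin n → F) → (Fin n → F)) (y : Fin N × Fin n → F) :
    Fin N × Fin n → F :=
  y - concatMap N β g (rsDecode κ t α v (innerDecode N β g' gi y))

open Classical in
/-- If at most `t` blocks are corrected wrongly by the inner decoder, then the outer decoder recovers
the word of `D`, and the error estimate is right up to words of `⨁ B`. -/
theorem errorEstimate_spec {κ t : ℕ} {α v : Fin N → K} (hα : Function.Injective α)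
    (hv : ∀ i, v i ≠ 0) (hN : κ + 2 * t ≤ N) {D : Submodule K (Fin N → K)}
    (hD : ∀ c, c ∈ D ↔ ∃ f : Polynomial K, f.degree < (κ : WithBot ℕ) ∧
      ∀ i, c i = v i * f.eval (α i))
    {C B : Submodule F (Fin n → F)} {g g' : Fin k → Fin n → F}
    (hC : ∀ j, g j ∈ C) (hB : B ≤ C) (hg' : ∀ j, g' j ∈ dualCode B)
    (hgg' : ∀ l m, g l ⬝ᵥ g' m = if l = m then 1 else 0) (β : Module.Basis (Fin k) F K)
    {gi : (Fin n → F) → (Fin n → F)} (hgi : IsSyndromeDecoder C gi) {c e : Fin N × Fin n → F}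
    (hc : c ∈ (D.restrictScalars F).map (concatMap N β g) ⊔ blockSum N B)
    (he : (Finset.univ.filter
      fun i => (fun t => e (i, t)) - gi (fun t => e (i, t)) ∉ B).card ≤ t) :
    e - errorEstimate κ t α v β g g' gi (c + e) ∈ blockSum N B := by
  obtain ⟨_, ⟨x, hx, rfl⟩, b, hb, rfl⟩ := Submodule.mem_sup.1 hc
  obtain ⟨f, hf, hxf⟩ := (hD x).1 hx
  have hdec : rsDecode κ t α v
      (innerDecode N β g' gi (concatMap N β g x + b + e)) = x := by
    rw [rsDecode_eq hα hv hN hf _ he]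
    · funext i; exact (hxf i).symm
    · intro i hi
      have hi' : (fun t => e (i, t)) - gi (fun t => e (i, t)) ∈ B := by
        simpa using hi
      have hblk : gi (fun t => (concatMap N β g x + b + e) (i, t)) =
          gi (fun t => e (i, t)) := by
        rw [← hgi (fun t => e (i, t)) (fun t => (concatMap N β g x + b) (i, t)) ?_]
        · congr 1
          funext t
          simp only [Pi.add_apply]
          ring
        · have h1 : (fun t => concatMap N β g x (i, t)) ∈ C := by
            rw [concatMap_block]
            exact Submodule.sum_mem _ fun j _ => Submodule.smul_mem _ _ (hC j)
          exact C.add_mem h1 (hB (hb i))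
      rw [← hxf i]
      have h1 := congrFun (symbolMap_concatMap (N := N) hgg' β x) i
      rw [symbolMap_apply] at h1
      rw [innerDecode, symbolMap_apply, ← h1]
      refine Finset.sum_congr rfl fun j _ => ?_
      congr 1
      have h2 : (fun t => (concatMap N β g x + b + e -
          fun p : Fin N × Fin n => gi (fun t => (concatMap N β g x + b + e) (p.1, t)) p.2) (i, t)) =
          (fun t => concatMap N β g x (i, t)) + ((fun t => b (i, t)) +
            ((fun t => e (i, t)) - gi (fun t => e (i, t)))) := by
        rw [← hblk]
        funext t
        simp only [Pi.add_apply, Pi.sub_apply]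
        ring
      rw [h2, dotProduct_add, dotProduct_comm (g' j) (_ + _), hg' j _ (B.add_mem (hb i) hi'),
        add_zero]
  rw [errorEstimate, hdec]
  have h3 : e - (concatMap N β g x + b + e - concatMap N β g x) = -b := by abel
  rw [h3]
  exact neg_mem hb

variable [Fintype F]

theorem Derivable.errorEstimate {X : Type*} {S : Set (X → F)} (hc : ∀ c : F, (fun _ => c) ∈ S)
    {κ t : ℕ} (hN : κ + 2 * t ≤ N) (α v : Fin N → K) (β : Module.Basis (Fin k) F K)
    (g g' : Fin k → Fin n → F) (gi : (Fin n → F) → (Fin n → F)) {y : Fin N × Fin n → X → F}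
    (hy : ∀ p, y p ∈ S) :
    Derivable S (N * k * (2 * Fintype.card F ^ (n + 1)) +
        40 * (N + 1) ^ 3 * (k * (2 * Fintype.card F ^ (k + k + 1))) + N * n * (2 * k) + N * n)
      (Set.range fun o x => errorEstimate κ t α v β g g' gi (fun p => y p x) o) := by
  let e : K ≃ (Fin k → F) := β.equivFun.toEquiv
  let z : Fin N → X → K := fun i x => innerDecode N β g' gi (fun p => y p x) i
  have hz : ∀ i x j, e (z i x) j = g' j ⬝ᵥ ((fun t => y (i, t) x) - gi (fun t => y (i, t) x)) := by
    intro i x j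
    have h1 : z i x = _ := symbolMap_apply β g' _ i
    rw [h1]
    change β.equivFun _ j = _
    rw [Module.Basis.equivFun_apply, β.repr_sum_self]
    rfl
  have h1 : Derivable S _ (Set.range fun (q : Fin N × Fin k) x => e (z q.1 x) q.2) :=
    Derivable.range fun q => by
      have := Derivable.lookup hc (fun u : Fin n → F => g' q.2 ⬝ᵥ (u - gi u))
        (u := fun t => y (q.1, t)) (fun t => hy _)
      simpa only [hz] using this
  let r : Fin N → X → K := fun i x => _root_.rsDecode κ t α v (fun i => z i x) i
  have h2 : Derivable (Set.range z ∪ Set.range fun (c : K) (_ : X) => c) _ (Set.range r) :=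
    Derivable.rsDecode (fun c => Or.inr ⟨c, rfl⟩) hN α v (fun i => Or.inl ⟨i, rfl⟩)
  have h3 := h2.changeAlphabet e (S' := S ∪ Set.range fun (q : Fin N × Fin k) x => e (z q.1 x) q.2)
    (by
      rintro _ ⟨φ, ⟨i, rfl⟩ | ⟨c, rfl⟩, j, rfl⟩
      · exact Or.inr ⟨(i, j), rfl⟩
      · exact Or.inl (hc _))
    (fun c => Or.inl (hc c))
  have h4 := (h1.trans h3).trans (Derivable.range fun p : Fin N × Fin n =>
    Derivable.linearForm (fun j => g j p.2) (u := fun j x => e (r p.1 x) j) (Or.inl (hc 0))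
      (fun j => Or.inr (Or.inr ⟨r p.1, ⟨p.1, rfl⟩, j, rfl⟩)))
  have h5 := h4.trans (Derivable.range fun p : Fin N × Fin n =>
    Derivable.gate (fun a b => a - b) (u := y p)
      (v := fun x => ∑ j, g j p.2 * e (r p.1 x) j) (Or.inl (hy p)) (Or.inr (Or.inr ⟨p, rfl⟩)))
  refine h5.mono subset_rfl ?_ ?_
  · simp only [Fintype.card_prod, Fintype.card_fin, mul_one]
    exact le_rfl
  · rintro _ ⟨p, rfl⟩
    refine Or.inr ⟨p, ?_⟩
    funext x
    change _ = y p x - concatMap N β g (fun i => r i x) p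
    simp only [concatMap, LinearMap.coe_mk, AddHom.coe_mk]
    congr 1
    exact Finset.sum_congr rfl fun j _ => mul_comm _ _

/-- A bound for the number of steps of the decoder of a concatenated code of length `X`, over a field
of `q` elements, when `q ^ n ≤ (2N) ^ c`. -/
noncomputable def stepBound (q c : ℕ) : Polynomial ℕ :=
  let X : Polynomial ℕ := Polynomial.X
  X * (2 * X) + (X * (2 * (q * (2 * X) ^ c)) +
    40 * (2 * X) ^ 3 * (X * (2 * (q * (2 * X) ^ 2))) + X * (2 * X) + X)

/-- Bounded distance decoding of one of the two quotient codes of a concatenation. The syndrome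
enters through a linear choice `ρ` of coset representatives: the estimate for `y` is computed from
`ρ y`, and so it depends only on the coset of `y`. -/
theorem IsConcatenation.exists_decoder {C₁ C₂ : Submodule F (Fin n → F)}
    {D₁ D₂ : Submodule K (Fin N → K)} {L₁ L₂ : Submodule F (Fin N × Fin n → F)}
    (h : IsConcatenation k C₁ C₂ D₁ D₂ L₁ L₂) (hn : 0 < n) (hN : 0 < N)
    (hkn : k ≤ n) {κ₁ t : ℕ} (hD₁ : IsGRS D₁ κ₁)
    (ht : κ₁ + 2 * t ≤ N) {gi : (Fin n → F) → (Fin n → F)} (hgi : IsSyndromeDecoder C₁ gi)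
    {W : F → ℝ} (hW : W ∈ stdSimplex ℝ F) {c : ℕ}
    (hk : Fintype.card F ^ k ≤ 2 * N) (hc : Fintype.card F ^ n ≤ (2 * N) ^ c) :
    ∃ g : (Fin N × Fin n → F) → (Fin N × Fin n → F), IsSyndromeDecoder L₁ g ∧
      (∃ s, s ≤ (stepBound (Fintype.card F) c).eval (n * N) ∧ ComputableInSteps s g) ∧
      decodingErrorProb W (dualCode L₂) g ≤
        2 ^ N * decodingErrorProb W (dualCode C₂) gi ^ (t + 1) := by
  classical
  obtain ⟨g, g', β, β', h₁, h₂, hgg', hββ', hL₁, hL₂⟩ := h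
  obtain ⟨_, α, v, hα, hv, hD⟩ := hD₁
  obtain ⟨ρ, hρ0, hρ⟩ := exists_linear_coset_representative L₁
  have hC : ∀ j, g j ∈ C₁ := fun j => by
    rw [h₁]; exact Submodule.mem_sup_right (Submodule.subset_span ⟨j, rfl⟩)
  have hg' : ∀ j, g' j ∈ dualCode (dualCode C₂) := fun j => by
    rw [dualCode_dualCode, h₂]; exact Submodule.mem_sup_right (Submodule.subset_span ⟨j, rfl⟩)
  have hle : dualCode C₂ ≤ C₁ := by
    conv_rhs => rw [h₁]
    exact le_sup_left
  refine ⟨fun y => errorEstimate κ₁ t α v β g g' gi (ρ y), fun y c hc => ?_, ?_, ?_⟩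
  · simp only [map_add, hρ0 c hc, add_zero]
  · have hd := (Derivable.linearMap ρ).trans (Derivable.errorEstimate
      (S := inputsAndConstants (Fin N × Fin n) F ∪ Set.range fun o x => ρ x o)
      (fun c => Or.inl (Or.inr ⟨c, rfl⟩)) ht α v β g g' gi
      (y := fun p x => ρ x p) (fun p => Or.inr ⟨p, rfl⟩))
    obtain ⟨s, hs, hcs⟩ :=
      (hd.mono subset_rfl le_rfl Set.subset_union_right).computableInSteps
    refine ⟨s, hs.trans ?_, hcs⟩
    simp only [stepBound, Polynomial.eval_add, Polynomial.eval_mul, Polynomial.eval_pow,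
      Polynomial.eval_X, Polynomial.eval_ofNat, Polynomial.eval_natCast, Nat.cast_id,
      Fintype.card_prod,
      Fintype.card_fin]
    have e0 : N * n = n * N := mul_comm _ _
    have e1 : N ≤ n * N := Nat.le_mul_of_pos_left _ hn
    have e2 : n ≤ n * N := Nat.le_mul_of_pos_right _ hN
    have e3 : N * k ≤ n * N := by rw [mul_comm]; exact Nat.mul_le_mul_right _ hkn
    rw [e0]
    set L := n * N
    have e4 : Fintype.card F ^ (n + 1) ≤ Fintype.card F * (2 * L) ^ c := by
      rw [pow_succ, mul_comm]
      exact Nat.mul_le_mul_left _ (hc.trans (Nat.pow_le_pow_left (by omega) c))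
    have e5 : Fintype.card F ^ (k + k + 1) ≤ Fintype.card F * (2 * L) ^ 2 := by
      rw [pow_succ, mul_comm, ← two_mul, mul_comm 2 k, pow_mul]
      exact Nat.mul_le_mul_left _ (Nat.pow_le_pow_left (hk.trans (by omega)) 2)
    have e6 : N + 1 ≤ 2 * L := by omega
    have e7 : k ≤ L := hkn.trans e2
    gcongr
  · refine decodingErrorProb_le_of_blocks hW fun e he => ?_
    have h3 : ρ e = (ρ e - e) + e := by abel
    have h4 : ρ e - e ∈ L₁ := by
      rw [← neg_sub]; exact neg_mem (hρ e)
    rw [hL₁] at h4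
    have h5 := errorEstimate_spec hα hv ht hD hC hle hg' hgg' β hgi h4 he
    rw [← h3] at h5
    rw [hL₂, dualCode_dualCode]
    exact Submodule.mem_sup_right h5

/-- If `L₁ = L₂^⊥`, every coset representative is a correct estimate. -/
theorem exists_decoder_of_dual_eq {L₁ L₂ : Submodule F (Fin N × Fin n → F)}
    (h : dualCode L₂ = L₁) (W : F → ℝ) :
    ∃ g : (Fin N × Fin n → F) → (Fin N × Fin n → F), IsSyndromeDecoder L₁ g ∧
      (∃ s, s ≤ (stepBound (Fintype.card F) 0).eval (n * N) ∧ ComputableInSteps s g) ∧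
      decodingErrorProb W (dualCode L₂) g = 0 := by
  obtain ⟨ρ, hρ0, hρ⟩ := exists_linear_coset_representative L₁
  refine ⟨ρ, fun y c hc => by rw [map_add, hρ0 c hc, add_zero], ?_, ?_⟩
  · obtain ⟨s, hs, hcs⟩ := (Derivable.linearMap ρ).computableInSteps
    refine ⟨s, hs.trans ?_, hcs⟩
    simp only [stepBound, Polynomial.eval_add, Polynomial.eval_mul, Polynomial.eval_pow,
      Polynomial.eval_X, Polynomial.eval_ofNat, Polynomial.eval_natCast, Nat.cast_id,
      Fintype.card_prod,
      Fintype.card_fin]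
    rw [mul_comm N n]
    exact Nat.le_add_right _ _
  · rw [h]
    exact Finset.sum_eq_zero fun e _ => if_pos (hρ e)

end Decoder

/-! ### Random conjugate code pairs -/

section MaximumLikelihood

variable {F ι : Type*} [Field F] [Fintype F] [Fintype ι]

open Classical in
/-- Maximum likelihood decoding. It can fail for the error `e` only if the code contains the
difference to another error that is at least as likely; degenerate errors are not exploited. -/
theorem exists_mlDecoder (W : F → ℝ) (hW : ∀ x, 0 ≤ W x) (C : Submodule F (ι → F)) :
    ∃ g : (ι → F) → (ι → F), IsSyndromeDecoder C g ∧ ∀ B : Submodule F (ι → F),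
      decodingErrorProb W B g ≤ ∑ e : ι → F, (∏ i, W (e i)) *
        min 1 (∑ e' : ι → F, if e' ≠ e ∧ ∏ i, W (e i) ≤ ∏ i, W (e' i) ∧ e' - e ∈ C
          then 1 else 0) := by
  have hmax : ∀ a : (ι → F) ⧸ C, ∃ e : ι → F, Submodule.Quotient.mk e = a ∧
      ∀ e' : ι → F, Submodule.Quotient.mk (p := C) e' = a →
        ∏ i, W (e' i) ≤ ∏ i, W (e i) := by
    intro a
    obtain ⟨y, hy⟩ := Submodule.Quotient.mk_surjective C a
    obtain ⟨e, he, hm⟩ := Finset.exists_max_image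
      (Finset.univ.filter fun e : ι → F => Submodule.Quotient.mk (p := C) e = a)
      (fun e => ∏ i, W (e i)) ⟨y, by simp [hy]⟩
    exact ⟨e, (Finset.mem_filter.1 he).2, fun e' he' => hm e' (by simp [he'])⟩
  choose f hf hfm using hmax
  refine ⟨fun y => f (Submodule.Quotient.mk y), fun y c hc => ?_, fun B => ?_⟩
  · have h1 : Submodule.Quotient.mk (p := C) (y + c) = Submodule.Quotient.mk y := by
      rw [Submodule.Quotient.eq]
      simpa using hc
    simp only [h1]
  · refine Finset.sum_le_sum fun e _ => ?_
    have h0 : 0 ≤ ∏ i, W (e i) := Finset.prod_nonneg fun i _ => hW _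
    have hs0 : ∀ e' : ι → F, (0 : ℝ) ≤ if e' ≠ e ∧ ∏ i, W (e i) ≤ ∏ i, W (e' i) ∧ e' - e ∈ C
        then 1 else 0 := fun e' => by split_ifs <;> norm_num
    split_ifs with h
    · exact mul_nonneg h0 (le_min zero_le_one (Finset.sum_nonneg fun e' _ => hs0 e'))
    · refine le_mul_of_one_le_right h0 (le_min le_rfl ?_)
      refine le_trans ?_ (Finset.single_le_sum (fun e' _ => hs0 e')
        (Finset.mem_univ (f (Submodule.Quotient.mk e))))
      rw [if_pos]
      refine ⟨fun he => h ?_, hfm _ _ rfl, ?_⟩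
      · simp [he]
      · rw [← Submodule.Quotient.eq]; exact hf _

theorem mul_min_one_le {p ρ s M : ℝ} (hp : 0 ≤ p) (hρ : 0 ≤ ρ) (hs0 : 0 ≤ s) (hs1 : s ≤ 1)
    (hM : M * p ≤ 1) : p * min 1 (M * ρ) ≤ p ^ (1 - s) * ρ ^ s := by
  rcases hp.eq_or_lt with rfl | hp
  · rw [zero_mul]; positivity
  have h1 : min 1 (M * ρ) ≤ min 1 (ρ / p) := by
    refine min_le_min_left _ ?_
    rw [le_div_iff₀ hp]
    nlinarith
  have h2 : min 1 (ρ / p) ≤ (ρ / p) ^ s := by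
    rcases le_total (ρ / p) 1 with h | h
    · rw [min_eq_right h]
      conv_lhs => rw [← Real.rpow_one (ρ / p)]
      rcases hs0.eq_or_lt with rfl | hs0
      · simpa using h
      rcases (div_nonneg hρ hp.le).eq_or_lt with h0 | h0
      · rw [← h0, Real.rpow_one]; positivity
      · exact Real.rpow_le_rpow_of_exponent_ge h0 h hs1
    · rw [min_eq_left h]; exact Real.one_le_rpow h hs0
  calc p * min 1 (M * ρ) ≤ p * (ρ / p) ^ s := mul_le_mul_of_nonneg_left (h1.trans h2) hp.le
    _ = p ^ (1 - s) * ρ ^ s := by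
      rw [Real.div_rpow hρ hp.le, Real.rpow_sub hp, Real.rpow_one]
      ring

open Classical in
/-- Gallager's bound for a random code, drawn uniformly from a family `C` of codes, that contains
each nonzero vector with probability at most `ρ`. -/
theorem sum_mlBound_le {G : Type*} [Fintype G] {W : F → ℝ} (hW : W ∈ stdSimplex ℝ F)
    (C : G → Submodule F (ι → F)) {ρ s : ℝ} (hρ : 0 ≤ ρ) (hs0 : 0 ≤ s) (hs1 : s ≤ 1)
    (hC : ∀ x ≠ 0, ((Finset.univ.filter fun A => x ∈ C A).card : ℝ) ≤ ρ * Fintype.card G) :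
    ∑ A, ∑ e : ι → F, (∏ i, W (e i)) *
        min 1 (∑ e' : ι → F, if e' ≠ e ∧ ∏ i, W (e i) ≤ ∏ i, W (e' i) ∧ e' - e ∈ C A
          then (1 : ℝ) else 0) ≤
      Fintype.card G * ((∑ x, W x ^ (1 - s)) ^ Fintype.card ι * ρ ^ s) := by
  have hp : ∀ e : ι → F, 0 ≤ ∏ i, W (e i) := fun e => Finset.prod_nonneg fun i _ => hW.1 _
  have hsum : ∑ e : ι → F, (∏ i, W (e i)) ^ (1 - s) =
      (∑ x, W x ^ (1 - s)) ^ Fintype.card ι := by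
    rw [← sum_prod_eq_pow]
    refine Finset.sum_congr rfl fun e _ => ?_
    rw [Real.finsetProd_rpow _ _ fun i _ => hW.1 _]
  rw [Finset.sum_comm, ← hsum, Finset.sum_mul, Finset.mul_sum]
  refine Finset.sum_le_sum fun e _ => ?_
  -- The number of errors that are at least as likely as `e`.
  set M : ℝ := ∑ e' : ι → F, if ∏ i, W (e i) ≤ ∏ i, W (e' i) then (1 : ℝ) else 0 with hM
  have hMp : M * ∏ i, W (e i) ≤ 1 := by
    rw [hM, Finset.sum_mul]
    refine le_trans ?_ (sum_prod_eq_one (ι := ι) hW).le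
    refine Finset.sum_le_sum fun e' _ => ?_
    split_ifs with h
    · rw [one_mul]; exact h
    · rw [zero_mul]; exact hp e'
  have hG0 : (0 : ℝ) ≤ Fintype.card G := Nat.cast_nonneg _
  have h1 : ∑ A, ∑ e' : ι → F, (if e' ≠ e ∧ ∏ i, W (e i) ≤ ∏ i, W (e' i) ∧ e' - e ∈ C A
      then (1 : ℝ) else 0) ≤ Fintype.card G * (M * ρ) := by
    rw [Finset.sum_comm, hM, Finset.sum_mul, Finset.mul_sum]
    refine Finset.sum_le_sum fun e' _ => ?_
    by_cases h : e' ≠ e ∧ ∏ i, W (e i) ≤ ∏ i, W (e' i)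
    · have h3 := hC (e' - e) (sub_ne_zero.2 h.1)
      rw [if_pos h.2, one_mul, mul_comm]
      refine le_trans (le_of_eq ?_) h3
      rw [Finset.card_filter]
      push_cast
      refine Finset.sum_congr rfl fun A _ => ?_
      simp [h.1, h.2]
    · rw [Finset.sum_eq_zero]
      · split_ifs
        · positivity
        · simp
      · intro A _
        rw [if_neg]
        exact fun h' => h ⟨h'.1, h'.2.1⟩
  calc ∑ A, (∏ i, W (e i)) * min 1 (∑ e' : ι → F,
        if e' ≠ e ∧ ∏ i, W (e i) ≤ ∏ i, W (e' i) ∧ e' - e ∈ C A then (1 : ℝ) else 0)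
      ≤ (∏ i, W (e i)) * (Fintype.card G * min 1 (M * ρ)) := by
        rw [← Finset.mul_sum]
        refine mul_le_mul_of_nonneg_left ?_ (hp e)
        rw [mul_min_of_nonneg _ _ hG0, mul_one]
        refine le_min ?_ ((Finset.sum_le_sum fun A _ => min_le_right _ _).trans h1)
        refine (Finset.sum_le_sum fun A _ => min_le_left _ _).trans (by simp)
    _ = Fintype.card G * ((∏ i, W (e i)) * min 1 (M * ρ)) := by ring
    _ ≤ _ := mul_le_mul_of_nonneg_left (mul_min_one_le (hp e) hρ hs0 hs1 hMp) hG0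

end MaximumLikelihood

section RandomCodes

theorem exists_submodule_finrank_eq {K V : Type*} [Field K] [AddCommGroup V] [Module K V]
    [FiniteDimensional K V] {m : ℕ} (hm : m ≤ Module.finrank K V) :
    ∃ U : Submodule K V, Module.finrank K U = m := by
  let b := Module.finBasis K V
  have hli := b.linearIndependent.comp (Fin.castLE hm) (Fin.castLE_injective hm)
  exact ⟨_, (finrank_span_eq_card hli).trans (Fintype.card_fin m)⟩

variable {F : Type*} [Field F] {n : ℕ}

theorem exists_dotProduct_ne_zero {x y : Fin n → F} (hx : x ≠ 0) (hy : y ≠ 0) :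
    ∃ w, x ⬝ᵥ w ≠ 0 ∧ y ⬝ᵥ w ≠ 0 := by
  classical
  obtain ⟨i, hi⟩ := Function.ne_iff.1 hx
  obtain ⟨j, hj⟩ := Function.ne_iff.1 hy
  simp only [Pi.zero_apply] at hi hj
  by_cases hyi : y i = 0
  · by_cases hxj : x j = 0
    · exact ⟨Pi.single i 1 + Pi.single j 1, by simpa [dotProduct_add, hxj], by
        simpa [dotProduct_add, hyi]⟩
    · exact ⟨Pi.single j 1, by simpa, by simpa⟩
  · exact ⟨Pi.single i 1, by simpa, by simpa⟩

/-- The general linear group acts transitively on the nonzero vectors. -/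
theorem exists_linearEquiv_apply_eq {x y : Fin n → F} (hx : x ≠ 0) (hy : y ≠ 0) :
    ∃ e : (Fin n → F) ≃ₗ[F] (Fin n → F), e x = y := by
  obtain ⟨w, hxw, hyw⟩ := exists_dotProduct_ne_zero hx hy
  let f : (Fin n → F) →ₗ[F] F := dotForm F (Fin n) w
  have hf : ∀ v, f v = v ⬝ᵥ w := fun v => dotProduct_comm w v
  rw [← hf] at hxw hyw
  let φ : (Fin n → F) →ₗ[F] (Fin n → F) := LinearMap.id + (f.smulRight ((f x)⁻¹ • (y - x)))
  have hφ : ∀ v, φ v = v + f v • (f x)⁻¹ • (y - x) := fun v => rfl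
  have hinj : Function.Injective φ := by
    rw [← LinearMap.ker_eq_bot, LinearMap.ker_eq_bot']
    intro v hv
    rw [hφ] at hv
    have h1 := congrArg f hv
    rw [map_add, map_smul, map_smul, map_sub, map_zero] at h1
    have h2 : f v * f y = 0 := by
      have : f v * (f y * (f x)⁻¹) = 0 := by
        rw [← h1]
        simp only [smul_eq_mul]
        field_simp
        ring
      rw [← mul_assoc] at this
      exact (mul_eq_zero.1 this).resolve_right (inv_ne_zero hxw)
    have h3 := (mul_eq_zero.1 h2).resolve_right hyw
    simpa [h3] using hv
  refine ⟨LinearEquiv.ofInjectiveEndo φ hinj, ?_⟩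
  rw [LinearEquiv.coe_ofInjectiveEndo, hφ, smul_smul, mul_inv_cancel₀ hxw, one_smul]
  abel

/-- The general linear group acts transitively on the nonzero linear forms. -/
theorem exists_linearEquiv_dotProduct_eq {x y : Fin n → F} (hx : x ≠ 0) (hy : y ≠ 0) :
    ∃ e : (Fin n → F) ≃ₗ[F] (Fin n → F), ∀ v, e v ⬝ᵥ y = v ⬝ᵥ x := by
  obtain ⟨w, hxw, hyw⟩ := exists_dotProduct_ne_zero hx hy
  let f : (Fin n → F) →ₗ[F] F := dotForm F (Fin n) x
  let g : (Fin n → F) →ₗ[F] F := dotForm F (Fin n) y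
  have hf : ∀ v, f v = x ⬝ᵥ v := fun _ => rfl
  have hg : ∀ v, g v = y ⬝ᵥ v := fun _ => rfl
  rw [← hf] at hxw
  rw [← hg] at hyw
  let φ : (Fin n → F) →ₗ[F] (Fin n → F) := LinearMap.id + ((f - g).smulRight ((g w)⁻¹ • w))
  have hφ : ∀ v, φ v = v + (f v - g v) • (g w)⁻¹ • w := fun v => rfl
  have hgφ : ∀ v, g (φ v) = f v := by
    intro v
    rw [hφ, map_add, map_smul, map_smul, smul_eq_mul, smul_eq_mul, inv_mul_cancel₀ hyw]
    ring
  have hinj : Function.Injective φ := by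
    rw [← LinearMap.ker_eq_bot, LinearMap.ker_eq_bot']
    intro v hv
    have h1 : f v = 0 := by rw [← hgφ, hv, map_zero]
    rw [hφ] at hv
    have h2 := congrArg f hv
    rw [map_add, map_smul, map_smul, map_zero, h1, zero_add, smul_eq_mul, smul_eq_mul] at h2
    have h3 := (mul_eq_zero.1 h2).resolve_right (mul_ne_zero (inv_ne_zero hyw) hxw)
    rw [h1, h3, zero_smul, add_zero] at hv
    exact hv
  refine ⟨LinearEquiv.ofInjectiveEndo φ hinj, fun v => ?_⟩
  rw [LinearEquiv.coe_ofInjectiveEndo, dotProduct_comm, dotProduct_comm v]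
  exact hgφ v

variable [Fintype F]

open Classical in
/-- Averaging: if the number of codes of a family that contain `x` is the same for all nonzero `x`,
then it is the expected one. -/
theorem card_filter_mem_le {G : Type*} [Fintype G] {C : G → Submodule F (Fin n → F)} {d : ℕ}
    (hd : ∀ A, Module.finrank F (C A) = d)
    (h : ∀ x ≠ 0, ∀ y ≠ 0, ∃ σ : G ≃ G, ∀ A, x ∈ C A ↔ y ∈ C (σ A)) {x : Fin n → F} (hx : x ≠ 0) :
    ((Finset.univ.filter fun A => x ∈ C A).card : ℝ) ≤
      (Fintype.card F : ℝ) ^ d / (Fintype.card F : ℝ) ^ n * Fintype.card G := by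
  set q := Fintype.card F with hq
  set m := (Finset.univ.filter fun A => x ∈ C A).card with hm
  have hq1 : 1 < q := Fintype.one_lt_card
  have hconst : ∀ y ≠ 0, (Finset.univ.filter fun A => y ∈ C A).card = m := by
    intro y hy
    obtain ⟨σ, hσ⟩ := h y hy x hx
    exact Finset.card_equiv σ fun A => by simp [hσ]
  have hcard : ∀ A, (Finset.univ.filter fun y : Fin n → F => y ≠ 0 ∧ y ∈ C A).card + 1 = q ^ d := by
    intro A
    have h1 : Fintype.card (C A) = q ^ d := by
      rw [← hd A]; exact Module.card_eq_pow_finrank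
    rw [← h1, Fintype.card_subtype, ← Finset.card_erase_add_one
      (a := (0 : Fin n → F)) (by simp : (0 : Fin n → F) ∈ Finset.univ.filter fun y => y ∈ C A)]
    congr 2
    ext y
    simp
  have hV : (Finset.univ.filter fun y : Fin n → F => y ≠ 0).card + 1 = q ^ n := by
    have h1 : Fintype.card (Fin n → F) = q ^ n := by simp [hq]
    rw [← h1, ← Finset.card_univ, ← Finset.card_erase_add_one (Finset.mem_univ (0 : Fin n → F))]
    congr 2
    ext y
    simp
  have hdouble : m * (q ^ n - 1) = Fintype.card G * (q ^ d - 1) := by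
    have h1 := Finset.sum_card_bipartiteAbove_eq_sum_card_bipartiteBelow
      (s := Finset.univ.filter fun y : Fin n → F => y ≠ 0) (t := (Finset.univ : Finset G))
      (fun y A => y ∈ C A)
    have h2 : ∀ y ∈ Finset.univ.filter fun y : Fin n → F => y ≠ 0,
        (Finset.bipartiteAbove (fun y A => y ∈ C A) (Finset.univ : Finset G) y).card = m :=
      fun y hy => hconst y (Finset.mem_filter.1 hy).2
    have h3 : ∀ A ∈ (Finset.univ : Finset G), (Finset.bipartiteBelow (fun y A => y ∈ C A)
        (Finset.univ.filter fun y : Fin n → F => y ≠ 0) A).card = q ^ d - 1 := by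
      intro A _
      rw [← hcard A, Nat.add_sub_cancel, Finset.bipartiteBelow, Finset.filter_filter]
    rw [Finset.sum_congr rfl h2, Finset.sum_congr rfl h3] at h1
    simp only [Finset.sum_const, smul_eq_mul, Finset.card_univ] at h1
    rw [← hV, Nat.add_sub_cancel, mul_comm]
    exact h1
  have hn : 0 < n := by
    rcases Nat.eq_zero_or_pos n with rfl | hn
    · exact absurd (Subsingleton.elim x 0) hx
    · exact hn
  have hqn : (1 : ℝ) < (q : ℝ) ^ n := one_lt_pow₀ (by exact_mod_cast hq1) hn.ne'
  have hreal : (m : ℝ) * ((q : ℝ) ^ n - 1) = Fintype.card G * ((q : ℝ) ^ d - 1) := by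
    have h1 : ((q ^ n - 1 : ℕ) : ℝ) = (q : ℝ) ^ n - 1 := by
      rw [Nat.cast_sub (Nat.one_le_pow _ _ (by omega))]; push_cast; rfl
    have h2 : ((q ^ d - 1 : ℕ) : ℝ) = (q : ℝ) ^ d - 1 := by
      rw [Nat.cast_sub (Nat.one_le_pow _ _ (by omega))]; push_cast; rfl
    rw [← h1, ← h2]
    exact_mod_cast hdouble
  rw [div_mul_eq_mul_div, le_div_iff₀ (by linarith)]
  have hmG : (m : ℝ) ≤ Fintype.card G := by
    exact_mod_cast Finset.card_le_univ _
  nlinarith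

/-- The image of a fixed pair `U₀ ≤ U₁` under a random linear automorphism is a good conjugate
pair. -/
theorem exists_good_conjugatePair {W : F → ℝ} (hW : W ∈ stdSimplex ℝ F) {m : ℕ} (hm : 2 * m ≤ n)
    {s : ℝ} (hs0 : 0 ≤ s) (hs1 : s ≤ 1) :
    ∃ C₁ C₂ : Submodule F (Fin n → F), IsConjugatePair C₁ C₂ (n - 2 * m) ∧
      ∃ g₁ g₂ : (Fin n → F) → (Fin n → F), IsSyndromeDecoder C₁ g₁ ∧ IsSyndromeDecoder C₂ g₂ ∧
        max (decodingErrorProb W (dualCode C₂) g₁) (decodingErrorProb W (dualCode C₁) g₂) ≤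
          2 * ((∑ x, W x ^ (1 - s)) ^ n * (((Fintype.card F : ℝ) ^ m)⁻¹) ^ s) := by
  classical
  let G := (Fin n → F) ≃ₗ[F] (Fin n → F)
  have : Finite G := DFunLike.finite _
  let _ : Fintype G := Fintype.ofFinite G
  have hfr : Module.finrank F (Fin n → F) = n := by simp
  obtain ⟨U₁, hU₁⟩ := exists_submodule_finrank_eq (K := F) (V := Fin n → F) (m := n - m)
    (by omega)
  obtain ⟨U₀', hU₀'⟩ := exists_submodule_finrank_eq (K := F) (V := U₁) (m := m) (by omega)
  let U₀ := U₀'.map U₁.subtype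
  have hU₀ : Module.finrank F U₀ = m := by
    rw [← hU₀']
    exact (Submodule.equivMapOfInjective _ U₁.injective_subtype U₀').finrank_eq.symm
  have hU : U₀ ≤ U₁ := Submodule.map_subtype_le _ _
  let C₁ : G → Submodule F (Fin n → F) := fun A => U₁.map (A : (Fin n → F) →ₗ[F] (Fin n → F))
  let B : G → Submodule F (Fin n → F) := fun A => U₀.map (A : (Fin n → F) →ₗ[F] (Fin n → F))
  let C₂ : G → Submodule F (Fin n → F) := fun A => dualCode (B A)
  have hd₁ : ∀ A, Module.finrank F (C₁ A) = n - m := fun A => by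
    rw [← hU₁]; exact (A.submoduleMap U₁).finrank_eq.symm
  have hdB : ∀ A, Module.finrank F (B A) = m := fun A => by
    rw [← hU₀]; exact (A.submoduleMap U₀).finrank_eq.symm
  have hd₂ : ∀ A, Module.finrank F (C₂ A) = n - m := fun A => by
    have h1 := finrank_add_finrank_dualCode (B A)
    rw [hdB, Fintype.card_fin] at h1
    change Module.finrank F (dualCode (B A)) = n - m
    omega
  have hpair : ∀ A, IsConjugatePair (C₁ A) (C₂ A) (n - 2 * m) := fun A =>
    ⟨by rw [dualCode_dualCode]; exact Submodule.map_mono hU, by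
      rw [hd₁, hd₂, Fintype.card_fin]; omega⟩
  have ht₁ : ∀ x ≠ 0, ∀ y ≠ 0, ∃ σ : G ≃ G, ∀ A, x ∈ C₁ A ↔ y ∈ C₁ (σ A) := by
    intro x hx y hy
    obtain ⟨e, he⟩ := exists_linearEquiv_apply_eq hx hy
    refine ⟨Equiv.mulLeft e, fun A => ?_⟩
    simp only [C₁, Submodule.mem_map, Equiv.coe_mulLeft]
    refine exists_congr fun u => and_congr_right fun _ => ?_
    rw [← he]
    exact e.injective.eq_iff.symm
  have ht₂ : ∀ x ≠ 0, ∀ y ≠ 0, ∃ σ : G ≃ G, ∀ A, x ∈ C₂ A ↔ y ∈ C₂ (σ A) := by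
    intro x hx y hy
    obtain ⟨e, he⟩ := exists_linearEquiv_dotProduct_eq hx hy
    refine ⟨Equiv.mulLeft e, fun A => ?_⟩
    have h1 : ∀ (A : G) z, z ∈ C₂ A ↔ ∀ u ∈ U₀, A u ⬝ᵥ z = 0 := by
      intro A z
      simp only [C₂, B, mem_dualCode, Submodule.mem_map, forall_exists_index, and_imp,
        forall_apply_eq_imp_iff₂]
      rfl
    rw [h1, h1]
    refine forall₂_congr fun u _ => ?_
    rw [← he]
    rfl
  have hq : (0 : ℝ) < Fintype.card F := by exact_mod_cast Fintype.card_pos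
  have hρ : (Fintype.card F : ℝ) ^ (n - m) / (Fintype.card F : ℝ) ^ n =
      ((Fintype.card F : ℝ) ^ m)⁻¹ := by
    rw [div_eq_iff (by positivity), inv_mul_eq_div, eq_div_iff (by positivity), ← pow_add]
    congr 1
    omega
  have hs₁ := sum_mlBound_le hW C₁ (s := s) (by positivity) hs0 hs1
    fun x hx => card_filter_mem_le hd₁ ht₁ hx
  have hs₂ := sum_mlBound_le hW C₂ (s := s) (by positivity) hs0 hs1
    fun x hx => card_filter_mem_le hd₂ ht₂ hx
  rw [hρ, Fintype.card_fin] at hs₁ hs₂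
  choose g₁ hg₁ hP₁ using fun A => exists_mlDecoder W hW.1 (C₁ A)
  choose g₂ hg₂ hP₂ using fun A => exists_mlDecoder W hW.1 (C₂ A)
  have hne : (Finset.univ : Finset G).Nonempty := ⟨1, Finset.mem_univ _⟩
  obtain ⟨A, -, hA⟩ := Finset.exists_le_of_sum_le hne
    (f := fun A => decodingErrorProb W (dualCode (C₂ A)) (g₁ A) +
      decodingErrorProb W (dualCode (C₁ A)) (g₂ A))
    (g := fun _ => 2 * ((∑ x, W x ^ (1 - s)) ^ n * (((Fintype.card F : ℝ) ^ m)⁻¹) ^ s)) (by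
      rw [Finset.sum_add_distrib, Finset.sum_const, Finset.card_univ, nsmul_eq_mul]
      have h1 := (Finset.sum_le_sum fun A (_ : A ∈ Finset.univ) =>
        hP₁ A (dualCode (C₂ A))).trans hs₁
      have h2 := (Finset.sum_le_sum fun A (_ : A ∈ Finset.univ) =>
        hP₂ A (dualCode (C₁ A))).trans hs₂
      linarith)
  refine ⟨C₁ A, C₂ A, hpair A, g₁ A, g₂ A, hg₁ A, hg₂ A, ?_⟩
  have h1 := decodingErrorProb_nonneg hW (dualCode (C₂ A)) (g₁ A)
  have h2 := decodingErrorProb_nonneg hW (dualCode (C₁ A)) (g₂ A)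
  exact max_le (by linarith) (by linarith)

end RandomCodes

/-! ### Concatenated pairs with generalized Reed-Solomon outer codes -/

section Packaging

variable {F : Type u} [Field F] [Fintype F]

/-- Both quotient codes of the pair have syndrome decoders of at most `p(N_o)` steps, and the error
probability of the pair with these decoders is at most `ε`. -/
def GRSConcatenation.HasDecoders (S : GRSConcatenation F) (W₁ W₂ : F → ℝ) (p : Polynomial ℕ)
    (ε : ℝ) : Prop :=
  ∃ g₁ g₂ : S.Word → S.Word, IsSyndromeDecoder S.L₁ g₁ ∧ IsSyndromeDecoder S.L₂ g₂ ∧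
    (∃ s, s ≤ p.eval S.length ∧ ComputableInSteps s g₁) ∧
    (∃ s, s ≤ p.eval S.length ∧ ComputableInSteps s g₂) ∧ S.errorProb W₁ W₂ g₁ g₂ ≤ ε

theorem GRSConcatenation.HasDecoders.mono {S : GRSConcatenation F} {W₁ W₂ : F → ℝ}
    {p : Polynomial ℕ} {ε ε' : ℝ} (h : S.HasDecoders W₁ W₂ p ε) (hε : ε ≤ ε') :
    S.HasDecoders W₁ W₂ p ε' := by
  obtain ⟨g₁, g₂, h1, h2, h3, h4, h5⟩ := h
  exact ⟨g₁, g₂, h1, h2, h3, h4, h5.trans hε⟩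

theorem IsConjugatePair.le_card {K ι : Type*} [Field K] [Fintype ι] {C₁ C₂ : Submodule K (ι → K)}
    {k : ℕ} (h : IsConjugatePair C₁ C₂ k) : k ≤ Fintype.card ι := by
  have h1 := Submodule.finrank_le C₁
  have h2 := Submodule.finrank_le C₂
  rw [Module.finrank_fintype_fun_eq_card] at h1 h2
  have := h.dim_eq
  omega

theorem half_pow_pos {q k : ℕ} (hq : 1 < q) (hk : 0 < k) : 0 < q ^ k / 2 :=
  Nat.div_pos ((Nat.succ_le_of_lt hq).trans (Nat.le_self_pow hk.ne' q)) two_pos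

theorem exists_trace_dual_bases {F K : Type*} [Field F] [Finite F] [Field K] [Algebra F K]
    [Finite K] {k : ℕ} (hK : Module.finrank F K = k) :
    ∃ β β' : Module.Basis (Fin k) F K,
      ∀ l m, Algebra.trace F K (β l * β' m) = if l = m then 1 else 0 := by
  have : Module.Finite F K := Module.Finite.of_finite
  let β' : Module.Basis (Fin k) F K := Module.finBasisOfFinrankEq F K hK
  refine ⟨β'.traceDual, β', fun l m => ?_⟩
  rw [Module.Basis.trace_traceDual_mul]
  simp only [eq_comm]

/-- Concatenation of a given inner pair with outer codes of length `2h`, where `h = ⌊q ^ k / 2⌋`, and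
dimensions `h + j`. The even length makes `j = 0` possible. The predicate `Q` transports properties
of the inner pair. -/
theorem exists_grsConcatenation {n k : ℕ} (hn : 0 < n) (hk : 0 < k)
    {C₁ C₂ : Submodule F (Fin n → F)} (hC : IsConjugatePair C₁ C₂ k) {h j : ℕ}
    (hh : h = Fintype.card F ^ k / 2) (hj : j ≤ h)
    (Q : ∀ n : ℕ, ℕ → Submodule F (Fin n → F) → Submodule F (Fin n → F) → Prop)
    (hQ : Q n k C₁ C₂) :
    ∃ S : GRSConcatenation F, Q S.n S.k S.C₁ S.C₂ ∧ IsConjugatePair S.L₁ S.L₂ S.dim ∧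
      S.length = n * (2 * h) ∧ S.dim = k * (2 * j) ∧
      (∀ W₁ ∈ stdSimplex ℝ F, ∀ W₂ ∈ stdSimplex ℝ F, ∀ g₁ g₂ : (Fin n → F) → (Fin n → F),
        IsSyndromeDecoder C₁ g₁ → IsSyndromeDecoder C₂ g₂ → ∀ x : ℝ,
        max (decodingErrorProb W₁ (dualCode C₂) g₁) (decodingErrorProb W₂ (dualCode C₁) g₂) ≤ x →
        ∀ c : ℕ, n ≤ c * k →
        S.HasDecoders W₁ W₂ (stepBound (Fintype.card F) c)
          (2 ^ (2 * h) * x ^ ((h - j) / 2 + 1))) ∧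
      (j = 0 → ∀ W₁ W₂ : F → ℝ, S.HasDecoders W₁ W₂ (stepBound (Fintype.card F) 0) 0) := by
  obtain ⟨K, iK, iA, hKd, hKf⟩ := exists_field_extension F hk
  have hKcard : Nat.card K = Fintype.card F ^ k := by
    rw [← hKd, ← Nat.card_eq_fintype_card]
    exact Module.natCard_eq_pow_finrank
  obtain ⟨β, β', hββ'⟩ := exists_trace_dual_bases hKd
  have hq : 1 < Fintype.card F := Fintype.one_lt_card
  have hh0 : 0 < h := hh ▸ half_pow_pos hq hk
  have hcard : Fintype.card F ^ k ≤ 2 * (2 * h) := by omega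
  obtain ⟨α⟩ : Nonempty (Fin (2 * h) ↪ K) := by
    have := Fintype.ofFinite K
    refine Function.Embedding.nonempty_of_card_le ?_
    rw [Fintype.card_fin, ← Nat.card_eq_fintype_card, hKcard]
    omega
  obtain ⟨D₁, D₂, hD₁, hD₂, hD⟩ := exists_grs_conjugatePair hj α.injective
  obtain ⟨g, g', h₁, h₂, hgg'⟩ := hC.exists_dual_vectors
  obtain ⟨L₁, L₂, hconc⟩ : ∃ L₁ L₂, IsConcatenation k C₁ C₂ D₁ D₂ L₁ L₂ :=
    ⟨_, _, g, g', β, β', h₁, h₂, hgg', hββ', rfl, rfl⟩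
  have hL : IsConjugatePair L₁ L₂ (k * (2 * j)) := hconc.isConjugatePair hD
  have hkn : k ≤ n := by simpa using hC.le_card
  let S : GRSConcatenation F :=
    { n := n, k := k, N := 2 * h, κ := 2 * j, κ₁ := h + j, n_pos := hn, k_pos := hk
      N_pos := by omega, C₁ := C₁, C₂ := C₂, inner_pair := hC, Ext := K
      extField := iK, extAlgebra := iA, D₁ := D₁, D₂ := D₂
      grs₁ := hD₁, grs₂ := hD₂, outer_pair := hD, L₁ := L₁, L₂ := L₂
      isConcatenation := hconc }
  refine ⟨S, hQ, hL, rfl, rfl, ?_, ?_⟩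
  · intro W₁ hW₁ W₂ hW₂ g₁ g₂ hg₁ hg₂ x hx c hc
    have hqn : Fintype.card F ^ n ≤ (2 * (2 * h)) ^ c := by
      calc Fintype.card F ^ n ≤ Fintype.card F ^ (k * c) :=
            Nat.pow_le_pow_right (by omega) (by rwa [mul_comm])
        _ = (Fintype.card F ^ k) ^ c := pow_mul _ _ _
        _ ≤ _ := Nat.pow_le_pow_left hcard c
    obtain ⟨G₁, h1, h2, h3⟩ := hconc.exists_decoder hn (by omega) hkn hD₁
      (t := (h - j) / 2) (by omega) hg₁ hW₁ hcard hqn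
    obtain ⟨G₂, h1', h2', h3'⟩ := hconc.symm.exists_decoder hn (by omega) hkn hD₂
      (t := (h - j) / 2) (by omega) hg₂ hW₂ hcard hqn
    refine ⟨G₁, G₂, h1, h1', h2, h2', max_le (h3.trans ?_) (h3'.trans ?_)⟩
    · refine mul_le_mul_of_nonneg_left (pow_le_pow_left₀ (decodingErrorProb_nonneg hW₁ _ _) ?_ _)
        (by positivity)
      exact (le_max_left _ _).trans hx
    · refine mul_le_mul_of_nonneg_left (pow_le_pow_left₀ (decodingErrorProb_nonneg hW₂ _ _) ?_ _)
        (by positivity)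
      exact (le_max_right _ _).trans hx
  · rintro rfl W₁ W₂
    obtain ⟨G₁, h1, h2, h3⟩ := exists_decoder_of_dual_eq hL.eq_dualCode W₁
    obtain ⟨G₂, h1', h2', h3'⟩ := exists_decoder_of_dual_eq hL.symm.eq_dualCode W₂
    exact ⟨G₁, G₂, h1, h1', h2, h2', max_le h3.le h3'.le⟩

end Packaging

/-! ### Asymptotics -/

theorem le_errorExponent {q L : ℕ} (hq : 1 < q) (hL : 0 < L) {P c : ℝ}
    (h : P ≤ (q : ℝ) ^ (-((L : ℝ) * c))) : (c : EReal) ≤ errorExponent q L P := by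
  have hq0 : (0 : ℝ) < q := by exact_mod_cast (by omega : 0 < q)
  have hlog : 0 < Real.log q := Real.log_pos (by exact_mod_cast hq)
  have hpos : 0 < (L : ℝ) * Real.log q := mul_pos (by exact_mod_cast hL) hlog
  rw [errorExponent, EReal.le_div_iff_mul_le (by exact_mod_cast hpos) (EReal.coe_ne_top _),
    ← EReal.neg_le_neg_iff, neg_neg]
  have h1 : ENNReal.log (ENNReal.ofReal P) ≤
      ENNReal.log (ENNReal.ofReal ((q : ℝ) ^ (-((L : ℝ) * c)))) :=
    ENNReal.log_monotone (ENNReal.ofReal_le_ofReal h)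
  refine h1.trans (le_of_eq ?_)
  rw [ENNReal.log_ofReal_of_pos (Real.rpow_pos_of_pos hq0 _), Real.log_rpow hq0, ← EReal.coe_mul,
    ← EReal.coe_neg]
  congr 1
  ring

section Parameters

variable {q : ℕ} {n k : ℕ → ℕ} {r : ℝ}

theorem tendsto_dim_atTop (hr : 0 < r) (hn : Tendsto n atTop atTop)
    (hk : Tendsto (fun i => (k i : ℝ) / n i) atTop (𝓝 r)) : Tendsto k atTop atTop := by
  have hn' : Tendsto (fun i => (n i : ℝ)) atTop atTop := tendsto_natCast_atTop_atTop.comp hn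
  have h1 := hk.pos_mul_atTop hr hn'
  refine tendsto_natCast_atTop_iff (R := ℝ).1 (h1.congr' ?_)
  filter_upwards [hn.eventually_gt_atTop 0] with i hi
  have : (n i : ℝ) ≠ 0 := by exact_mod_cast hi.ne'
  field_simp

theorem tendsto_half_pow_atTop (hq : 1 < q) (hk : Tendsto k atTop atTop) :
    Tendsto (fun i => q ^ k i / 2) atTop atTop :=
  (Nat.tendsto_div_const_atTop two_ne_zero).comp
    ((tendsto_pow_atTop_atTop_of_one_lt hq).comp hk)

theorem tendsto_floor_ratio {h : ℕ → ℕ} (hh : Tendsto h atTop atTop) {R : ℝ} (hR : 0 ≤ R) :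
    Tendsto (fun i => (⌊R * h i⌋₊ : ℝ) / h i) atTop (𝓝 R) :=
  (tendsto_nat_floor_mul_div_atTop hR).comp (tendsto_natCast_atTop_atTop.comp hh)

/-- The number of correctable errors, relative to the length `2h` of the outer code. -/
theorem tendsto_radius_ratio {h : ℕ → ℕ} (hh : Tendsto h atTop atTop) {R : ℝ} (hR : 0 ≤ R)
    (hR1 : R ≤ 1) :
    Tendsto (fun i => (((h i - ⌊R * h i⌋₊) / 2 + 1 : ℕ) : ℝ) / ((2 * h i : ℕ) : ℝ)) atTop
      (𝓝 ((1 - R) / 4)) := by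
  have hh' : Tendsto (fun i => (h i : ℝ)) atTop atTop := tendsto_natCast_atTop_atTop.comp hh
  have h1 := tendsto_floor_ratio hh hR
  have h2 : Tendsto (fun i => (1 - (⌊R * h i⌋₊ : ℝ) / h i) / 4) atTop (𝓝 ((1 - R) / 4)) :=
    (tendsto_const_nhds.sub h1).div_const 4
  have h3 : Tendsto (fun i => (1 - (⌊R * h i⌋₊ : ℝ) / h i) / 4 + 1 / (h i : ℝ)) atTop
      (𝓝 ((1 - R) / 4)) := by
    simpa using h2.add (tendsto_const_nhds.div_atTop hh' : Tendsto (fun i => 1 / (h i : ℝ)) _ _)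
  have hb : ∀ i, ((h i : ℝ) - ⌊R * h i⌋₊) / 2 ≤ (((h i - ⌊R * h i⌋₊) / 2 + 1 : ℕ) : ℝ) ∧
      (((h i - ⌊R * h i⌋₊) / 2 + 1 : ℕ) : ℝ) ≤ ((h i : ℝ) - ⌊R * h i⌋₊) / 2 + 1 := by
    intro i
    have hle : ⌊R * h i⌋₊ ≤ h i := Nat.floor_le_of_le (by
      nlinarith [(Nat.cast_nonneg (h i) : (0 : ℝ) ≤ h i)])
    rw [← Nat.cast_sub hle]
    set d := h i - ⌊R * h i⌋₊
    have e1 : d ≤ 2 * (d / 2 + 1) := by omega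
    have e2 : 2 * (d / 2 + 1) ≤ d + 2 := by omega
    have e1' : (d : ℝ) ≤ 2 * ((d / 2 + 1 : ℕ) : ℝ) := by exact_mod_cast e1
    have e2' : 2 * ((d / 2 + 1 : ℕ) : ℝ) ≤ d + 2 := by exact_mod_cast e2
    constructor <;> linarith
  refine tendsto_of_tendsto_of_tendsto_of_le_of_le' h2 h3 ?_ ?_
  · filter_upwards [hh.eventually_gt_atTop 0] with i hi
    have hpos : (0 : ℝ) < h i := by exact_mod_cast hi
    rw [le_div_iff₀ (by push_cast; linarith)]
    refine le_trans (le_of_eq ?_) (hb i).1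
    push_cast
    field_simp
    ring
  · filter_upwards [hh.eventually_gt_atTop 0] with i hi
    have hpos : (0 : ℝ) < h i := by exact_mod_cast hi
    rw [div_le_iff₀ (by push_cast; linarith)]
    refine (hb i).2.trans ?_
    push_cast
    field_simp
    nlinarith

theorem tendsto_rate {h : ℕ → ℕ} (hh : Tendsto h atTop atTop) {R : ℝ} (hR : 0 ≤ R)
    (hk : Tendsto (fun i => (k i : ℝ) / n i) atTop (𝓝 r)) :
    Tendsto (fun i => ((k i * (2 * ⌊R * h i⌋₊) : ℕ) : ℝ) / ((n i * (2 * h i) : ℕ) : ℝ)) atTop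
      (𝓝 (r * R)) := by
  refine (hk.mul (tendsto_floor_ratio hh hR)).congr fun i => ?_
  push_cast
  rw [div_mul_div_comm, mul_left_comm (k i : ℝ), mul_left_comm (n i : ℝ),
    mul_div_mul_left _ _ (two_ne_zero)]

theorem eventually_le_mul_dim (hr : 0 < r) (hn : Tendsto n atTop atTop)
    (hk : Tendsto (fun i => (k i : ℝ) / n i) atTop (𝓝 r)) {c : ℕ} (hc : 2 ≤ c * r) :
    ∀ᶠ i in atTop, n i ≤ c * k i := by
  filter_upwards [hk.eventually_const_lt (half_lt_self hr), hn.eventually_gt_atTop 0] with i hi hn0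
  have hpos : (0 : ℝ) < n i := by exact_mod_cast hn0
  rw [lt_div_iff₀ hpos] at hi
  have : (n i : ℝ) ≤ c * k i := by
    have hc0 : (0 : ℝ) ≤ c := Nat.cast_nonneg _
    nlinarith [mul_le_mul_of_nonneg_left hi.le hc0]
  exact_mod_cast this

theorem eventually_polynomial_le_rpow (hq : 1 < q) (p : Polynomial ℝ) {δ : ℝ} (hδ : 0 < δ) :
    ∀ᶠ n : ℕ in atTop, p.eval (n : ℝ) ≤ (q : ℝ) ^ (δ * n) := by
  have hq0 : (0 : ℝ) < q := by exact_mod_cast (by omega : 0 < q)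
  have hb : 0 < δ * Real.log q := mul_pos hδ (Real.log_pos (by exact_mod_cast hq))
  have h1 := (p.comp (Polynomial.C (δ * Real.log q)⁻¹ * Polynomial.X)).tendsto_div_exp_atTop
  have h2 : Tendsto (fun n : ℕ => δ * Real.log q * (n : ℝ)) atTop atTop :=
    tendsto_natCast_atTop_atTop.const_mul_atTop hb
  filter_upwards [(h1.comp h2).eventually_lt_const one_pos] with n hn
  simp only [Function.comp_apply, Polynomial.eval_comp, Polynomial.eval_mul, Polynomial.eval_C,
    Polynomial.eval_X] at hn
  rw [inv_mul_cancel_left₀ hb.ne', div_lt_one (Real.exp_pos _)] at hn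
  rw [Real.rpow_def_of_pos hq0]
  refine hn.le.trans (le_of_eq ?_)
  congr 1
  ring

end Parameters

section ErrorExponent

variable {F : Type u} [Field F] [Fintype F]

/-- Concatenation at inner rate near `r` and outer rate near `R`, with an error exponent near
`(1 - R) E((1 + r) / 2) / 4`: the outer code corrects a fraction `(1 - R) / 4` of the symbols. The
degree of the polynomial that bounds the complexity depends on `r` only, through `c`. -/
theorem exists_concatenation_of_attainsBound {W₁ W₂ : F → ℝ} {E : ℝ → ℝ} {a : ℕ → ℝ}
    (hW₁ : W₁ ∈ stdSimplex ℝ F) (hW₂ : W₂ ∈ stdSimplex ℝ F)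
    (hE : ContinuousOn E (Set.Icc (1 / 2) 1)) {p : Polynomial ℝ}
    (hp : ∀ n : ℕ, a n ≤ p.eval (n : ℝ)) {n k : ℕ → ℕ} {r : ℝ} (hr : r ∈ Set.Ioo (0 : ℝ) 1)
    (hn : Tendsto n atTop atTop) (hk : Tendsto (fun j => (k j : ℝ) / n j) atTop (𝓝 r))
    (hC : ∀ j, ∃ C₁ C₂ : Submodule F (Fin (n j) → F), AttainsBound W₁ W₂ E a (k j) C₁ C₂)
    {R : ℝ} (hR : R ∈ Set.Icc (0 : ℝ) 1) {c : ℕ} (hc : 2 ≤ c * r) {v η : ℝ}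
    (hv : v < (1 - R) / 4 * E ((1 + r) / 2)) (hη : 0 < η) (J : ℕ) :
    ∃ S : GRSConcatenation F, AttainsBound W₁ W₂ E a S.k S.C₁ S.C₂ ∧
      IsConjugatePair S.L₁ S.L₂ S.dim ∧ J ≤ S.length ∧
      |(S.dim : ℝ) / S.length - r * R| < η ∧
      S.HasDecoders W₁ W₂ (stepBound (Fintype.card F) c)
        ((Fintype.card F : ℝ) ^ (-((S.length : ℝ) * v))) := by
  choose C₁ C₂ hC using hC
  have hq : 1 < Fintype.card F := Fintype.one_lt_card
  set q := Fintype.card F with hqdef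
  have hq0 : (0 : ℝ) < q := by exact_mod_cast (by omega : 0 < q)
  have hq1 : (1 : ℝ) < q := by exact_mod_cast hq
  have hk' := tendsto_dim_atTop hr.1 hn hk
  set h : ℕ → ℕ := fun i => q ^ k i / 2 with hdef
  have hh : Tendsto h atTop atTop := tendsto_half_pow_atTop hq hk'
  set j : ℕ → ℕ := fun i => ⌊R * h i⌋₊ with jdef
  have hn' : Tendsto (fun i => (n i : ℝ)) atTop atTop := tendsto_natCast_atTop_atTop.comp hn
  -- The exponents of the inner codes.
  have hEt : Tendsto (fun i => E ((1 + (k i : ℝ) / n i) / 2)) atTop (𝓝 (E ((1 + r) / 2))) := by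
    have hmem : (1 + r) / 2 ∈ Set.Icc (1 / 2 : ℝ) 1 :=
      ⟨by linarith [hr.1], by linarith [hr.2]⟩
    refine (hE _ hmem).tendsto.comp (tendsto_nhdsWithin_iff.2
      ⟨(hk.const_add 1).div_const 2, Eventually.of_forall fun i => ?_⟩)
    have h1 : (0 : ℝ) ≤ (k i : ℝ) / n i := by positivity
    have h2 : (k i : ℝ) / n i ≤ 1 := by
      refine div_le_one_of_le₀ ?_ (Nat.cast_nonneg _)
      have := (hC i).1.le_card
      rw [Fintype.card_fin] at this
      exact_mod_cast this
    exact ⟨by linarith, by linarith⟩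
  set δ : ℝ := (1 - R) / 4 * E ((1 + r) / 2) - v with hδ
  have hδ0 : 0 < δ := sub_pos.2 hv
  have hlim : Tendsto (fun i => (((h i - j i) / 2 + 1 : ℕ) : ℝ) / ((2 * h i : ℕ) : ℝ) *
      (E ((1 + (k i : ℝ) / n i) / 2) - δ) - Real.logb q 2 / n i) atTop
      (𝓝 ((1 - R) / 4 * (E ((1 + r) / 2) - δ) - 0)) :=
    ((tendsto_radius_ratio hh hR.1 hR.2).mul (hEt.sub_const δ)).sub
      (tendsto_const_nhds.div_atTop hn')
  have hlt : v < (1 - R) / 4 * (E ((1 + r) / 2) - δ) - 0 := by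
    have h1 : (1 - R) / 4 * δ < δ := by nlinarith [hR.1]
    have h2 : (1 - R) / 4 * E ((1 + r) / 2) = δ + v := by rw [hδ]; ring
    nlinarith
  have hrate := (tendsto_rate (k := k) (n := n) hh hR.1 hk).eventually
    (Metric.ball_mem_nhds (r * R) hη)
  obtain ⟨i, hi1, hi2, hi3, hi4, hi5, hi6, hi7, hi8⟩ :=
    (hlim.eventually_const_lt hlt |>.and <| hn.eventually_gt_atTop 0 |>.and <|
      hk'.eventually_gt_atTop 0 |>.and <| hh.eventually_gt_atTop 0 |>.and <|
      (hn.eventually (eventually_polynomial_le_rpow hq p hδ0)) |>.and <|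
      eventually_le_mul_dim hr.1 hn hk hc |>.and <| hrate.and <|
      hn.eventually_ge_atTop J).exists
  have hji : j i ≤ h i := Nat.floor_le_of_le (by
    nlinarith [(Nat.cast_nonneg (h i) : (0 : ℝ) ≤ h i), hR.2])
  obtain ⟨hpair, g₁, g₂, hg₁, hg₂, hg⟩ := hC i
  obtain ⟨S, hS, hSL, hlen, hdim, hdec, -⟩ := exists_grsConcatenation hi2 hi3 hpair rfl hji
    (fun _ k C₁ C₂ => AttainsBound W₁ W₂ E a k C₁ C₂) (hC i)
  refine ⟨S, hS, hSL, ?_, ?_, ?_⟩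
  · rw [hlen]
    exact hi8.trans (Nat.le_mul_of_pos_right _ (Nat.mul_pos two_pos hi4))
  · rw [hlen, hdim]
    exact hi7
  · have hx : max (decodingErrorProb W₁ (dualCode (C₂ i)) g₁)
        (decodingErrorProb W₂ (dualCode (C₁ i)) g₂) ≤
        (q : ℝ) ^ (-((n i : ℝ) * (E ((1 + (k i : ℝ) / n i) / 2) - δ))) := by
      refine hg.trans ?_
      calc a (n i) * (q : ℝ) ^ (-((n i : ℝ) * E ((1 + (k i : ℝ) / n i) / 2)))
          ≤ (q : ℝ) ^ (δ * n i) * (q : ℝ) ^ (-((n i : ℝ) * E ((1 + (k i : ℝ) / n i) / 2))) :=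
            mul_le_mul_of_nonneg_right ((hp _).trans hi5) (by positivity)
        _ = _ := by
            rw [← Real.rpow_add hq0]
            congr 1
            ring
    refine (hdec W₁ hW₁ W₂ hW₂ g₁ g₂ hg₁ hg₂ _ hx c hi6).mono ?_
    rw [hlen]
    have hnpos : (0 : ℝ) < n i := by exact_mod_cast hi2
    have hhpos : (0 : ℝ) < ((2 * h i : ℕ) : ℝ) := by
      exact_mod_cast (by omega : 0 < 2 * h i)
    have h2 : (2 : ℝ) ^ (2 * h i) = (q : ℝ) ^ (Real.logb q 2 * ((2 * h i : ℕ) : ℝ)) := by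
      rw [Real.rpow_mul hq0.le, Real.rpow_logb hq0 hq1.ne' two_pos, Real.rpow_natCast]
    change (2 : ℝ) ^ (2 * h i) * _ ≤ _
    rw [h2, ← Real.rpow_natCast, ← Real.rpow_mul hq0.le, ← Real.rpow_add hq0]
    refine Real.rpow_le_rpow_of_exponent_le hq1.le ?_
    set T : ℝ := (((h i - j i) / 2 + 1 : ℕ) : ℝ) with hT
    set H : ℝ := ((2 * h i : ℕ) : ℝ) with hH
    set e : ℝ := E ((1 + (k i : ℝ) / n i) / 2) - δ
    have h3 := mul_lt_mul_of_pos_left hi1 (mul_pos hnpos hhpos)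
    have h4 : (n i : ℝ) * H * (T / H * e - Real.logb q 2 / n i) =
        n i * T * e - Real.logb q 2 * H := by
      field_simp
    rw [h4] at h3
    have h5 : ((n i * (2 * h i) : ℕ) : ℝ) = n i * H := by rw [hH]; push_cast; ring
    rw [h5]
    change Real.logb q 2 * H + -((n i : ℝ) * e) * T ≤ _
    nlinarith

end ErrorExponent

section BinarySymmetricChannel

theorem hasDerivAt_rpow_one_sub {x : ℝ} (hx : 0 ≤ x) :
    HasDerivAt (fun s : ℝ => x ^ (1 - s)) (-(x * Real.log x)) 0 := by
  rcases hx.eq_or_lt with rfl | hx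
  · simp only [zero_mul, neg_zero]
    refine (hasDerivAt_const (0 : ℝ) (0 : ℝ)).congr_of_eventuallyEq ?_
    filter_upwards [eventually_lt_nhds (one_pos : (0 : ℝ) < 1)] with s hs
    exact Real.zero_rpow (by linarith)
  · have h := ((hasDerivAt_id (0 : ℝ)).const_sub 1).const_rpow hx
    simpa [mul_comm] using h

/-- Above the entropy, the base of Gallager's bound is less than `1`: at `s = 0` it is `1`, with
derivative `h(p) - b < 0`. -/
theorem exists_gallager_base_lt_one {p b : ℝ} (hp : p ∈ Set.Icc (0 : ℝ) 1)
    (hb : Real.binEntropy p < b) :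
    ∃ s ∈ Set.Ioo (0 : ℝ) 1, ((1 - p) ^ (1 - s) + p ^ (1 - s)) * Real.exp (-(s * b)) < 1 := by
  have h1 := (hasDerivAt_rpow_one_sub (sub_nonneg.2 hp.2)).add (hasDerivAt_rpow_one_sub hp.1)
  have h2 : HasDerivAt (fun s : ℝ => Real.exp (-(s * b))) (-b) 0 := by
    have := (((hasDerivAt_id (0 : ℝ)).mul_const b).neg).exp
    simpa using this
  have h3 := h1.mul h2
  have hneg : (-((1 - p) * Real.log (1 - p)) + -(p * Real.log p)) * Real.exp (-(0 * b)) +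
      ((1 - p) ^ (1 - (0 : ℝ)) + p ^ (1 - (0 : ℝ))) * -b < 0 := by
    have : Real.binEntropy p = -((1 - p) * Real.log (1 - p)) + -(p * Real.log p) := by
      rw [Real.binEntropy, Real.log_inv, Real.log_inv]; ring
    simp
    linarith
  have h4 := h3.tendsto_slope_zero_right.eventually_lt_const hneg
  obtain ⟨s, hs, hs0, hs1⟩ := (h4.and (Ioo_mem_nhdsGT (one_pos : (0 : ℝ) < 1))).exists
  refine ⟨s, ⟨hs0, hs1⟩, ?_⟩
  have h5 : (s : ℝ)⁻¹ * (((1 - p) ^ (1 - s) + p ^ (1 - s)) * Real.exp (-(s * b)) - 1) < 0 := by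
    simpa using hs
  have h6 := (pos_iff_neg_of_mul_neg h5).1 (inv_pos.2 hs0)
  linarith

variable {F : Type u} [Field F] [Fintype F]

theorem sum_bsc_comp (hF : Fintype.card F = 2) (p : ℝ) (φ : ℝ → ℝ) :
    ∑ x, φ (bsc F p x) = φ (1 - p) + φ p := by
  classical
  have h1 : (Finset.univ : Finset F) = {0, 1} := by
    symm
    rw [← Finset.card_eq_iff_eq_univ, hF, Finset.card_pair zero_ne_one]
  rw [h1, Finset.sum_pair zero_ne_one]
  simp [bsc]

theorem bsc_mem_stdSimplex (hF : Fintype.card F = 2) {p : ℝ} (hp : p ∈ Set.Icc (0 : ℝ) 1) :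
    bsc F p ∈ stdSimplex ℝ F := by
  refine ⟨fun x => ?_, ?_⟩
  · rw [bsc]
    split_ifs
    exacts [sub_nonneg.2 hp.2, hp.1]
  · have := sum_bsc_comp hF p id
    simpa using this

/-- Inner pairs for the binary symmetric channel at any rate `r < 1 - 2h(p)`, of error probability
tending to `0`. -/
theorem exists_inner_bsc (hF : Fintype.card F = 2) {p : ℝ} (hp : p ∈ Set.Icc (0 : ℝ) 1) {r : ℝ}
    (hr : r ∈ Set.Ioo (0 : ℝ) 1) (hrp : r < 1 - 2 * (Real.binEntropy p / Real.log 2)) :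
    ∃ k : ℕ → ℕ, ∃ x : ℕ → ℝ, Tendsto (fun n => (k n : ℝ) / n) atTop (𝓝 r) ∧
      Tendsto x atTop (𝓝 0) ∧
      ∀ᶠ n in atTop, ∃ C₁ C₂ : Submodule F (Fin n → F), IsConjugatePair C₁ C₂ (k n) ∧
        ∃ g₁ g₂ : (Fin n → F) → (Fin n → F), IsSyndromeDecoder C₁ g₁ ∧ IsSyndromeDecoder C₂ g₂ ∧
        max (decodingErrorProb (bsc F p) (dualCode C₂) g₁)
          (decodingErrorProb (bsc F p) (dualCode C₁) g₂) ≤ x n := by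
  have hlog : 0 < Real.log 2 := Real.log_pos one_lt_two
  have hb : Real.binEntropy p < (1 - r) / 2 * Real.log 2 := by
    rw [← div_lt_iff₀ hlog]; linarith
  obtain ⟨s, hs, hlt⟩ := exists_gallager_base_lt_one hp hb
  set θ := ((1 - p) ^ (1 - s) + p ^ (1 - s)) * Real.exp (-(s * ((1 - r) / 2 * Real.log 2))) with hθ
  have hsum0 : 0 ≤ (1 - p) ^ (1 - s) + p ^ (1 - s) :=
    add_nonneg (Real.rpow_nonneg (sub_nonneg.2 hp.2) _) (Real.rpow_nonneg hp.1 _)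
  have hθ0 : 0 ≤ θ := mul_nonneg hsum0 (Real.exp_pos _).le
  let m : ℕ → ℕ := fun n => ⌈(1 - r) / 2 * n⌉₊
  have hr2 : 0 ≤ (1 - r) / 2 := by linarith [hr.2]
  have hm : Tendsto (fun n : ℕ => (m n : ℝ) / n) atTop (𝓝 ((1 - r) / 2)) :=
    (tendsto_nat_ceil_mul_div_atTop hr2).comp tendsto_natCast_atTop_atTop
  have hm2 : ∀ᶠ n : ℕ in atTop, 2 * m n ≤ n := by
    filter_upwards [hm.eventually_lt_const (by linarith [hr.1] : (1 - r) / 2 < 1 / 2),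
      eventually_gt_atTop 0] with n hn hn0
    have hpos : (0 : ℝ) < n := by exact_mod_cast hn0
    rw [div_lt_iff₀ hpos] at hn
    have : (2 : ℝ) * m n ≤ n := by linarith
    exact_mod_cast this
  refine ⟨fun n => n - 2 * m n, fun n => 2 * θ ^ n, ?_, ?_, ?_⟩
  · have h1 : Tendsto (fun n : ℕ => 1 - 2 * ((m n : ℝ) / n)) atTop (𝓝 r) := by
      have := (hm.const_mul 2).const_sub 1
      convert this using 2
      ring
    refine h1.congr' ?_
    filter_upwards [hm2, eventually_gt_atTop 0] with n hn hn0
    have hpos : (n : ℝ) ≠ 0 := by exact_mod_cast hn0.ne'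
    rw [Nat.cast_sub hn]
    push_cast
    field_simp
  · simpa using (tendsto_pow_atTop_nhds_zero_of_lt_one hθ0 hlt).const_mul 2
  · filter_upwards [hm2] with n hn
    obtain ⟨C₁, C₂, hC, g₁, g₂, hg₁, hg₂, hg⟩ :=
      exists_good_conjugatePair (bsc_mem_stdSimplex hF hp) hn hs.1.le hs.2.le
    refine ⟨C₁, C₂, hC, g₁, g₂, hg₁, hg₂, hg.trans ?_⟩
    rw [sum_bsc_comp hF p (fun y => y ^ (1 - s)), hF, hθ, mul_pow]
    refine mul_le_mul_of_nonneg_left (mul_le_mul_of_nonneg_left ?_ (pow_nonneg hsum0 n)) two_pos.le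
    have h2 : (((2 : ℕ) : ℝ) ^ m n)⁻¹ ^ s = Real.exp (-(s * (m n * Real.log 2))) := by
      rw [Real.rpow_def_of_pos (by positivity), Real.log_inv, Real.log_pow]
      congr 1
      push_cast
      ring
    rw [h2, ← Real.exp_nat_mul]
    refine Real.exp_le_exp.2 ?_
    have h3 : (1 - r) / 2 * n ≤ m n := Nat.le_ceil _
    have h4 := mul_le_mul_of_nonneg_right h3 (mul_nonneg hs.1.le hlog.le)
    nlinarith

/-- Inner pairs with vanishing error probability suffice: once it is below a constant that depends
on `R`, the outer code makes the error probability at most `2 ^ (-h)`, where `2h` is its length. -/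
theorem exists_concatenation_bsc (hF : Fintype.card F = 2) {p : ℝ} (hp : p ∈ Set.Icc (0 : ℝ) 1)
    {r : ℝ} (hr : r ∈ Set.Ioo (0 : ℝ) 1) (hrp : r < 1 - 2 * (Real.binEntropy p / Real.log 2))
    {R : ℝ} (hR : R ∈ Set.Ico (0 : ℝ) 1) {c : ℕ} (hc : 2 ≤ c * r) {η : ℝ} (hη : 0 < η) (J : ℕ) :
    ∃ S : GRSConcatenation F, IsConjugatePair S.L₁ S.L₂ S.dim ∧ J ≤ S.length ∧
      |(S.dim : ℝ) / S.length - r * R| < η ∧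
      S.HasDecoders (bsc F p) (bsc F p) (stepBound (Fintype.card F) c) η := by
  obtain ⟨k, x, hk, hx, hC⟩ := exists_inner_bsc hF hp hr hrp
  have hW := bsc_mem_stdSimplex hF hp
  have hq : 1 < Fintype.card F := Fintype.one_lt_card
  have hn : Tendsto (fun i : ℕ => i) atTop atTop := tendsto_id
  have hk' := tendsto_dim_atTop hr.1 hn hk
  set h : ℕ → ℕ := fun i => Fintype.card F ^ k i / 2 with hdef
  have hh : Tendsto h atTop atTop := tendsto_half_pow_atTop hq hk'
  set j : ℕ → ℕ := fun i => ⌊R * h i⌋₊ with jdef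
  have hR2 : 0 < (1 - R) / 2 := by linarith [hR.2]
  -- An inner error probability at which the error probability of the outer code decays.
  obtain ⟨y, hy, hy0, hy1⟩ : ∃ y : ℝ, 4 * y ^ ((1 - R) / 2) < 1 / 2 ∧ 0 < y ∧ y < 1 := by
    have h1 : Tendsto (fun y : ℝ => 4 * y ^ ((1 - R) / 2)) (𝓝[>] 0) (𝓝 0) := by
      have h2 := (Real.continuousAt_rpow_const 0 ((1 - R) / 2) (Or.inr hR2.le)).tendsto
      rw [Real.zero_rpow hR2.ne'] at h2
      simpa using (h2.mono_left nhdsWithin_le_nhds).const_mul 4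
    exact ((h1.eventually_lt_const (by norm_num : (0 : ℝ) < 1 / 2)).and
      (Ioo_mem_nhdsGT (one_pos : (0 : ℝ) < 1))).exists
  have hhalf : Tendsto (fun i => (1 / 2 : ℝ) ^ h i) atTop (𝓝 0) :=
    (tendsto_pow_atTop_nhds_zero_of_lt_one (by norm_num) (by norm_num)).comp hh
  have hrate := (tendsto_rate (k := k) (n := fun i => i) hh hR.1 hk).eventually
    (Metric.ball_mem_nhds (r * R) hη)
  obtain ⟨i, hi1, hi2, hi3, hi4, hi5, hi6, hi7, hi8, hi9⟩ :=
    (hx.eventually_lt_const hy0 |>.and <| hn.eventually_gt_atTop 0 |>.and <|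
      hk'.eventually_gt_atTop 0 |>.and <| hh.eventually_gt_atTop 0 |>.and <|
      hhalf.eventually_lt_const hη |>.and <|
      eventually_le_mul_dim hr.1 hn hk hc |>.and <| hrate.and <|
      hn.eventually_ge_atTop J |>.and hC).exists
  have hfl : (j i : ℝ) ≤ R * h i := Nat.floor_le (mul_nonneg hR.1 (Nat.cast_nonneg _))
  have hji : j i ≤ h i := by
    have : (j i : ℝ) ≤ h i :=
      hfl.trans (mul_le_of_le_one_left (Nat.cast_nonneg _) hR.2.le)
    exact_mod_cast this
  obtain ⟨C₁, C₂, hpair, g₁, g₂, hg₁, hg₂, hg⟩ := hi9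
  obtain ⟨S, -, hSL, hlen, hdim, hdec, -⟩ := exists_grsConcatenation hi2 hi3 hpair rfl hji
    (fun _ _ _ _ => True) trivial
  refine ⟨S, hSL, ?_, ?_, ?_⟩
  · rw [hlen]
    exact hi8.trans (Nat.le_mul_of_pos_right _ (Nat.mul_pos two_pos hi4))
  · rw [hlen, hdim]
    exact hi7
  · refine (hdec _ hW _ hW g₁ g₂ hg₁ hg₂ y (hg.trans hi1.le) c hi6).mono (le_trans ?_ hi5.le)
    change (2 : ℝ) ^ (2 * h i) * y ^ ((h i - j i) / 2 + 1) ≤ _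
    have h1 : y ^ ((h i - j i) / 2 + 1) ≤ (y ^ ((1 - R) / 2)) ^ h i := by
      rw [← Real.rpow_natCast, ← Real.rpow_natCast, ← Real.rpow_mul hy0.le]
      refine Real.rpow_le_rpow_of_exponent_ge hy0 hy1.le ?_
      have h2 : h i ≤ j i + 2 * ((h i - j i) / 2 + 1) := by omega
      have h3 : (h i : ℝ) ≤ j i + 2 * (((h i - j i) / 2 + 1 : ℕ) : ℝ) := by exact_mod_cast h2
      nlinarith
    calc (2 : ℝ) ^ (2 * h i) * y ^ ((h i - j i) / 2 + 1)
        ≤ 2 ^ (2 * h i) * (y ^ ((1 - R) / 2)) ^ h i :=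
          mul_le_mul_of_nonneg_left h1 (by positivity)
      _ = (4 * y ^ ((1 - R) / 2)) ^ h i := by rw [pow_mul, mul_pow]; norm_num
      _ ≤ (1 / 2) ^ h i := pow_le_pow_left₀ (by positivity) hy.le _

end BinarySymmetricChannel

/-! ### The sequences of concatenated pairs -/

theorem GRSConcatenation.length_pos {F : Type u} [Field F] (S : GRSConcatenation F) :
    0 < S.length :=
  Nat.mul_pos S.n_pos S.N_pos

section Sequences

variable {F : Type u} [Field F] [Fintype F]

theorem exists_sequence_of_forall_exists {W₁ W₂ : F → ℝ} {P : GRSConcatenation F → Prop} {ρ : ℝ}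
    {p : Polynomial ℕ} {ε : ℕ → GRSConcatenation F → ℝ}
    (h : ∀ J : ℕ, ∃ S, P S ∧ IsConjugatePair S.L₁ S.L₂ S.dim ∧ J ≤ S.length ∧
      |(S.dim : ℝ) / S.length - ρ| < 1 / ((J : ℝ) + 1) ∧ S.HasDecoders W₁ W₂ p (ε J S)) :
    ∃ (S : ℕ → GRSConcatenation F) (g₁ g₂ : (j : ℕ) → (S j).Word → (S j).Word),
      (∀ j, P (S j)) ∧ (∀ j, IsConjugatePair (S j).L₁ (S j).L₂ (S j).dim) ∧
      Tendsto (fun j => (S j).length) atTop atTop ∧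
      Tendsto (fun j => ((S j).dim : ℝ) / ((S j).length : ℝ)) atTop (𝓝 ρ) ∧
      (∀ j, (S j).errorProb W₁ W₂ (g₁ j) (g₂ j) ≤ ε j (S j)) ∧ ArePolynomialDecoders S g₁ g₂ := by
  choose S hP hS hJ hρ hD using h
  choose g₁ g₂ h1 h2 h3 h4 h5 using hD
  refine ⟨S, g₁, g₂, hP, hS, tendsto_atTop_mono hJ tendsto_id, ?_, h5,
    fun j => ⟨h1 j, h2 j⟩, p, fun j => ⟨h3 j, h4 j⟩⟩
  rw [tendsto_iff_dist_tendsto_zero]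
  exact squeeze_zero (fun _ => dist_nonneg) (fun j => (hρ j).le)
    tendsto_one_div_add_atTop_nhds_zero_nat

/-- Pairs of dimension `0`, that is, with `L₁ = L₂^⊥`: every error in the coset that the syndrome
determines is harmless, so a linear decoder never fails. -/
theorem exists_concatenation_dim_zero
    {Q : ∀ n : ℕ, ℕ → Submodule F (Fin n → F) → Submodule F (Fin n → F) → Prop} {r : ℝ} (hr : 0 < r)
    {n k : ℕ → ℕ} (hn : Tendsto n atTop atTop)
    (hk : Tendsto (fun j => (k j : ℝ) / n j) atTop (𝓝 r))
    (hC : ∀ j, ∃ C₁ C₂ : Submodule F (Fin (n j) → F), IsConjugatePair C₁ C₂ (k j) ∧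
      Q (n j) (k j) C₁ C₂) (W₁ W₂ : F → ℝ) (J : ℕ) :
    ∃ S : GRSConcatenation F, Q S.n S.k S.C₁ S.C₂ ∧ IsConjugatePair S.L₁ S.L₂ S.dim ∧
      J ≤ S.length ∧ S.dim = 0 ∧ S.HasDecoders W₁ W₂ (stepBound (Fintype.card F) 0) 0 := by
  obtain ⟨i, hi1, hi2, hi3⟩ := (hn.eventually_gt_atTop 0 |>.and <|
    (tendsto_dim_atTop hr hn hk).eventually_gt_atTop 0 |>.and <| hn.eventually_ge_atTop J).exists
  obtain ⟨C₁, C₂, hC, hQ⟩ := hC i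
  obtain ⟨S, hS, hL, hlen, hdim, -, hdec⟩ :=
    exists_grsConcatenation hi1 hi2 hC rfl (Nat.zero_le _) Q hQ
  refine ⟨S, hS, hL, ?_, by rw [hdim, mul_zero, mul_zero], hdec rfl W₁ W₂⟩
  rw [hlen]
  exact hi3.trans (Nat.le_mul_of_pos_right _
    (Nat.mul_pos two_pos (half_pow_pos Fintype.one_lt_card hi2)))

theorem exists_isGreatest_exponent {E : ℝ → ℝ} (hE : ContinuousOn E (Set.Icc (1 / 2) 1)) {R₀ : ℝ}
    (hR₀ : R₀ ∈ Set.Icc (0 : ℝ) 1) :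
    ∃ r ∈ Set.Icc (0 : ℝ) 1, ∃ R ∈ Set.Icc (0 : ℝ) 1, r * R = R₀ ∧
      IsGreatest {x : ℝ | ∃ r ∈ Set.Icc (0 : ℝ) 1, ∃ R ∈ Set.Icc (0 : ℝ) 1,
        r * R = R₀ ∧ x = (1 - R) * E ((1 + r) / 2)} ((1 - R) * E ((1 + r) / 2)) := by
  set K : Set (ℝ × ℝ) := (Set.Icc 0 1 ×ˢ Set.Icc 0 1) ∩ {x | x.1 * x.2 = R₀} with hK
  have hcomp : IsCompact K :=
    (isCompact_Icc.prod isCompact_Icc).inter_right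
      (isClosed_eq (continuous_fst.mul continuous_snd) continuous_const)
  have hne : K.Nonempty := ⟨(R₀, 1), ⟨hR₀, by simp⟩, mul_one R₀⟩
  have hcont : ContinuousOn (fun x : ℝ × ℝ => (1 - x.2) * E ((1 + x.1) / 2)) K := by
    refine ContinuousOn.mul (by fun_prop) (hE.comp (by fun_prop) ?_)
    rintro x ⟨⟨hx, -⟩, -⟩
    exact ⟨by linarith [hx.1], by linarith [hx.2]⟩
  obtain ⟨⟨r, R⟩, ⟨⟨hr, hR⟩, hrR⟩, hmax⟩ := hcomp.exists_isMaxOn hne hcont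
  refine ⟨r, hr, R, hR, hrR, ⟨r, hr, R, hR, hrR, rfl⟩, ?_⟩
  rintro _ ⟨r', hr', R', hR', hrR', rfl⟩
  exact hmax (show (r', R') ∈ K from ⟨⟨hr', hR'⟩, hrR'⟩)

theorem two_le_ceil_mul {x r : ℝ} (hx : 0 < x) (hr : x / 2 ≤ r) : 2 ≤ (⌈4 / x⌉₊ : ℝ) * r := by
  calc (2 : ℝ) = 4 / x * (x / 2) := by field_simp; norm_num
    _ ≤ ⌈4 / x⌉₊ * r := mul_le_mul (Nat.le_ceil _) hr (by positivity) (Nat.cast_nonneg _)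

/-- The concatenated pairs approach the exponent of any decomposition `R₀ = r R`. For `r > 0` the
inner rates approach `r` from below while staying above `r / 2`, so that one polynomial bounds the
complexity of all decoders. For `r = 0`, hence `R₀ = 0`, the alphabet of the outer codes would be
too small for decoding an inner code by table lookup in polynomial time; but then pairs of
dimension `0` have the required rate. -/
theorem exists_concatenation_near {W₁ W₂ : F → ℝ} {E : ℝ → ℝ} {a : ℕ → ℝ}
    (hW₁ : W₁ ∈ stdSimplex ℝ F) (hW₂ : W₂ ∈ stdSimplex ℝ F)
    (hE : ContinuousOn E (Set.Icc (1 / 2) 1))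
    (ha : ∃ p : Polynomial ℝ, ∀ n : ℕ, a n ≤ p.eval (n : ℝ))
    (hin : ∀ r ∈ Set.Ioo (0 : ℝ) 1, ∃ n k : ℕ → ℕ,
        Tendsto n atTop atTop ∧
        Tendsto (fun j => (k j : ℝ) / (n j : ℝ)) atTop (𝓝 r) ∧
        ∀ j, ∃ C₁ C₂ : Submodule F (Fin (n j) → F), AttainsBound W₁ W₂ E a (k j) C₁ C₂)
    {r R : ℝ} (hr : r ∈ Set.Icc (0 : ℝ) 1) (hR : R ∈ Set.Icc (0 : ℝ) 1) :
    ∃ p : Polynomial ℕ, ∀ J : ℕ, ∃ S : GRSConcatenation F,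
      AttainsBound W₁ W₂ E a S.k S.C₁ S.C₂ ∧ IsConjugatePair S.L₁ S.L₂ S.dim ∧ J ≤ S.length ∧
      |(S.dim : ℝ) / S.length - r * R| < 1 / ((J : ℝ) + 1) ∧
      S.HasDecoders W₁ W₂ p ((Fintype.card F : ℝ) ^
        (-((S.length : ℝ) * (1 / 4 * ((1 - R) * E ((1 + r) / 2)) - 1 / ((J : ℝ) + 1))))) := by
  obtain ⟨p, hp⟩ := ha
  rcases hr.1.eq_or_lt with rfl | hr0
  · refine ⟨stepBound (Fintype.card F) 0, fun J => ?_⟩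
    obtain ⟨n, k, hn, hk, hC⟩ := hin (1 / 2) ⟨by norm_num, by norm_num⟩
    obtain ⟨S, hQ, hL, hJ, hdim, hdec⟩ := exists_concatenation_dim_zero
      (Q := fun _ k C₁ C₂ => AttainsBound W₁ W₂ E a k C₁ C₂) (by norm_num) hn hk
      (fun j => let ⟨C₁, C₂, h⟩ := hC j; ⟨C₁, C₂, h.1, h⟩) W₁ W₂ J
    refine ⟨S, hQ, hL, hJ, ?_, hdec.mono (by positivity)⟩
    rw [hdim, Nat.cast_zero, zero_div, zero_mul, sub_zero, abs_zero]
    positivity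
  · refine ⟨stepBound (Fintype.card F) ⌈4 / r⌉₊, fun J => ?_⟩
    have hJ : (0 : ℝ) < 1 / ((J : ℝ) + 1) := by positivity
    have hmem : (1 + r) / 2 ∈ Set.Icc (1 / 2 : ℝ) 1 :=
      ⟨by linarith [hr.1], by linarith [hr.2]⟩
    have hIoo : ∀ᶠ x in 𝓝[<] r, x ∈ Set.Ioo (r / 2) r := Ioo_mem_nhdsLT (by linarith)
    have hid : Tendsto (fun x : ℝ => x) (𝓝[<] r) (𝓝 r) := tendsto_id.mono_left nhdsWithin_le_nhds
    have hEt : Tendsto (fun x => (1 - R) / 4 * E ((1 + x) / 2)) (𝓝[<] r)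
        (𝓝 ((1 - R) / 4 * E ((1 + r) / 2))) := by
      refine ((hE _ hmem).tendsto.comp (tendsto_nhdsWithin_iff.2
        ⟨(hid.const_add 1).div_const 2, ?_⟩)).const_mul _
      filter_upwards [hIoo] with x hx
      exact ⟨by linarith [hx.1], by linarith [hx.2, hr.2]⟩
    have hrate := (hid.mul_const R).eventually (Metric.ball_mem_nhds (r * R) (half_pos hJ))
    obtain ⟨x, hx, hxR, hxE⟩ := (hIoo.and <| hrate.and <| hEt.eventually_const_lt
      (show 1 / 4 * ((1 - R) * E ((1 + r) / 2)) - 1 / ((J : ℝ) + 1) <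
        (1 - R) / 4 * E ((1 + r) / 2) by linarith)).exists
    have hx01 : x ∈ Set.Ioo (0 : ℝ) 1 := ⟨by linarith [hx.1], by linarith [hx.2, hr.2]⟩
    obtain ⟨n, k, hn, hk, hC⟩ := hin x hx01
    obtain ⟨S, hQ, hL, hlen, hdim, hdec⟩ := exists_concatenation_of_attainsBound hW₁ hW₂ hE hp hx01
      hn hk hC hR (two_le_ceil_mul hr0 hx.1.le) hxE (half_pos hJ) J
    refine ⟨S, hQ, hL, hlen, ?_, hdec⟩
    have h1 := abs_sub_le ((S.dim : ℝ) / S.length) (x * R) (r * R)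
    have h2 : |x * R - r * R| < 1 / ((J : ℝ) + 1) / 2 := hxR
    linarith

/-- At rate `1 - 2h(p) > 0` the inner and the outer rates tend to `1 - 2h(p)` and `1`; at rate `0`
pairs of dimension `0` have no decoding errors. -/
theorem exists_concatenation_near_bsc (hF : Fintype.card F = 2) {p : ℝ}
    (hp : p ∈ Set.Icc (0 : ℝ) 1) (hρ : 0 ≤ 1 - 2 * (Real.binEntropy p / Real.log 2)) :
    ∃ P : Polynomial ℕ, ∀ J : ℕ, ∃ S : GRSConcatenation F,
      IsConjugatePair S.L₁ S.L₂ S.dim ∧ J ≤ S.length ∧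
      |(S.dim : ℝ) / S.length - (1 - 2 * (Real.binEntropy p / Real.log 2))| < 1 / ((J : ℝ) + 1) ∧
      S.HasDecoders (bsc F p) (bsc F p) P (1 / ((J : ℝ) + 1)) := by
  have hρ1 : 1 - 2 * (Real.binEntropy p / Real.log 2) ≤ 1 := by
    have := div_nonneg (Real.binEntropy_nonneg hp.1 hp.2) (Real.log_pos one_lt_two).le
    linarith
  obtain ⟨ρ, hρeq⟩ : ∃ ρ, ρ = 1 - 2 * (Real.binEntropy p / Real.log 2) := ⟨_, rfl⟩
  rw [← hρeq] at hρ hρ1 ⊢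
  rcases hρ.eq_or_lt with rfl | hρ0
  · refine ⟨stepBound (Fintype.card F) 0, fun J => ?_⟩
    have htop : ∀ n : ℕ, IsConjugatePair (⊤ : Submodule F (Fin n → F)) ⊤ n := fun n =>
      ⟨le_top, by simp⟩
    have hk : Tendsto (fun j : ℕ => (j : ℝ) / (j : ℝ)) atTop (𝓝 1) := by
      refine tendsto_const_nhds.congr' ?_
      filter_upwards [eventually_gt_atTop 0] with j hj
      rw [div_self (by exact_mod_cast hj.ne')]
    obtain ⟨S, -, hL, hJ, hdim, hdec⟩ := exists_concatenation_dim_zero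
      (Q := fun _ _ _ _ => True) one_pos tendsto_id hk (fun j => ⟨⊤, ⊤, htop j, trivial⟩)
      (bsc F p) (bsc F p) J
    refine ⟨S, hL, hJ, ?_, hdec.mono (by positivity)⟩
    rw [hdim, Nat.cast_zero, zero_div, sub_zero, abs_zero]
    positivity
  · refine ⟨stepBound (Fintype.card F) ⌈4 / ρ⌉₊, fun J => ?_⟩
    have hJ : (0 : ℝ) < 1 / ((J : ℝ) + 1) := by positivity
    have hIoo : ∀ᶠ x in 𝓝[<] ρ, x ∈ Set.Ioo (ρ / 2) ρ := Ioo_mem_nhdsLT (by linarith)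
    have hlim : Tendsto (fun x : ℝ => x * (x / ρ)) (𝓝[<] ρ) (𝓝 ρ) := by
      have h : ContinuousAt (fun x : ℝ => x * (x / ρ)) ρ := by fun_prop
      have h' := h.tendsto.mono_left (nhdsWithin_le_nhds (s := Set.Iio ρ))
      rwa [div_self hρ0.ne', mul_one] at h'
    obtain ⟨x, hx, hxρ⟩ := (hIoo.and <|
      hlim.eventually (Metric.ball_mem_nhds ρ (half_pos hJ))).exists
    have hx0 : 0 < x := by linarith [hx.1]
    obtain ⟨S, hL, hlen, hdim, hdec⟩ := exists_concatenation_bsc hF hp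
      (r := x) ⟨hx0, by linarith [hx.2]⟩ (hρeq ▸ hx.2) (R := x / ρ)
      ⟨by positivity, (div_lt_one hρ0).2 hx.2⟩ (two_le_ceil_mul hρ0 hx.1.le) (half_pos hJ) J
    refine ⟨S, hL, hlen, ?_, hdec.mono (by linarith)⟩
    have h1 := abs_sub_le ((S.dim : ℝ) / S.length) (x * (x / ρ)) ρ
    have h2 : |x * (x / ρ) - ρ| < 1 / ((J : ℝ) + 1) / 2 := hxρ
    linarith

theorem GRSConcatenation.errorProb_nonneg {S : GRSConcatenation F} {W₁ W₂ : F → ℝ}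
    (hW₁ : W₁ ∈ stdSimplex ℝ F) (g₁ g₂ : S.Word → S.Word) : 0 ≤ S.errorProb W₁ W₂ g₁ g₂ :=
  (decodingErrorProb_nonneg hW₁ _ g₁).trans (le_max_left _ _)

end Sequences

theorem theorem2 {F : Type u} [Field F] [Fintype F] :
    (∀ (W₁ W₂ : F → ℝ) (E : ℝ → ℝ) (a : ℕ → ℝ),
      W₁ ∈ stdSimplex ℝ F → W₂ ∈ stdSimplex ℝ F →
      ContinuousOn E (Set.Icc (1 / 2) 1) →
      (∃ p : Polynomial ℝ, ∀ n : ℕ, a n ≤ p.eval (n : ℝ)) →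
      (∀ r ∈ Set.Ioo (0 : ℝ) 1, ∃ n k : ℕ → ℕ,
        Tendsto n atTop atTop ∧
        Tendsto (fun j => (k j : ℝ) / (n j : ℝ)) atTop (𝓝 r) ∧
        ∀ j, ∃ C₁ C₂ : Submodule F (Fin (n j) → F), AttainsBound W₁ W₂ E a (k j) C₁ C₂) →
      ∀ R₀ ∈ Set.Icc (0 : ℝ) 1,
        ∃ (S : ℕ → GRSConcatenation F) (g₁ g₂ : (j : ℕ) → (S j).Word → (S j).Word),
          (∀ j, AttainsBound W₁ W₂ E a (S j).k (S j).C₁ (S j).C₂) ∧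
          (∀ j, IsConjugatePair (S j).L₁ (S j).L₂ (S j).dim) ∧
          Tendsto (fun j => (S j).length) atTop atTop ∧
          Tendsto (fun j => ((S j).dim : ℝ) / ((S j).length : ℝ)) atTop (𝓝 R₀) ∧
          (∃ M : ℝ,
            IsGreatest {x : ℝ | ∃ r ∈ Set.Icc (0 : ℝ) 1, ∃ R ∈ Set.Icc (0 : ℝ) 1,
              r * R = R₀ ∧ x = (1 - R) * E ((1 + r) / 2)} M ∧
            ((1 / 4 * M : ℝ) : EReal) ≤
              limsup (fun j => errorExponent (Fintype.card F) (S j).length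
                ((S j).errorProb W₁ W₂ (g₁ j) (g₂ j))) atTop) ∧
          ArePolynomialDecoders S g₁ g₂) ∧
    (Fintype.card F = 2 → ∀ p ∈ Set.Icc (0 : ℝ) 1, 0 ≤ 1 - 2 * (Real.binEntropy p / Real.log 2) →
      ∃ (S : ℕ → GRSConcatenation F) (g₁ g₂ : (j : ℕ) → (S j).Word → (S j).Word),
        (∀ j, IsConjugatePair (S j).L₁ (S j).L₂ (S j).dim) ∧
        Tendsto (fun j => (S j).length) atTop atTop ∧
        Tendsto (fun j => ((S j).dim : ℝ) / ((S j).length : ℝ)) atTop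
          (𝓝 (1 - 2 * (Real.binEntropy p / Real.log 2))) ∧
        Tendsto (fun j => (S j).errorProb (bsc F p) (bsc F p) (g₁ j) (g₂ j)) atTop (𝓝 0) ∧
        ArePolynomialDecoders S g₁ g₂) := by
  refine ⟨fun W₁ W₂ E a hW₁ hW₂ hE ha hin R₀ hR₀ => ?_, fun hF p hp hρ => ?_⟩
  · obtain ⟨r, hr, R, hR, rfl, hM⟩ := exists_isGreatest_exponent hE hR₀
    obtain ⟨p, hp⟩ := exists_concatenation_near hW₁ hW₂ hE ha hin hr hR
    obtain ⟨S, g₁, g₂, h1, h2, h3, h4, h5, h6⟩ := exists_sequence_of_forall_exists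
      (P := fun S => AttainsBound W₁ W₂ E a S.k S.C₁ S.C₂) hp
    refine ⟨S, g₁, g₂, h1, h2, h3, h4, ⟨_, hM, ?_⟩, h6⟩
    have hlim : Tendsto (fun j : ℕ =>
        ((1 / 4 * ((1 - R) * E ((1 + r) / 2)) - 1 / ((j : ℝ) + 1) : ℝ) : EReal)) atTop
        (𝓝 ((1 / 4 * ((1 - R) * E ((1 + r) / 2)) : ℝ) : EReal)) := by
      refine (continuous_coe_real_ereal.tendsto _).comp ?_
      simpa using (tendsto_one_div_add_atTop_nhds_zero_nat (𝕜 := ℝ)).const_sub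
        (1 / 4 * ((1 - R) * E ((1 + r) / 2)))
    rw [← hlim.limsup_eq]
    exact limsup_le_limsup (Eventually.of_forall fun j =>
      le_errorExponent Fintype.one_lt_card (S j).length_pos (h5 j))
  · obtain ⟨P, hP⟩ := exists_concatenation_near_bsc hF hp hρ
    obtain ⟨S, g₁, g₂, -, h2, h3, h4, h5, h6⟩ := exists_sequence_of_forall_exists
      (P := fun _ => True) fun J => (hP J).imp fun _ h => ⟨trivial, h⟩
    exact ⟨S, g₁, g₂, h2, h3, h4,
      squeeze_zero (fun j => (S j).errorProb_nonneg (bsc_mem_stdSimplex hF hp) _ _) h5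
        tendsto_one_div_add_atTop_nhds_zero_nat, h6⟩
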